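/- **Setting.** Let $F(X,Y,u)\in C^1(\mathbb R^3)$ be $2\pi$-periodic in $X$ and in $Y$ with $F(X,Y,0)=0$, let $\theta>1$, $\mathbb S^1=\mathbb R/2\pi\mathbb Z$, and for $\Delta\in\mathbb S^1$ consider $$\ddot u=F(x,\theta x+\Delta,u).\qquad(\ast_\Delta)$$ Write $\Delta^{\pm}=\Delta\pm2\theta\pi\in\mathbb S^1$. The map $\mathcal P$ sends the slice $\{\Delta\}\times\mathbb R^2$ to the slice $\{\Delta^+\}\times\mathbb R^2$: $\mathcal P(u_0,u_0')=(u(2\pi),\dot u(2\pi))$, where $u$ solves $(\ast_\Delta)$ with $u(0)=u_0$, $\dot u(0)=u_0'$. The map $\mathcal P^{-1}$ sends the slice $\Delta$ to the slice $\Delta^-$: $\mathcal P^{-1}(u_0,u_0')=(u(-2\pi),\dot u(-2\pi))$. Let $\mathscr U^\pm_\Delta$ be the sets of data in the slice $\Delta$ whose solution exists on $[0,2\pi]$, respectively on $[-2\pi,0]$, and $\mathscr U_\Delta=\mathscr U_\Delta^+\cap\mathscr U_\Delta^-$. A solution collapses at $x_c$ if $|u(x)|\to\infty$ as $x\to x_c$.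 "Increasing" and "decreasing" are not strict; $f$ is $\gamma$-Lipschitz if $|f(x)-f(y)|\le\gamma|x-y|$. **Islands, strips, donuts.** A $\gamma$-island in the slice $\Delta$ is an open curvilinear quadrangle $D_\Delta\subset\mathscr U_\Delta$ with two disjoint opposite sides $\alpha^\pm$, graphs $u'=h_\pm(u)$ of monotone $\gamma$-Lipschitz functions of the same type (both increasing or both decreasing), whose points give solutions collapsing at $x=-2\pi$, and two disjoint opposite sides $\beta^\pm$, graphs $u=v_\pm(u')$ of monotone $\gamma$-Lipschitz functions of the type opposite to that of $h_\pm$, whose points give solutions collapsing at $x=2\pi$. An $h_\gamma$-curve of the island joins $\beta^-$ to $\beta^+$ inside $\overline{D_\Delta}$ and is the graph $u'=h(u)$ of a monotone $\gamma$-Lipschitz function of the type of $h_\pm$; an $h_\gamma$-strip is the open part of the island between two disjoint $h_\gamma$-curves. $v_\gamma$-curves (graphs $u=v(u')$ of the type of $v_\pm$ that join $\alpha^-$ to $\alpha^+$) and $v_\gamma$-strips are defined likewise. The thickness $d_h(H)$ of an $h_\gamma$-strip bounded by the graphs of $h_1$ and $h_2$ is $\max|\tilde h_1-\tilde h_2|$,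 where $\tilde h_{1,2}$ are the continuations of $h_{1,2}$, constant beyond each end point, to the smallest interval containing both domains; $d_v$ is defined likewise. A $\gamma$-donut is a family of $\gamma$-islands $D_\Delta$, $\Delta\in\mathbb S^1$, whose sides depend continuously on $\Delta$ and keep their types of monotonicity. **Hypothesis.** Let $\mathcal A$ be a finite set and $\gamma\ge0$. For $i\in\mathcal A$ let $(D^i_\Delta)_\Delta$ be pairwise disjoint $\gamma$-donuts, and let $M$ be a constant with $d_h(D^i_\Delta)\le M$ and $d_v(D^i_\Delta)\le M$ for all $i,\Delta$ (the island being regarded as the strip between its $\alpha$-sides, respectively between its $\beta$-sides). Put $$V_{i,j}(\Delta)=\mathcal P^{-1}(D^j_{\Delta^+})\cap D^i_\Delta,\qquad H_{i,j}(\Delta)=\mathcal P(D^i_{\Delta^-})\cap D^j_\Delta ,$$ and assume $V_{i,j}(\Delta)\neq\emptyset$ for all $i,j\in\mathcal A$, $\Delta\in\mathbb S^1$. **Conditions.** For a pair of types of monotonicity (first type, second type), call the following sign patterns of a $2\times2$ matrix (strict signs) admitted: - (increasing, increasing): $\begin{pmatrix}+&+\\+&+\end{pmatrix}$, $\begin{pmatrix}-&-\\-&-\end{pmatrix}$;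 - (increasing, decreasing): $\begin{pmatrix}+&+\\-&-\end{pmatrix}$, $\begin{pmatrix}-&-\\+&+\end{pmatrix}$; - (decreasing, decreasing): $\begin{pmatrix}+&-\\-&+\end{pmatrix}$, $\begin{pmatrix}-&+\\+&-\end{pmatrix}$; - (decreasing, increasing): $\begin{pmatrix}+&-\\+&-\end{pmatrix}$, $\begin{pmatrix}-&+\\-&+\end{pmatrix}$. (H-1) For all $i,j,\Delta$, the map $\mathcal P$ is defined on $\overline{V_{i,j}(\Delta)}$ and at all points $\mathbf p$ of this set the matrices $\mathcal D\mathcal P_{\mathbf p}=(a_{mn})$ have one and the same sign pattern, admitted for (type of the $\alpha$-sides of $D^i$, type of the $\alpha$-sides of $D^j$). (H-2) For all $i,j,\Delta$ there is $\rho_h=\rho_h(i,j,\Delta)>1$ with $|a_{11}|\ge\rho_h$ at all points of $\overline{V_{i,j}(\Delta)}$. (V-1) For all $i,j,\Delta$, the map $\mathcal P^{-1}$ is defined on $\overline{H_{i,j}(\Delta)}$ and at all points $\mathbf q$ of this set the matrices $\mathcal D\mathcal P^{-1}_{\mathbf q}=(b_{mn})$ have one and the same sign pattern, admitted for (type of the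 $\beta$-sides of $D^j$, type of the $\beta$-sides of $D^i$). (V-2) For all $i,j,\Delta$ there is $\rho_v=\rho_v(i,j,\Delta)>1$ with $|b_{22}|\ge\rho_v$ at all points of $\overline{H_{i,j}(\Delta)}$. **Theorem.** (a) (H-1) and (H-2) imply: for all $i,j$ there is $\gamma_{ij}>0$, independent of $\Delta$, such that for every $\Delta$ and every $v_\gamma$-strip $V\subset D^j_\Delta$ the set $\widetilde V^i=\mathcal P^{-1}(V)\cap D^i_{\Delta^-}$ is a $v_{\gamma_{ij}}$-strip (V-i), and $d_v(\widetilde V^i)\le d_v(V)/\rho_h(i,j,\Delta^-)$ (V-ii). (b) Conversely, (V-1) and (V-2) imply: for all $i,j$ there is $\gamma_{ij}>0$, independent of $\Delta$, such that for every $\Delta$ and every $h_\gamma$-strip $H\subset D^i_\Delta$ the set $\widetilde H^j=\mathcal P(H)\cap D^j_{\Delta^+}$ is an $h_{\gamma_{ij}}$-strip (H-i), and $d_h(\widetilde H^j)\le d_h(H)/\rho_v(i,j,\Delta^+)$ (H-ii). -/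

import Mathlib

open Set Filter Topology

noncomputable section

namespace QuasiStrips

/-! ### The equation, the slices of the Poincare map and their domains -/

/-- `c = (u, u')` solves `u'' = F (x, θ x + Δ, u)` on `s` (written as a first order system).
The phase `Δ` lives on the circle `ℝ / 2πℤ`; for `F` that is `2π`-periodic in its second argument
the choice of the real representative of `Δ` is immaterial. -/
def IsSolution (F : ℝ → ℝ → ℝ → ℝ) (θ : ℝ) (Δ : Real.Angle) (s : Set ℝ) (c : ℝ → ℝ × ℝ) : Prop :=
  ∀ x ∈ s, HasDerivWithinAt c ((c x).2, F x (θ * x + Δ.toReal) (c x).1) s x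

/-- The solution with Cauchy data `p` at `x = 0` exists up to `x = T` (which may be negative)
and has Cauchy data `q` there. -/
def Reaches (F : ℝ → ℝ → ℝ → ℝ) (θ : ℝ) (Δ : Real.Angle) (T : ℝ) (p q : ℝ × ℝ) : Prop :=
  ∃ c : ℝ → ℝ × ℝ, IsSolution F θ Δ (uIcc 0 T) c ∧ c 0 = p ∧ c T = q

/-- The Cauchy data at `x = 0` whose solution exists on the closed interval from `0` to `T`. -/
def flowDomain (F : ℝ → ℝ → ℝ → ℝ) (θ : ℝ) (Δ : Real.Angle) (T : ℝ) : Set (ℝ × ℝ) :=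
  {p | ∃ q, Reaches F θ Δ T p q}

open Classical in
/-- The map from the Cauchy data at `x = 0` to those at `x = T`, with the value `(0, 0)` outside
`flowDomain F θ Δ T`. -/
def flow (F : ℝ → ℝ → ℝ → ℝ) (θ : ℝ) (Δ : Real.Angle) (T : ℝ) (p : ℝ × ℝ) : ℝ × ℝ :=
  if h : ∃ q, Reaches F θ Δ T p q then h.choose else (0, 0)

/-- The rotation of the circle by `2θπ`, under which the Poincare map permutes the slices. -/
def shift (θ : ℝ) : Real.Angle := ((2 * θ * Real.pi : ℝ) : Real.Angle)

/-- The domain of the Poincare map in the slice `Δ`. -/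
def domPlus (F : ℝ → ℝ → ℝ → ℝ) (θ : ℝ) (Δ : Real.Angle) : Set (ℝ × ℝ) :=
  flowDomain F θ Δ (2 * Real.pi)

/-- The domain of the inverse Poincare map in the slice `Δ`. -/
def domMinus (F : ℝ → ℝ → ℝ → ℝ) (θ : ℝ) (Δ : Real.Angle) : Set (ℝ × ℝ) :=
  flowDomain F θ Δ (-(2 * Real.pi))

/-- The Poincare map from the slice `Δ` to the slice `Δ + shift θ`. -/
def poincare (F : ℝ → ℝ → ℝ → ℝ) (θ : ℝ) (Δ : Real.Angle) : ℝ × ℝ → ℝ × ℝ :=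
  flow F θ Δ (2 * Real.pi)

/-- The inverse Poincare map from the slice `Δ` to the slice `Δ - shift θ`. -/
def poincareInv (F : ℝ → ℝ → ℝ → ℝ) (θ : ℝ) (Δ : Real.Angle) : ℝ × ℝ → ℝ × ℝ :=
  flow F θ Δ (-(2 * Real.pi))

/-- The solution with Cauchy data `p` at `x = 0` exists between `0` and `T` (`T` excluded), and
`|u(x)|` tends to infinity as `x` tends to `T`. -/
def CollapsesAt (F : ℝ → ℝ → ℝ → ℝ) (θ : ℝ) (Δ : Real.Angle) (T : ℝ) (p : ℝ × ℝ) : Prop :=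
  ∃ c : ℝ → ℝ × ℝ, IsSolution F θ Δ (uIcc 0 T \ {T}) c ∧ c 0 = p ∧
    Tendsto (fun x => |(c x).1|) (𝓝[uIcc 0 T \ {T}] T) atTop

/-! ### Monotone Lipschitz arcs -/

/-- The type of monotonicity. Monotonicity is not strict, so a constant function has both types. -/
inductive MonoType where
  | inc
  | dec

/-- The opposite type. -/
def MonoType.opp : MonoType → MonoType
  | .inc => .dec
  | .dec => .inc

/-- `f` has the given type of monotonicity on `s`. -/
def MonoType.On : MonoType → (ℝ → ℝ) → Set ℝ → Prop
  | .inc, f, s => MonotoneOn f s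
  | .dec, f, s => AntitoneOn f s

/-- A function on a compact interval `[lo, hi]`; only the values of `f` there matter. -/
structure Arc where
  lo : ℝ
  hi : ℝ
  le : lo ≤ hi
  f : ℝ → ℝ

namespace Arc

/-- The continuation of the function beyond `[lo, hi]` by its values at the end points. -/
def ext (a : Arc) (x : ℝ) : ℝ := a.f (max a.lo (min a.hi x))

/-- The graph `u' = f u` in the plane of the points `(u, u')`. -/
def hGraph (a : Arc) : Set (ℝ × ℝ) := {p | p.1 ∈ Icc a.lo a.hi ∧ p.2 = a.f p.1}

/-- The graph `u = f u'` in the plane of the points `(u, u')`. -/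
def vGraph (a : Arc) : Set (ℝ × ℝ) := {p | p.2 ∈ Icc a.lo a.hi ∧ p.1 = a.f p.2}

/-- The function is monotone of type `σ` and Lipschitz with constant `γ` on its interval. -/
def MonoLip (a : Arc) (γ : ℝ) (σ : MonoType) : Prop :=
  σ.On a.f (Icc a.lo a.hi) ∧
    ∀ x ∈ Icc a.lo a.hi, ∀ y ∈ Icc a.lo a.hi, |a.f x - a.f y| ≤ γ * |x - y|

/-- The `C`-norm distance of two continued functions on the smallest interval containing both
domains. -/
def dist (a b : Arc) : ℝ :=
  sSup ((fun x => |b.ext x - a.ext x|) '' Icc (min a.lo b.lo) (max a.hi b.hi))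

/-- A family of arcs depends continuously on the phase. -/
def ContinuousFamily (a : Real.Angle → Arc) : Prop :=
  Continuous (fun Δ => (a Δ).lo) ∧ Continuous (fun Δ => (a Δ).hi) ∧
    Continuous (fun z : Real.Angle × ℝ => (a z.1).ext z.2)

end Arc

/-! ### Curvilinear quadrangles, islands, donuts -/

/-- Four sides: the graphs `u' = αm u` (lower), `u' = αp u` (upper), `u = βm u'` (left) and
`u = βp u'` (right). -/
structure Quad where
  αm : Arc
  αp : Arc
  βm : Arc
  βp : Arc

/-- The open set enclosed by the four sides. -/
def Quad.region (Q : Quad) : Set (ℝ × ℝ) :=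
  {p | Q.αm.ext p.1 < p.2 ∧ p.2 < Q.αp.ext p.1 ∧ Q.βm.ext p.2 < p.1 ∧ p.1 < Q.βp.ext p.2}

/-- The four sides are monotone `γ`-Lipschitz graphs, opposite sides are of the same type (`σ` for
the `α`-sides and its opposite for the `β`-sides) and do not meet, and the sides close up at the
four corners. -/
structure Quad.IsQuadrangle (Q : Quad) (γ : ℝ) (σ : MonoType) : Prop where
  αm_mono : Q.αm.MonoLip γ σ
  αp_mono : Q.αp.MonoLip γ σ
  βm_mono : Q.βm.MonoLip γ σ.opp
  βp_mono : Q.βp.MonoLip γ σ.opp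
  α_lt : ∀ x, Q.αm.ext x < Q.αp.ext x
  β_lt : ∀ y, Q.βm.ext y < Q.βp.ext y
  corner_mm : Q.αm.f Q.αm.lo = Q.βm.lo ∧ Q.βm.f Q.βm.lo = Q.αm.lo
  corner_mp : Q.αm.f Q.αm.hi = Q.βp.lo ∧ Q.βp.f Q.βp.lo = Q.αm.hi
  corner_pm : Q.αp.f Q.αp.lo = Q.βm.hi ∧ Q.βm.f Q.βm.hi = Q.αp.lo
  corner_pp : Q.αp.f Q.αp.hi = Q.βp.hi ∧ Q.βp.f Q.βp.hi = Q.αp.hi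

/-- `Q` bounds a `γ`-island in the slice `Δ`, with `α`-sides of type `σ`. -/
structure Quad.IsIsland (Q : Quad) (F : ℝ → ℝ → ℝ → ℝ) (θ : ℝ) (Δ : Real.Angle) (γ : ℝ)
    (σ : MonoType) : Prop where
  quadrangle : Q.IsQuadrangle γ σ
  subset : Q.region ⊆ domPlus F θ Δ ∩ domMinus F θ Δ
  α_collapse : ∀ p ∈ Q.αm.hGraph ∪ Q.αp.hGraph, CollapsesAt F θ Δ (-(2 * Real.pi)) p
  β_collapse : ∀ p ∈ Q.βm.vGraph ∪ Q.βp.vGraph, CollapsesAt F θ Δ (2 * Real.pi) p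

/-- A `γ`-donut: a family of `γ`-islands, one in each slice, that depends continuously on the slice
and keeps the type of monotonicity of its sides. -/
structure IsDonut (F : ℝ → ℝ → ℝ → ℝ) (θ γ : ℝ) (σ : MonoType) (D : Real.Angle → Quad) : Prop where
  island : ∀ Δ, (D Δ).IsIsland F θ Δ γ σ
  αm_cont : Arc.ContinuousFamily fun Δ => (D Δ).αm
  αp_cont : Arc.ContinuousFamily fun Δ => (D Δ).αp
  βm_cont : Arc.ContinuousFamily fun Δ => (D Δ).βm
  βp_cont : Arc.ContinuousFamily fun Δ => (D Δ).βp

/-- The `D i`, `i ∈ A`, are pairwise disjoint `γ`-donuts (they form a `γ`-donut set), and the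
thicknesses of all their islands, seen as `h`-strips and as `v`-strips, have a common bound. -/
structure IsDonutSet {A : Type*} (F : ℝ → ℝ → ℝ → ℝ) (θ γ : ℝ) (σ : A → MonoType)
    (D : A → Real.Angle → Quad) : Prop where
  donut : ∀ i, IsDonut F θ γ (σ i) (D i)
  disjoint : ∀ i j, i ≠ j → ∀ Δ, Disjoint (D i Δ).region (D j Δ).region
  bounded : ∃ M : ℝ, ∀ i Δ,
    (D i Δ).αm.dist (D i Δ).αp ≤ M ∧ (D i Δ).βm.dist (D i Δ).βp ≤ M

/-! ### Curves and strips -/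

/-- An `h_γ`-curve of the quadrangle `Q` whose `α`-sides are of type `σ`: it joins the two
`β`-sides inside the closed quadrangle. -/
structure IsHCurve (γ : ℝ) (σ : MonoType) (Q : Quad) (a : Arc) : Prop where
  mono : a.MonoLip γ σ
  left : (a.lo, a.f a.lo) ∈ Q.βm.vGraph
  right : (a.hi, a.f a.hi) ∈ Q.βp.vGraph
  subset : a.hGraph ⊆ closure Q.region

/-- A `v_γ`-curve of the quadrangle `Q` whose `α`-sides are of type `σ`: it joins the two
`α`-sides inside the closed quadrangle. -/
structure IsVCurve (γ : ℝ) (σ : MonoType) (Q : Quad) (b : Arc) : Prop where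
  mono : b.MonoLip γ σ.opp
  bottom : (b.f b.lo, b.lo) ∈ Q.αm.hGraph
  top : (b.f b.hi, b.hi) ∈ Q.αp.hGraph
  subset : b.vGraph ⊆ closure Q.region

/-- An `h_γ`-strip, given by the two (disjoint) `h_γ`-curves that bound it. -/
structure HStrip (γ : ℝ) (σ : MonoType) (Q : Quad) where
  lower : Arc
  upper : Arc
  lower_curve : IsHCurve γ σ Q lower
  upper_curve : IsHCurve γ σ Q upper
  lt : ∀ x, lower.ext x < upper.ext x

/-- The open set of the points of the island between the two curves. -/
def HStrip.carrier {γ : ℝ} {σ : MonoType} {Q : Quad} (H : HStrip γ σ Q) : Set (ℝ × ℝ) :=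
  {p | p ∈ Q.region ∧ H.lower.ext p.1 < p.2 ∧ p.2 < H.upper.ext p.1}

/-- The thickness `d_h`. -/
def HStrip.thickness {γ : ℝ} {σ : MonoType} {Q : Quad} (H : HStrip γ σ Q) : ℝ :=
  H.lower.dist H.upper

/-- A `v_γ`-strip, given by the two (disjoint) `v_γ`-curves that bound it. -/
structure VStrip (γ : ℝ) (σ : MonoType) (Q : Quad) where
  left : Arc
  right : Arc
  left_curve : IsVCurve γ σ Q left
  right_curve : IsVCurve γ σ Q right
  lt : ∀ y, left.ext y < right.ext y

/-- The open set of the points of the island between the two curves. -/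
def VStrip.carrier {γ : ℝ} {σ : MonoType} {Q : Quad} (V : VStrip γ σ Q) : Set (ℝ × ℝ) :=
  {p | p ∈ Q.region ∧ V.left.ext p.2 < p.1 ∧ p.1 < V.right.ext p.2}

/-- The thickness `d_v`. -/
def VStrip.thickness {γ : ℝ} {σ : MonoType} {Q : Quad} (V : VStrip γ σ Q) : ℝ :=
  V.left.dist V.right

/-! ### The conditions on the linearization -/

section Conditions

variable {A : Type*} (F : ℝ → ℝ → ℝ → ℝ) (θ : ℝ) (σ : A → MonoType) (D : A → Real.Angle → Quad)

/-- `V_{ij}(Δ)`: the points of the island `i` in the slice `Δ` sent by the Poincare map to the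
island `j` in the next slice. -/
def vSet (i j : A) (Δ : Real.Angle) : Set (ℝ × ℝ) :=
  poincareInv F θ (Δ + shift θ) '' (D j (Δ + shift θ)).region ∩ (D i Δ).region

/-- `H_{ij}(Δ)`: the points of the island `j` in the slice `Δ` that come from the island `i` in the
preceding slice. -/
def hSet (i j : A) (Δ : Real.Angle) : Set (ℝ × ℝ) :=
  poincare F θ (Δ - shift θ) '' (D i (Δ - shift θ)).region ∩ (D j Δ).region

/-- The matrix of the linearization at `p` of a map of the plane. -/
def jacobian (f : ℝ × ℝ → ℝ × ℝ) (p : ℝ × ℝ) : Matrix (Fin 2) (Fin 2) ℝ :=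
  !![(fderiv ℝ f p (1, 0)).1, (fderiv ℝ f p (0, 1)).1;
     (fderiv ℝ f p (1, 0)).2, (fderiv ℝ f p (0, 1)).2]

/-- The entries of `M` have the signs `s`. -/
def HasSigns (M : Matrix (Fin 2) (Fin 2) ℝ) (s : Matrix (Fin 2) (Fin 2) SignType) : Prop :=
  ∀ m n, SignType.sign (M m n) = s m n

/-- The sign configurations that are admitted when the sides of the initial island are of the first
type and those of the target island of the second one. -/
def AdmittedSigns : MonoType → MonoType → Matrix (Fin 2) (Fin 2) SignType → Prop
  | .inc, .inc, s => s = !![1, 1; 1, 1] ∨ s = !![-1, -1; -1, -1]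
  | .inc, .dec, s => s = !![1, 1; -1, -1] ∨ s = !![-1, -1; 1, 1]
  | .dec, .dec, s => s = !![1, -1; -1, 1] ∨ s = !![-1, 1; 1, -1]
  | .dec, .inc, s => s = !![1, -1; 1, -1] ∨ s = !![-1, 1; -1, 1]

/-- (H-1): on the closure of `V_{ij}(Δ)` the Poincare map is defined and its linearization has one
and the same sign configuration, admitted for the types of the `α`-sides of the islands `i`, `j`. -/
def CondH1 (i j : A) (Δ : Real.Angle) : Prop :=
  ∃ s, AdmittedSigns (σ i) (σ j) s ∧ ∀ p ∈ closure (vSet F θ D i j Δ),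
    p ∈ domPlus F θ Δ ∧ HasSigns (jacobian (poincare F θ Δ) p) s

/-- (H-2) with the constant `ρ`. -/
def CondH2 (i j : A) (Δ : Real.Angle) (ρ : ℝ) : Prop :=
  1 < ρ ∧ ∀ p ∈ closure (vSet F θ D i j Δ), ρ ≤ |jacobian (poincare F θ Δ) p 0 0|

/-- (V-1): on the closure of `H_{ij}(Δ)` the inverse Poincare map is defined and its linearization
has one and the same sign configuration, admitted for the types of the `β`-sides of the islands
`j`, `i`. -/
def CondV1 (i j : A) (Δ : Real.Angle) : Prop :=
  ∃ s, AdmittedSigns (σ j).opp (σ i).opp s ∧ ∀ q ∈ closure (hSet F θ D i j Δ),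
    q ∈ domMinus F θ Δ ∧ HasSigns (jacobian (poincareInv F θ Δ) q) s

/-- (V-2) with the constant `ρ`. -/
def CondV2 (i j : A) (Δ : Real.Angle) (ρ : ℝ) : Prop :=
  1 < ρ ∧ ∀ q ∈ closure (hSet F θ D i j Δ), ρ ≤ |jacobian (poincareInv F θ Δ) q 1 1|

/-- (H-i) and (H-ii): for each pair `i, j` there is a constant `γ'`, the same for all slices, such
that each `h_γ`-strip `H` of the island `i` yields an `h_γ'`-strip `P(H) ∩ D_j` in the next slice,
whose thickness is smaller by the factor `ρ i j Δ` at least. -/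
def ConclH (γ : ℝ) (ρ : A → A → Real.Angle → ℝ) : Prop :=
  ∀ i j, ∃ γ' : ℝ, 0 < γ' ∧ ∀ Δ, ∀ H : HStrip γ (σ i) (D i Δ),
    ∃ H' : HStrip γ' (σ j) (D j (Δ + shift θ)),
      H'.carrier = poincare F θ Δ '' H.carrier ∩ (D j (Δ + shift θ)).region ∧
      H'.thickness ≤ H.thickness / ρ i j Δ

/-- (V-i) and (V-ii): the same for the inverse map and the `v_γ`-strips of the island `j`. -/
def ConclV (γ : ℝ) (ρ : A → A → Real.Angle → ℝ) : Prop :=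
  ∀ i j, ∃ γ' : ℝ, 0 < γ' ∧ ∀ Δ, ∀ V : VStrip γ (σ j) (D j Δ),
    ∃ V' : VStrip γ' (σ i) (D i (Δ - shift θ)),
      V'.carrier = poincareInv F θ Δ '' V.carrier ∩ (D i (Δ - shift θ)).region ∧
      V'.thickness ≤ V.thickness / ρ i j Δ

end Conditions

end QuasiStrips

end

open Set Filter Topology

noncomputable section

namespace QuasiStrips

/-! ### Ordinary differential equations with a continuously differentiable right-hand side -/

/-! Fix islands $D^i$ in one slice and $D^j$ in the next, and call the points of $D^i$ mapped into
$D^j$ the crossing set. On its closure, the admitted signs say that, up to one global sign $\eta$,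
the linearization carries the quadrant of directions of the type of the α-sides of $D^i$ into the
corresponding quadrant for $D^j$, and it stretches the first coordinate by $\rho$. Call a monotone
graph of the α-type between the α-sides of $D^i$ a line. As long as a line stays in the closed
crossing set, its image moves strictly monotonically across every curve of the β-type in $D^j$: the
deviation `cutFun` increases.

Collapse closes the other ways out. The map is undefined on the β-sides of $D^i$ and its inverse on
the α-sides of $D^j$, so the closed crossing set misses the former and its image misses the latter.
Hence a line can be followed from any point of the closed crossing set until its image reaches one
β-side of $D^j$ forwards and the other one backwards (`StripMap.exists_entry`,
`StripMap.exists_exit`).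

A line might still return for a second passage. Its image and a piece of the middle curve of $D^j$
would then form a loop in the image of the flow which winds around an end of that middle curve. Such
ends collapse under the inverse map, and following the flow back in time the collapsing solution
escapes to infinity while the loop stays bounded; so a continuous logarithm exists and there is no
winding (`flow_exists_log`, `StripMap.mid_zero_unique`). That every line does pass is a continuity
argument starting from one point of the nonempty crossing set (`StripMap.exists_mid_zero`).
Together: each line meets the closed crossing set in exactly one interval
(`StripMap.exists_interval`).

The preimage of a v-curve therefore meets each horizontal line once and is a graph $u=X(u')$. It is
monotone because two of its points in α-position would lie on a common line; it is Lipschitz by the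
expansion and a bound $C$ for the linearization (`StripMap.exists_vCurve`). Integrating the
expansion along horizontal lines divides the thickness by $\rho$ (`StripMap.exists_strip_of_order`).
The constant $C$ is uniform in the slice by compactness of the circle and Grönwall estimates
(`StripMap.exists_uniform_bound`).

All this is done for an abstract `StripMap`. The statement on the inverse map is the same one with
time reversed and the two coordinates interchanged. -/

lemma contDiff_exists_lipschitzOnWith {X Y : Type*} [NormedAddCommGroup X] [NormedSpace ℝ X]
    [NormedAddCommGroup Y] [NormedSpace ℝ Y] {f : X → Y} (hf : ContDiff ℝ 1 f) {s : Set X}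
    (hs : IsCompact s) : ∃ K, LipschitzOnWith K f s :=
  LocallyLipschitzOn.exists_lipschitzOnWith_of_compact hs
    (hf.locallyLipschitz.locallyLipschitzOn)

/-! ### Uniqueness of solutions on a compact interval. -/

section Unique

variable {E : Type*} [NormedAddCommGroup E] [NormedSpace ℝ E] [ProperSpace E]

/-- Both solutions stay in one ball, on which the field is Lipschitz uniformly over the compact time
interval; Grönwall uniqueness is then applied on each side of `x₀`. -/
theorem ode_unique {v : ℝ → E → E} (hv : ContDiff ℝ 1 fun z : ℝ × E => v z.1 z.2) {a b x₀ : ℝ}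
    {c c' : ℝ → E} (hc : ∀ x ∈ Icc a b, HasDerivWithinAt c (v x (c x)) (Icc a b) x)
    (hc' : ∀ x ∈ Icc a b, HasDerivWithinAt c' (v x (c' x)) (Icc a b) x) (hx₀ : x₀ ∈ Icc a b)
    (h : c x₀ = c' x₀) : EqOn c c' (Icc a b) := by
  have hcc : ContinuousOn c (Icc a b) := fun x hx => (hc x hx).continuousWithinAt
  have hcc' : ContinuousOn c' (Icc a b) := fun x hx => (hc' x hx).continuousWithinAt
  obtain ⟨R, hR⟩ := (isCompact_Icc.image_of_continuousOn hcc).isBounded.subset_closedBall 0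
  obtain ⟨R', hR'⟩ := (isCompact_Icc.image_of_continuousOn hcc').isBounded.subset_closedBall 0
  obtain ⟨K, hK⟩ := contDiff_exists_lipschitzOnWith hv
    ((isCompact_Icc (a := a) (b := b)).prod (isCompact_closedBall (0 : E) (max R R')))
  have hlip : ∀ t ∈ Icc a b, LipschitzOnWith K (v t) (Metric.closedBall 0 (max R R')) := by
    intro t ht x hx y hy
    have := hK (show (t, x) ∈ _ from ⟨ht, hx⟩) (show (t, y) ∈ _ from ⟨ht, hy⟩)
    simpa [Prod.edist_eq] using this
  have hm : ∀ t ∈ Icc a b, c t ∈ Metric.closedBall (0 : E) (max R R') := fun t ht =>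
    Metric.closedBall_subset_closedBall (le_max_left _ _) (hR ⟨t, ht, rfl⟩)
  have hm' : ∀ t ∈ Icc a b, c' t ∈ Metric.closedBall (0 : E) (max R R') := fun t ht =>
    Metric.closedBall_subset_closedBall (le_max_right _ _) (hR' ⟨t, ht, rfl⟩)
  have hder : ∀ {d : ℝ → E}, (∀ x ∈ Icc a b, HasDerivWithinAt d (v x (d x)) (Icc a b) x) →
      (∀ t ∈ Ico x₀ b, HasDerivWithinAt d (v t (d t)) (Ici t) t) ∧
      ∀ t ∈ Ioc a x₀, HasDerivWithinAt d (v t (d t)) (Iic t) t := by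
    intro d hd
    refine ⟨fun t ht => ?_, fun t ht => ?_⟩
    · exact (hd t ⟨hx₀.1.trans ht.1, ht.2.le⟩).mono_of_mem_nhdsWithin
        (mem_of_superset (Icc_mem_nhdsGE ht.2) (Icc_subset_Icc_left (hx₀.1.trans ht.1)))
    · exact (hd t ⟨ht.1.le, ht.2.trans hx₀.2⟩).mono_of_mem_nhdsWithin
        (mem_of_superset (Icc_mem_nhdsLE ht.1) (Icc_subset_Icc_right (ht.2.trans hx₀.2)))
  rw [← Icc_union_Icc_eq_Icc hx₀.1 hx₀.2]
  have hl : Icc a x₀ ⊆ Icc a b := Icc_subset_Icc_right hx₀.2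
  have hr : Icc x₀ b ⊆ Icc a b := Icc_subset_Icc_left hx₀.1
  refine EqOn.union ?_ ?_
  · exact ODE_solution_unique_of_mem_Icc_left
      (fun t ht => hlip t (hl (Ioc_subset_Icc_self ht))) (hcc.mono hl) (hder hc).2
      (fun t ht => hm t (hl (Ioc_subset_Icc_self ht))) (hcc'.mono hl) (hder hc').2
      (fun t ht => hm' t (hl (Ioc_subset_Icc_self ht))) h
  · exact ODE_solution_unique_of_mem_Icc_right
      (fun t ht => hlip t (hr (Ico_subset_Icc_self ht))) (hcc.mono hr) (hder hc).1
      (fun t ht => hm t (hr (Ico_subset_Icc_self ht))) (hcc'.mono hr) (hder hc').1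
      (fun t ht => hm' t (hr (Ico_subset_Icc_self ht))) h

end Unique

/-! ### Lipschitz dependence on a parameter and on initial values. -/

section Dependence

/-- `c` is an integral curve of `W δ` on the unit interval. -/
def Traj (W : ℝ → ℝ → ℝ × ℝ → ℝ × ℝ) (δ : ℝ) (c : ℝ → ℝ × ℝ) : Prop :=
  ∀ t ∈ Icc (0 : ℝ) 1, HasDerivWithinAt c (W δ t (c t)) (Icc 0 1) t

/-- The retraction of the plane to the square of half-width `R`. -/
def boxClamp (R : ℝ) (z : ℝ × ℝ) : ℝ × ℝ := (max (-R) (min R z.1), max (-R) (min R z.2))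

lemma boxClamp_lipschitz (R : ℝ) : LipschitzWith 1 (boxClamp R) := by
  have h1 : LipschitzWith 1 (fun x : ℝ => max (-R) (min R x)) :=
    (LipschitzWith.id.const_min R).const_max (-R)
  have := (h1.comp LipschitzWith.prod_fst).prodMk (h1.comp LipschitzWith.prod_snd)
  have h : boxClamp R = fun z => (max (-R) (min R z.1), max (-R) (min R z.2)) := rfl
  rw [h]
  simpa using this

lemma boxClamp_norm_le {R : ℝ} (hR : 0 ≤ R) (z : ℝ × ℝ) : ‖boxClamp R z‖ ≤ R := by
  have h : -R ≤ R := by linarith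
  exact max_le (abs_le.2 ⟨le_max_left _ _, max_le h (min_le_left _ _)⟩)
    (abs_le.2 ⟨le_max_left _ _, max_le h (min_le_left _ _)⟩)

lemma boxClamp_of_norm_le {R : ℝ} {z : ℝ × ℝ} (hz : ‖z‖ ≤ R) : boxClamp R z = z := by
  simp only [Prod.norm_def, Real.norm_eq_abs, sup_le_iff, abs_le] at hz
  ext <;> simp [boxClamp, *]

variable {W : ℝ → ℝ → ℝ × ℝ → ℝ × ℝ}

lemma Traj.continuousOn {δ : ℝ} {c : ℝ → ℝ × ℝ} (h : Traj W δ c) : ContinuousOn c (Icc 0 1) :=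
  fun t ht => (h t ht).continuousWithinAt

lemma Traj.eqOn (hW : ContDiff ℝ 1 fun z : ℝ × ℝ × ℝ × ℝ => W z.1 z.2.1 z.2.2) {δ : ℝ}
    {c c' : ℝ → ℝ × ℝ} (h : Traj W δ c) (h' : Traj W δ c') (h0 : c 0 = c' 0) :
    EqOn c c' (Icc 0 1) :=
  ode_unique (v := W δ) (hW.comp (contDiff_const.prodMk contDiff_id)) h h'
    (left_mem_Icc.2 zero_le_one) h0

/-- Precomposing with the retraction leaves only a compact set of arguments, where a $C^1$ field is
Lipschitz. The truncated field is thus globally Lipschitz in the state, so its trajectories cannot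
escape. -/
lemma box_lipschitz (hW : ContDiff ℝ 1 fun z : ℝ × ℝ × ℝ × ℝ => W z.1 z.2.1 z.2.2) (δ₀ : ℝ)
    {R : ℝ} (hR : 0 ≤ R) : ∃ K : NNReal, ∀ δ ∈ Icc (δ₀ - 1) (δ₀ + 1), ∀ δ' ∈ Icc (δ₀ - 1) (δ₀ + 1),
      ∀ t ∈ Icc (0 : ℝ) 1, ∀ z z', dist (W δ t (boxClamp R z)) (W δ' t (boxClamp R z')) ≤
        K * max |δ - δ'| (dist z z') := by
  obtain ⟨K, hK⟩ := contDiff_exists_lipschitzOnWith hW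
    ((isCompact_Icc (a := δ₀ - 1) (b := δ₀ + 1)).prod
      ((isCompact_Icc (a := (0 : ℝ)) (b := 1)).prod (isCompact_closedBall (0 : ℝ × ℝ) R)))
  refine ⟨K, fun δ hδ δ' hδ' t ht z z' => ?_⟩
  have hb : ∀ w, boxClamp R w ∈ Metric.closedBall (0 : ℝ × ℝ) R := fun w => by
    simpa using boxClamp_norm_le hR w
  have := hK.dist_le_mul (δ, t, boxClamp R z) ⟨hδ, ht, hb z⟩ (δ', t, boxClamp R z') ⟨hδ', ht, hb z'⟩
  refine this.trans (mul_le_mul_of_nonneg_left ?_ K.2)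
  have h1 := (boxClamp_lipschitz R).dist_le_mul z z'
  rw [Prod.dist_eq, Prod.dist_eq, dist_self, Real.dist_eq]
  refine max_le (le_max_left _ _) (max_le (le_max_of_le_right dist_nonneg) ?_)
  exact le_max_of_le_right (by simpa using h1)

lemma box_exists (hW : ContDiff ℝ 1 fun z : ℝ × ℝ × ℝ × ℝ => W z.1 z.2.1 z.2.2) (δ : ℝ)
    {R : ℝ} (hR : 0 ≤ R) (p : ℝ × ℝ) :
    ∃ c, Traj (fun δ t z => W δ t (boxClamp R z)) δ c ∧ c 0 = p := by
  obtain ⟨K, hK⟩ := box_lipschitz hW δ hR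
  have hδ : δ ∈ Icc (δ - 1) (δ + 1) := ⟨by linarith, by linarith⟩
  have hcont : ContinuousOn (fun w : ℝ × (ℝ × ℝ) => W δ w.1 w.2)
      (Icc (0 : ℝ) 1 ×ˢ Metric.closedBall (0 : ℝ × ℝ) R) := by
    exact (hW.continuous.comp (by fun_prop : Continuous fun w : ℝ × (ℝ × ℝ) => (δ, w.1, w.2))).continuousOn
  obtain ⟨M, hM⟩ := ((isCompact_Icc.prod (isCompact_closedBall (0 : ℝ × ℝ) R)).image_of_continuousOn
    hcont).isBounded.exists_norm_le
  have hb : ∀ w, boxClamp R w ∈ Metric.closedBall (0 : ℝ × ℝ) R := fun w => by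
    simpa using boxClamp_norm_le hR w
  have hPL : IsPicardLindelof (fun t z => W δ t (boxClamp R z)) (tmin := 0) (tmax := 1)
      ⟨0, left_mem_Icc.2 zero_le_one⟩ p M.toNNReal 0 M.toNNReal K := by
    refine ⟨fun t ht => ?_, fun x _ => ?_, fun t ht x _ => ?_, ?_⟩
    · refine LipschitzOnWith.of_dist_le_mul fun x _ y _ => ?_
      have := hK δ hδ δ hδ t ht x y
      rwa [sub_self, abs_zero, max_eq_right dist_nonneg] at this
    · exact (hW.continuous.comp (by fun_prop : Continuous fun t : ℝ => (δ, t, boxClamp R x))).continuousOn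
    · exact (hM _ ⟨(t, boxClamp R x), ⟨ht, hb x⟩, rfl⟩).trans (Real.le_coe_toNNReal M)
    · simp
  obtain ⟨α, h0, hα⟩ := hPL.exists_eq_forall_mem_Icc_hasDerivWithinAt₀
  exact ⟨α, hα, h0⟩

/-- A trajectory for `δ'` is an approximate trajectory for `δ`, with error at most
$K|\delta-\delta'|$. The Grönwall bound is linear in the pair (initial distance, error), so `m`
factors out. -/
lemma box_dist (hW : ContDiff ℝ 1 fun z : ℝ × ℝ × ℝ × ℝ => W z.1 z.2.1 z.2.2) (δ₀ : ℝ)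
    {R : ℝ} (hR : 0 ≤ R) : ∃ C : ℝ, 0 ≤ C ∧ ∀ δ ∈ Icc (δ₀ - 1) (δ₀ + 1),
      ∀ δ' ∈ Icc (δ₀ - 1) (δ₀ + 1), ∀ c c', Traj (fun δ t z => W δ t (boxClamp R z)) δ c →
      Traj (fun δ t z => W δ t (boxClamp R z)) δ' c' → ∀ t ∈ Icc (0 : ℝ) 1,
        dist (c t) (c' t) ≤ C * max |δ - δ'| (dist (c 0) (c' 0)) := by
  obtain ⟨K, hK⟩ := box_lipschitz hW δ₀ hR
  refine ⟨gronwallBound 1 K K 1, ?_, fun δ hδ δ' hδ' c c' hc hc' t ht => ?_⟩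
  · have := gronwallBound_mono (δ := 1) zero_le_one K.2 K.2 (zero_le_one (α := ℝ))
    rw [gronwallBound_x0] at this
    exact zero_le_one.trans this
  · set m := max |δ - δ'| (dist (c 0) (c' 0)) with hm
    have hm0 : 0 ≤ m := le_max_of_le_left (abs_nonneg _)
    have hder : ∀ {δ d}, Traj (fun δ t z => W δ t (boxClamp R z)) δ d →
        ∀ t ∈ Ico (0 : ℝ) 1, HasDerivWithinAt d (W δ t (boxClamp R (d t))) (Ici t) t := by
      intro δ d hd t ht
      exact (hd t ⟨ht.1, ht.2.le⟩).mono_of_mem_nhdsWithin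
        (mem_of_superset (Icc_mem_nhdsGE ht.2) (Icc_subset_Icc_left ht.1))
    have key := dist_le_of_approx_trajectories_ODE_of_mem (v := fun t z => W δ t (boxClamp R z))
      (s := fun _ => univ) (K := K) (εf := 0) (εg := K * m) (δ := m)
      (f := c) (g := c') (a := 0) (b := 1)
      (fun t ht => LipschitzOnWith.of_dist_le_mul fun x _ y _ => by
        have := hK δ hδ δ hδ t (Ico_subset_Icc_self ht) x y
        rwa [sub_self, abs_zero, max_eq_right dist_nonneg] at this)
      hc.continuousOn (hder hc) (fun t _ => by simp) (fun _ _ => mem_univ _)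
      hc'.continuousOn (hder hc')
      (fun t ht => by
        have := hK δ' hδ' δ hδ t (Ico_subset_Icc_self ht) (c' t) (c' t)
        rw [dist_self, max_eq_left (abs_nonneg _), abs_sub_comm] at this
        exact this.trans (mul_le_mul_of_nonneg_left (le_max_left _ _) K.2))
      (fun _ _ => mem_univ _) (le_max_right _ _) t ht
    rw [sub_zero, zero_add] at key
    have hlin : ∀ x, gronwallBound m K (K * m) x = gronwallBound 1 K K x * m := by
      intro x
      by_cases h0 : (K : ℝ) = 0
      · simp [h0, gronwallBound_K0]
      · simp only [gronwallBound_of_K_ne_0 h0]; field_simp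
    rw [hlin] at key
    exact key.trans (mul_le_mul_of_nonneg_right
      (gronwallBound_mono zero_le_one K.2 K.2 ht.2) hm0)

/-- Continuation of trajectories and their Lipschitz dependence on the parameter and the initial
value, near a given trajectory. -/
theorem traj_dependence (hW : ContDiff ℝ 1 fun z : ℝ × ℝ × ℝ × ℝ => W z.1 z.2.1 z.2.2) {δ₀ : ℝ}
    {c₀ : ℝ → ℝ × ℝ} (hc₀ : Traj W δ₀ c₀) :
    ∃ ε > 0, ∃ C : ℝ, 0 ≤ C ∧
      (∀ δ p, |δ - δ₀| ≤ ε → dist p (c₀ 0) ≤ ε → ∃ c, Traj W δ c ∧ c 0 = p) ∧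
      ∀ δ δ' c c', |δ - δ₀| ≤ ε → |δ' - δ₀| ≤ ε → Traj W δ c → Traj W δ' c' →
        dist (c 0) (c₀ 0) ≤ ε → dist (c' 0) (c₀ 0) ≤ ε → ∀ t ∈ Icc (0 : ℝ) 1,
          dist (c t) (c' t) ≤ C * max |δ - δ'| (dist (c 0) (c' 0)) := by
  obtain ⟨M, hM⟩ := (isCompact_Icc.image_of_continuousOn hc₀.continuousOn).isBounded.exists_norm_le
  have hM' : ∀ t ∈ Icc (0 : ℝ) 1, ‖c₀ t‖ ≤ M := fun t ht => hM _ ⟨t, ht, rfl⟩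
  have hM0 : 0 ≤ M := (norm_nonneg _).trans (hM' 0 (left_mem_Icc.2 zero_le_one))
  have hR : 0 ≤ M + 1 := by linarith
  obtain ⟨C, hC0, hC⟩ := box_dist hW δ₀ hR
  have hbox : ∀ {δ c}, Traj W δ c → (∀ t ∈ Icc (0 : ℝ) 1, ‖c t‖ ≤ M + 1) →
      Traj (fun δ t z => W δ t (boxClamp (M + 1) z)) δ c := by
    intro δ c hc hb t ht
    simpa only [boxClamp_of_norm_le (hb t ht)] using hc t ht
  have hunbox : ∀ {δ c}, Traj (fun δ t z => W δ t (boxClamp (M + 1) z)) δ c →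
      (∀ t ∈ Icc (0 : ℝ) 1, ‖c t‖ ≤ M + 1) → Traj W δ c := by
    intro δ c hc hb t ht
    simpa only [boxClamp_of_norm_le (hb t ht)] using hc t ht
  have hc₀' := hbox hc₀ fun t ht => (hM' t ht).trans (by linarith)
  -- With $C\varepsilon\le 1$, truncated trajectories starting `ε`-close to `c₀` stay at distance at
  -- most 1 from it, inside the box of half-width `M + 1` where the truncation is invisible.
  obtain ⟨ε, hε, hε1, hεC⟩ : ∃ ε > 0, ε ≤ 1 ∧ C * ε ≤ 1 := by
    refine ⟨1 / (C + 1), by positivity, ?_, ?_⟩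
    · rw [div_le_one (by positivity)]; linarith
    · rw [mul_one_div, div_le_one (by positivity)]; linarith
  have hmem : ∀ {δ}, |δ - δ₀| ≤ ε → δ ∈ Icc (δ₀ - 1) (δ₀ + 1) := fun {δ} h => by
    have := abs_le.1 (h.trans hε1); constructor <;> linarith
  have hex : ∀ δ p, |δ - δ₀| ≤ ε → dist p (c₀ 0) ≤ ε →
      ∃ c, Traj W δ c ∧ c 0 = p ∧ ∀ t ∈ Icc (0 : ℝ) 1, ‖c t‖ ≤ M + 1 := by
    intro δ p hδ hp
    obtain ⟨c, hc, h0⟩ := box_exists hW δ hR p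
    have hb : ∀ t ∈ Icc (0 : ℝ) 1, ‖c t‖ ≤ M + 1 := by
      intro t ht
      have h1 := hC δ (hmem hδ) δ₀ (hmem (by simpa using hε.le)) c c₀ hc hc₀' t ht
      have h2 : C * max |δ - δ₀| (dist (c 0) (c₀ 0)) ≤ 1 :=
        (mul_le_mul_of_nonneg_left (max_le hδ (h0 ▸ hp)) hC0).trans hεC
      have h3 := norm_le_norm_add_norm_sub' (c t) (c₀ t)
      rw [dist_eq_norm] at h1
      linarith [hM' t ht]
    exact ⟨c, hunbox hc hb, h0, hb⟩
  refine ⟨ε, hε, C, hC0, fun δ p hδ hp => ?_, fun δ δ' c c' hδ hδ' hc hc' h0 h0' => ?_⟩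
  · obtain ⟨c, hc, h0, -⟩ := hex δ p hδ hp
    exact ⟨c, hc, h0⟩
  -- Uniqueness identifies an arbitrary trajectory with the one constructed inside the box.
  · have hb : ∀ {δ c}, |δ - δ₀| ≤ ε → Traj W δ c → dist (c 0) (c₀ 0) ≤ ε →
        ∀ t ∈ Icc (0 : ℝ) 1, ‖c t‖ ≤ M + 1 := by
      intro δ c hδ hc h0 t ht
      obtain ⟨d, hd, hd0, hdb⟩ := hex δ (c 0) hδ h0
      rw [hc.eqOn hW hd hd0.symm ht]
      exact hdb t ht
    exact hC δ (hmem hδ) δ' (hmem hδ') c c' (hbox hc (hb hδ hc h0)) (hbox hc' (hb hδ' hc' h0'))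

end Dependence

/-! ### The flow of the equation -/

/-- The right-hand side of the first order system, with a real phase. -/
def slopeField (F : ℝ → ℝ → ℝ → ℝ) (θ δ x : ℝ) (z : ℝ × ℝ) : ℝ × ℝ :=
  (z.2, F x (θ * x + δ) z.1)

/-- The right-hand side after the substitution `x = T t`. -/
def timeField (F : ℝ → ℝ → ℝ → ℝ) (θ T δ t : ℝ) (z : ℝ × ℝ) : ℝ × ℝ :=
  T • slopeField F θ δ (T * t) z

/-- `F` is continuously differentiable and `2π`-periodic in its first two arguments. -/
structure PeriodicC1 (F : ℝ → ℝ → ℝ → ℝ) : Prop where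
  contDiff : ContDiff ℝ 1 fun z : ℝ × ℝ × ℝ => F z.1 z.2.1 z.2.2
  perX : ∀ X Y u, F (X + 2 * Real.pi) Y u = F X Y u
  perY : ∀ X Y u, F X (Y + 2 * Real.pi) u = F X Y u

/-! ### Solutions over whole periods, and local continuity of the flow in phase and data. -/

section Flow

variable {F : ℝ → ℝ → ℝ → ℝ} {θ : ℝ}

lemma PeriodicC1.perX_int (hF : PeriodicC1 F) (n : ℤ) (X Y u : ℝ) :
    F (X + n * (2 * Real.pi)) Y u = F X Y u := by
  have : Function.Periodic (fun X => F X Y u) (2 * Real.pi) := fun X => hF.perX X Y u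
  simpa using this.int_mul n X

lemma PeriodicC1.perY_int (hF : PeriodicC1 F) (n : ℤ) (X Y u : ℝ) :
    F X (Y + n * (2 * Real.pi)) u = F X Y u := by
  have : Function.Periodic (fun Y => F X Y u) (2 * Real.pi) := fun Y => hF.perY X Y u
  simpa using this.int_mul n Y

lemma PeriodicC1.slopeField_contDiff (hF : PeriodicC1 F) (δ : ℝ) :
    ContDiff ℝ 1 fun z : ℝ × ℝ × ℝ => slopeField F θ δ z.1 z.2 := by
  unfold slopeField
  have h : ContDiff ℝ 1 fun z : ℝ × ℝ × ℝ => ((z.1, θ * z.1 + δ, z.2.1) : ℝ × ℝ × ℝ) := by fun_prop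
  exact (by fun_prop : ContDiff ℝ 1 fun z : ℝ × ℝ × ℝ => z.2.2).prodMk (hF.contDiff.comp h)

lemma PeriodicC1.timeField_contDiff (hF : PeriodicC1 F) (T : ℝ) :
    ContDiff ℝ 1 fun z : ℝ × ℝ × ℝ × ℝ => timeField F θ T z.1 z.2.1 z.2.2 := by
  unfold timeField slopeField
  have h : ContDiff ℝ 1 fun z : ℝ × ℝ × ℝ × ℝ =>
      ((T * z.2.1, θ * (T * z.2.1) + z.1, z.2.2.1) : ℝ × ℝ × ℝ) := by fun_prop
  exact ((by fun_prop : ContDiff ℝ 1 fun z : ℝ × ℝ × ℝ × ℝ => z.2.2.2).prodMk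
    (hF.contDiff.comp h)).const_smul T

lemma PeriodicC1.slopeField_congr (hF : PeriodicC1 F) {δ δ' : ℝ}
    (h : (δ : Real.Angle) = δ') (x : ℝ) (z : ℝ × ℝ) : slopeField F θ δ x z = slopeField F θ δ' x z := by
  obtain ⟨k, hk⟩ := Real.Angle.angle_eq_iff_two_pi_dvd_sub.1 h
  have : θ * x + δ = θ * x + δ' + k * (2 * Real.pi) := by linarith
  simp only [slopeField, this, hF.perY_int]

lemma IsSolution.mono {Δ : Real.Angle} {s t : Set ℝ} {c : ℝ → ℝ × ℝ} (h : IsSolution F θ Δ s c)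
    (hts : t ⊆ s) : IsSolution F θ Δ t c :=
  fun x hx => (h x (hts hx)).mono hts

lemma IsSolution.continuousOn {Δ : Real.Angle} {s : Set ℝ} {c : ℝ → ℝ × ℝ}
    (h : IsSolution F θ Δ s c) : ContinuousOn c s :=
  fun x hx => (h x hx).continuousWithinAt

lemma IsSolution.eq_of_eq (hF : PeriodicC1 F) {Δ : Real.Angle} {s s' : Set ℝ} {c c' : ℝ → ℝ × ℝ}
    (h : IsSolution F θ Δ s c) (h' : IsSolution F θ Δ s' c') {x y : ℝ} (hs : uIcc x y ⊆ s)
    (hs' : uIcc x y ⊆ s') (hx : c x = c' x) : c y = c' y :=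
  ode_unique (v := slopeField F θ Δ.toReal) (hF.slopeField_contDiff _) (h.mono hs) (h'.mono hs')
    left_mem_uIcc hx right_mem_uIcc

/-- Translating $x$ by a multiple $T$ of $2\pi$ is invisible in the first argument of $F$ and adds
$\theta T$ to the phase in the second one; the real representatives of the phases may differ by
multiples of $2\pi$, which periodicity absorbs. -/
lemma IsSolution.shift (hF : PeriodicC1 F) {Δ : Real.Angle} {s : Set ℝ} {c : ℝ → ℝ × ℝ}
    (h : IsSolution F θ Δ s c) {T : ℝ} (hT : ∃ n : ℤ, T = n * (2 * Real.pi)) :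
    IsSolution F θ (Δ + ((θ * T : ℝ) : Real.Angle)) ((· + T) ⁻¹' s) (fun x => c (x + T)) := by
  obtain ⟨n, rfl⟩ := hT
  intro x hx
  have h1 := (h _ hx).scomp x ((hasDerivAt_id x).add_const (n * (2 * Real.pi))).hasDerivWithinAt
    (mapsTo_preimage (· + n * (2 * Real.pi)) s)
  convert! h1 using 1
  simp only [one_smul]
  refine Prod.ext rfl ?_
  have h2 : ((Δ + ((θ * (n * (2 * Real.pi)) : ℝ) : Real.Angle)).toReal : Real.Angle)
      = ((Δ.toReal + θ * (n * (2 * Real.pi)) : ℝ) : Real.Angle) := by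
    simp
  have h3 := congrArg Prod.snd (hF.slopeField_congr (θ := θ) h2 x (c (x + n * (2 * Real.pi))))
  simp only [slopeField] at h3
  rw [h3, hF.perX_int]
  congr 1
  ring_nf

lemma left_ne_nhdsWithin_neBot {a b : ℝ} (hab : a ≠ b) : (𝓝[uIcc a b \ {b}] b).NeBot := by
  rw [← mem_closure_iff_nhdsWithin_neBot]
  rcases lt_or_gt_of_ne hab with h | h
  · rw [uIcc_of_le h.le, Icc_sdiff_right, closure_Ico hab]; exact right_mem_Icc.2 h.le
  · rw [uIcc_of_ge h.le, Icc_sdiff_left, closure_Ioc hab.symm]; exact left_mem_Icc.2 h.le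

/-- If the two met once they would agree up to `b` by uniqueness, but `c` is continuous at `b` while
`e` is unbounded there. -/
lemma IsSolution.ne_of_collapse (hF : PeriodicC1 F) {Δ : Real.Angle} {a b : ℝ} {c e : ℝ → ℝ × ℝ}
    (hc : IsSolution F θ Δ (uIcc a b) c) (he : IsSolution F θ Δ (uIcc a b \ {b}) e)
    (hlim : Tendsto (fun x => |(e x).1|) (𝓝[uIcc a b \ {b}] b) atTop) {x : ℝ}
    (hx : x ∈ uIcc a b \ {b}) : c x ≠ e x := by
  intro hce
  have hab : a ≠ b := by
    rintro rfl
    simp at hx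
  have hne := left_ne_nhdsWithin_neBot hab
  have heq : ∀ y ∈ uIcc a b \ {b}, c y = e y := by
    intro y hy
    have hsub : uIcc x y ⊆ uIcc a b \ {b} := by
      rcases lt_or_gt_of_ne hab with h | h
      · rw [uIcc_of_le h.le, Icc_sdiff_right] at *
        exact OrdConnected.uIcc_subset ordConnected_Ico hx hy
      · rw [uIcc_of_ge h.le, Icc_sdiff_left] at *
        exact OrdConnected.uIcc_subset ordConnected_Ioc hx hy
    exact hc.eq_of_eq hF he (hsub.trans sdiff_subset) hsub hce
  have h1 : Tendsto (fun x => |(c x).1|) (𝓝[uIcc a b \ {b}] b) (𝓝 |(c b).1|) :=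
    (continuous_abs.comp continuous_fst).continuousAt.tendsto.comp
      ((hc.continuousOn b right_mem_uIcc).mono sdiff_subset)
  refine not_tendsto_nhds_of_tendsto_atTop (hlim.congr' ?_) _ h1
  filter_upwards [self_mem_nhdsWithin] with y hy
  rw [heq y hy]

lemma CollapsesAt.notMem_flowDomain (hF : PeriodicC1 F) {Δ : Real.Angle} {T : ℝ} (hT : T ≠ 0)
    {p : ℝ × ℝ} (h : CollapsesAt F θ Δ T p) : p ∉ flowDomain F θ Δ T := by
  rintro ⟨q, c, hc, h0, -⟩
  obtain ⟨e, he, he0, hlim⟩ := h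
  exact hc.ne_of_collapse hF he hlim ⟨left_mem_uIcc, fun h => hT h.symm⟩ (h0.trans he0.symm)

lemma Reaches.unique (hF : PeriodicC1 F) {Δ : Real.Angle} {T : ℝ} {p q q' : ℝ × ℝ}
    (h : Reaches F θ Δ T p q) (h' : Reaches F θ Δ T p q') : q = q' := by
  obtain ⟨c, hc, h0, rfl⟩ := h
  obtain ⟨c', hc', h0', rfl⟩ := h'
  exact hc.eq_of_eq hF hc' Subset.rfl Subset.rfl (h0.trans h0'.symm)

lemma reaches_flow {Δ : Real.Angle} {T : ℝ} {p : ℝ × ℝ} (h : p ∈ flowDomain F θ Δ T) :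
    Reaches F θ Δ T p (flow F θ Δ T p) := by
  have h' : ∃ q, Reaches F θ Δ T p q := h
  rw [flow, dif_pos h']
  exact h'.choose_spec

lemma Reaches.flow_eq (hF : PeriodicC1 F) {Δ : Real.Angle} {T : ℝ} {p q : ℝ × ℝ}
    (h : Reaches F θ Δ T p q) : flow F θ Δ T p = q :=
  (reaches_flow ⟨q, h⟩).unique hF h

lemma Reaches.symm (hF : PeriodicC1 F) {Δ : Real.Angle} {T : ℝ}
    (hT : ∃ n : ℤ, T = n * (2 * Real.pi)) {p q : ℝ × ℝ} (h : Reaches F θ Δ T p q) :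
    Reaches F θ (Δ + ((θ * T : ℝ) : Real.Angle)) (-T) q p := by
  obtain ⟨c, hc, rfl, rfl⟩ := h
  refine ⟨fun x => c (x + T), ?_, by simp, by simp⟩
  convert! hc.shift hF hT using 1
  simp [uIcc_comm]

lemma flow_mem (hF : PeriodicC1 F) {Δ : Real.Angle} {T : ℝ}
    (hT : ∃ n : ℤ, T = n * (2 * Real.pi)) {p : ℝ × ℝ} (h : p ∈ flowDomain F θ Δ T) :
    flow F θ Δ T p ∈ flowDomain F θ (Δ + ((θ * T : ℝ) : Real.Angle)) (-T) :=
  ⟨p, (reaches_flow h).symm hF hT⟩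

lemma flow_flow (hF : PeriodicC1 F) {Δ : Real.Angle} {T : ℝ}
    (hT : ∃ n : ℤ, T = n * (2 * Real.pi)) {p : ℝ × ℝ} (h : p ∈ flowDomain F θ Δ T) :
    flow F θ (Δ + ((θ * T : ℝ) : Real.Angle)) (-T) (flow F θ Δ T p) = p :=
  ((reaches_flow h).symm hF hT).flow_eq hF

lemma IsSolution.traj {Δ : Real.Angle} {T : ℝ} {c : ℝ → ℝ × ℝ}
    (hc : IsSolution F θ Δ (uIcc 0 T) c) :
    Traj (timeField F θ T) Δ.toReal (fun t => c (T * t)) := by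
  intro t ht
  have hm : MapsTo (T * ·) (Icc 0 1) (uIcc 0 T) := by
    intro t ht
    rw [mem_uIcc]
    rcases le_total 0 T with h | h
    · left; constructor <;> nlinarith [ht.1, ht.2]
    · right; constructor <;> nlinarith [ht.1, ht.2]
  have := (hc _ (hm ht)).scomp t ((hasDerivAt_id t).const_mul T).hasDerivWithinAt hm
  simpa [Function.comp_def, timeField, slopeField] using this

lemma Traj.isSolution {Δ : Real.Angle} {T : ℝ} (hT : T ≠ 0) {c : ℝ → ℝ × ℝ}
    (hc : Traj (timeField F θ T) Δ.toReal c) :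
    IsSolution F θ Δ (uIcc 0 T) (fun x => c (x / T)) := by
  intro x hx
  have hm : MapsTo (· / T) (uIcc 0 T) (Icc 0 1) := by
    intro x hx
    rw [mem_uIcc] at hx
    rcases lt_or_gt_of_ne hT with h | h
    · refine ⟨div_nonneg_of_nonpos ?_ h.le, (div_le_one_of_neg h).2 ?_⟩ <;> rcases hx with hx | hx <;>
        linarith [hx.1, hx.2]
    · refine ⟨div_nonneg ?_ h.le, (div_le_one h).2 ?_⟩ <;> rcases hx with hx | hx <;>
        linarith [hx.1, hx.2]
  have := (hc _ (hm hx)).scomp x ((hasDerivAt_id x).div_const T).hasDerivWithinAt hm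
  convert! this using 1
  simp only [timeField, smul_smul, slopeField]
  rw [one_div, inv_mul_cancel₀ hT, one_smul, mul_div_cancel₀ _ hT]

lemma Traj.congr (hF : PeriodicC1 F) {δ δ' T : ℝ} {c : ℝ → ℝ × ℝ} (h : (δ : Real.Angle) = δ')
    (hc : Traj (timeField F θ T) δ c) : Traj (timeField F θ T) δ' c := by
  intro t ht
  simpa only [timeField, hF.slopeField_congr h] using hc t ht

lemma reaches_iff_traj (hF : PeriodicC1 F) {δ T : ℝ} (hT : T ≠ 0) {p q : ℝ × ℝ} :
    Reaches F θ (δ : Real.Angle) T p q ↔ ∃ c, Traj (timeField F θ T) δ c ∧ c 0 = p ∧ c 1 = q := by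
  have hδ : (((δ : Real.Angle).toReal : ℝ) : Real.Angle) = δ := Real.Angle.coe_toReal _
  constructor
  · rintro ⟨c, hc, h0, h1⟩
    exact ⟨_, hc.traj.congr hF hδ, by simpa using h0, by simpa using h1⟩
  · rintro ⟨c, hc, h0, h1⟩
    exact ⟨_, (hc.congr hF hδ.symm).isSolution hT, by simpa using h0, by simpa [hT] using h1⟩

lemma isOpenQuotientMap_angle : IsOpenQuotientMap ((↑) : ℝ → Real.Angle) :=
  QuotientAddGroup.isOpenQuotientMap_mk

/-- The covering of the circle by the line is open, so local statements can be checked with a real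
phase near `δ`. This avoids `toReal`, which jumps at one point of the circle. -/
lemma nhds_angle_prod (δ : ℝ) (p : ℝ × ℝ) :
    𝓝 ((δ : Real.Angle), p) = map (Prod.map (↑) id) (𝓝 (δ, p)) :=
  ((isOpenQuotientMap_angle.prodMap IsOpenQuotientMap.id).map_nhds_eq (δ, p)).symm

/-- Near a point of the domain, the flow is defined, and Lipschitz continuous uniformly with
respect to the phase. -/
theorem flow_local (hF : PeriodicC1 F) {T : ℝ} (hT : T ≠ 0) {Δ₀ : Real.Angle} {p₀ : ℝ × ℝ}
    (hp₀ : p₀ ∈ flowDomain F θ Δ₀ T) :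
    ∃ C : ℝ, 0 ≤ C ∧ ∃ U ∈ 𝓝 (Δ₀, p₀), ∀ x ∈ U, x.2 ∈ flowDomain F θ x.1 T ∧
      ∀ p, (x.1, p) ∈ U → dist (flow F θ x.1 T x.2) (flow F θ x.1 T p) ≤ C * dist x.2 p := by
  induction Δ₀ using Real.Angle.induction_on with | _ δ₀ =>
  obtain ⟨q₀, hq₀⟩ := hp₀
  obtain ⟨c₀, hc₀, rfl, rfl⟩ := (reaches_iff_traj hF hT).1 hq₀
  obtain ⟨ε, hε, C, hC, hex, hlip⟩ := traj_dependence (hF.timeField_contDiff T) hc₀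
  refine ⟨C, hC, Prod.map (↑) id '' (Metric.closedBall (δ₀, c₀ 0) ε), ?_, ?_⟩
  · rw [nhds_angle_prod]
    exact image_mem_map (Metric.closedBall_mem_nhds _ hε)
  · rintro _ ⟨⟨δ, p⟩, hδp, rfl⟩
    have hδ : |δ - δ₀| ≤ ε := (le_max_left _ _).trans hδp
    have hp : dist p (c₀ 0) ≤ ε := (le_max_right _ _).trans hδp
    obtain ⟨c, hc, rfl⟩ := hex δ p hδ hp
    have hr : Reaches F θ (δ : Real.Angle) T (c 0) (c 1) :=
      (reaches_iff_traj hF hT).2 ⟨c, hc, rfl, rfl⟩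
    refine ⟨⟨_, hr⟩, ?_⟩
    rintro p' ⟨⟨δ', p''⟩, hδp', h⟩
    simp only [Prod.map_apply, id, Prod.mk.injEq] at h
    obtain ⟨hδδ', rfl⟩ := h
    have hp' : dist p'' (c₀ 0) ≤ ε := (le_max_right _ _).trans hδp'
    obtain ⟨c', hc', rfl⟩ := hex δ p'' hδ hp'
    have hr' : Reaches F θ (δ : Real.Angle) T (c' 0) (c' 1) :=
      (reaches_iff_traj hF hT).2 ⟨c', hc', rfl, rfl⟩
    simp only [Prod.map_apply, id]
    rw [hr.flow_eq hF, hr'.flow_eq hF]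
    have := hlip δ δ c c' hδ hδ hc hc' hp hp' 1 (right_mem_Icc.2 zero_le_one)
    rwa [sub_self, abs_zero, max_eq_right dist_nonneg] at this

theorem flow_tendsto (hF : PeriodicC1 F) {T : ℝ} (hT : T ≠ 0) {Δ₀ : Real.Angle} {p₀ : ℝ × ℝ}
    (hp₀ : p₀ ∈ flowDomain F θ Δ₀ T) :
    Tendsto (fun x : Real.Angle × (ℝ × ℝ) => flow F θ x.1 T x.2) (𝓝 (Δ₀, p₀))
      (𝓝 (flow F θ Δ₀ T p₀)) := by
  induction Δ₀ using Real.Angle.induction_on with | _ δ₀ =>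
  obtain ⟨q₀, hq₀⟩ := hp₀
  rw [hq₀.flow_eq hF]
  obtain ⟨c₀, hc₀, rfl, rfl⟩ := (reaches_iff_traj hF hT).1 hq₀
  obtain ⟨ε, hε, C, hC, hex, hlip⟩ := traj_dependence (hF.timeField_contDiff T) hc₀
  rw [nhds_angle_prod, tendsto_map'_iff, tendsto_iff_dist_tendsto_zero]
  have hlim : Tendsto (fun x : ℝ × (ℝ × ℝ) => C * dist x (δ₀, c₀ 0)) (𝓝 (δ₀, c₀ 0)) (𝓝 0) := by
    have : Continuous fun x : ℝ × (ℝ × ℝ) => C * dist x (δ₀, c₀ 0) := by fun_prop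
    simpa using this.tendsto (δ₀, c₀ 0)
  refine squeeze_zero' (Eventually.of_forall fun _ => dist_nonneg) ?_ hlim
  filter_upwards [Metric.closedBall_mem_nhds (δ₀, c₀ 0) hε] with ⟨δ, p⟩ hδp
  have hδ : |δ - δ₀| ≤ ε := (le_max_left _ _).trans hδp
  have hp : dist p (c₀ 0) ≤ ε := (le_max_right _ _).trans hδp
  obtain ⟨c, hc, rfl⟩ := hex δ p hδ hp
  have hr : Reaches F θ (δ : Real.Angle) T (c 0) (c 1) :=
    (reaches_iff_traj hF hT).2 ⟨c, hc, rfl, rfl⟩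
  simp only [Function.comp, Prod.map_apply, id]
  rw [hr.flow_eq hF]
  exact hlip δ δ₀ c c₀ hδ (by simpa using hε.le) hc hc₀ hp (by simpa using hε.le) 1
    (right_mem_Icc.2 zero_le_one)

/-! ### A continuous logarithm along the flow -/

/-- At time `ε` the quotient $1-\varphi/e$ has positive real part, so the principal branch provides
a logarithm of $\varphi-e$. The difference never vanishes afterwards, and the homotopy lifts through
the covering `Complex.exp`. -/
lemma exists_log_of_homotopy {A : Type*} [TopologicalSpace A] {ε : ℝ} (hε : ε ∈ Ioo (0 : ℝ) 1)
    (φ : ℝ → A → ℂ) (hφ : ContinuousOn (fun x : ℝ × A => φ x.1 x.2) (Icc ε 1 ×ˢ univ))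
    (e : ℝ → ℂ) (he : ContinuousOn e (Icc ε 1)) (hne : ∀ t ∈ Icc ε 1, ∀ a, φ t a ≠ e t)
    (hlt : ∀ a, ‖φ ε a‖ < ‖e ε‖) :
    ∃ L : A → ℂ, Continuous L ∧ ∀ a, Complex.exp (L a) = φ 1 a - e 1 := by
  have hs : ∀ s : unitInterval, ε + (1 - ε) * s ∈ Icc ε 1 := fun s => by
    have := s.2.1; have := s.2.2; constructor <;> nlinarith [hε.1, hε.2]
  let H : C(unitInterval × A, {z : ℂ // z ≠ 0}) :=
    ⟨fun x => ⟨φ (ε + (1 - ε) * x.1) x.2 - e (ε + (1 - ε) * x.1), sub_ne_zero.2 (hne _ (hs _) _)⟩,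
      Continuous.subtype_mk (Continuous.sub
        (hφ.comp_continuous (f := fun x : unitInterval × A => (ε + (1 - ε) * (x.1 : ℝ), x.2))
          (by fun_prop) fun x => ⟨hs _, mem_univ _⟩)
        (he.comp_continuous (f := fun x : unitInterval × A => ε + (1 - ε) * (x.1 : ℝ))
          (by fun_prop) fun x => hs _)) _⟩
  have hε1 : ε ∈ Icc ε 1 := ⟨le_rfl, hε.2.le⟩
  have hφε : Continuous fun a => φ ε a :=
    hφ.comp_continuous (f := fun a : A => (ε, a)) (by fun_prop) fun x => ⟨hε1, mem_univ _⟩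
  have he0 : ∀ _ : A, e ε ≠ 0 := fun a => norm_pos_iff.1 ((norm_nonneg _).trans_lt (hlt a))
  have hpos : ∀ a, 0 < (1 - φ ε a / e ε).re := by
    intro a
    have h1 : ‖φ ε a / e ε‖ < 1 := by
      rw [norm_div, div_lt_one (norm_pos_iff.2 (he0 a))]; exact hlt a
    have h2 := (abs_le.1 (Complex.abs_re_le_norm (φ ε a / e ε))).2
    simp only [Complex.sub_re, Complex.one_re]
    linarith
  let f : C(A, ℂ) := ⟨fun a => Complex.log (1 - φ ε a / e ε) + Complex.log (-e ε),
    (Continuous.clog (by fun_prop) fun a => Or.inl (hpos a)).add continuous_const⟩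
  have hf : ∀ a, H (0, a) = (⟨Complex.exp (f a), Complex.exp_ne_zero _⟩ : {z : ℂ // z ≠ 0}) := by
    intro a
    refine Subtype.ext ?_
    have h1 : (1 - φ ε a / e ε) ≠ 0 := fun h => by simpa [h] using hpos a
    simp only [H, f, ContinuousMap.coe_mk, Set.Icc.coe_zero, mul_zero, add_zero]
    rw [Complex.exp_add, Complex.exp_log h1, Complex.exp_log (neg_ne_zero.2 (he0 a))]
    rw [mul_neg, sub_mul, div_mul_cancel₀ _ (he0 a)]
    ring
  refine ⟨fun a => Complex.isCoveringMap_exp.liftHomotopy H f hf (1, a), by fun_prop, fun a => ?_⟩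
  have := congrArg Subtype.val
    (congrFun (Complex.isCoveringMap_exp.liftHomotopy_lifts H f hf) (1, a))
  simpa [H] using this

/-- No loop in `K` has an image winding around `e`: going back in time from $T$ to $0$, the solution
with data `e` tends to infinity, whereas the solutions issuing from `K` remain bounded and never
meet it. The chart `Ψ` is arbitrary so that a curve can be straightened before angles are measured.
-/
theorem flow_exists_log (hF : PeriodicC1 F) {T : ℝ} (hT : T ≠ 0)
    (hTn : ∃ n : ℤ, T = n * (2 * Real.pi)) {Δ : Real.Angle} {K : Set (ℝ × ℝ)} (hK : IsCompact K)
    (hKd : K ⊆ flowDomain F θ Δ T) {e : ℝ × ℝ}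
    (he : CollapsesAt F θ (Δ + ((θ * T : ℝ) : Real.Angle)) (-T) e) (Ψ : ℝ × ℝ ≃ₜ ℂ) :
    ∃ L : ℝ × ℝ → ℂ, ContinuousOn L K ∧
      ∀ p ∈ K, Complex.exp (L p) = Ψ (flow F θ Δ T p) - Ψ e := by
  obtain ⟨d, hd, hd0, hdlim⟩ := he
  have hTn' : ∃ n : ℤ, -T = n * (2 * Real.pi) := by
    obtain ⟨n, hn⟩ := hTn; exact ⟨-n, by rw [hn]; push_cast; ring⟩
  have hd' := hd.shift hF hTn'
  have hΔ : Δ + ((θ * T : ℝ) : Real.Angle) + ((θ * -T : ℝ) : Real.Angle) = Δ := by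
    rw [mul_neg, Real.Angle.coe_neg]; abel
  rw [hΔ] at hd'
  have hset : (fun x => x + -T) ⁻¹' (uIcc 0 (-T) \ {-T}) = uIcc T 0 \ {0} := by
    rw [preimage_sdiff]; simp
  rw [hset] at hd'
  -- The collapsing solution, translated to the slice `Δ`: it has data `e` at $x=T$ and blows up at
  -- $x=0$.
  set d' : ℝ → ℝ × ℝ := fun x => d (x + -T) with hd'def
  have hlim : Tendsto (fun x => |(d' x).1|) (𝓝[uIcc T 0 \ {0}] 0) atTop := by
    refine hdlim.comp (tendsto_nhdsWithin_iff.2 ⟨?_, ?_⟩)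
    · have : Tendsto (fun x : ℝ => x + -T) (𝓝 0) (𝓝 (0 + -T)) := (continuous_add_const _).tendsto 0
      rw [zero_add] at this
      exact this.mono_left nhdsWithin_le_nhds
    · filter_upwards [self_mem_nhdsWithin] with x hx
      rw [← hset] at hx
      exact hx
  choose! c hc hc0 hc1 using fun p (hp : p ∈ K) => reaches_flow (hKd hp)
  have htr := fun p hp => (hc p hp).traj
  have hcont : ContinuousOn (fun x : ℝ × K => c x.2 (T * x.1)) (Icc 0 1 ×ˢ univ) := by
    rintro ⟨t₀, p₀, hp₀⟩ ⟨ht₀, -⟩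
    obtain ⟨ε, hε, C, hC, -, hlip⟩ := traj_dependence (hF.timeField_contDiff T) (htr p₀ hp₀)
    have h1 : Tendsto (fun x : ℝ × K => C * dist (x.2 : ℝ × ℝ) p₀ + dist (c p₀ (T * x.1)) (c p₀ (T * t₀)))
        (𝓝[Icc 0 1 ×ˢ univ] (t₀, ⟨p₀, hp₀⟩)) (𝓝 (C * dist p₀ p₀ + dist (c p₀ (T * t₀)) (c p₀ (T * t₀)))) := by
      refine Tendsto.add ?_ ?_
      · have : Continuous fun x : ℝ × K => C * dist (x.2 : ℝ × ℝ) p₀ := by fun_prop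
        exact (this.tendsto (t₀, ⟨p₀, hp₀⟩)).mono_left nhdsWithin_le_nhds
      · refine Tendsto.dist ?_ tendsto_const_nhds
        have h2 := (htr p₀ hp₀).continuousOn t₀ ht₀
        exact h2.tendsto.comp (tendsto_nhdsWithin_iff.2 ⟨
          (continuous_fst.tendsto (t₀, (⟨p₀, hp₀⟩ : K))).mono_left nhdsWithin_le_nhds,
          by filter_upwards [self_mem_nhdsWithin] with x hx using hx.1⟩)
    rw [dist_self, dist_self, mul_zero, add_zero] at h1
    rw [ContinuousWithinAt, tendsto_iff_dist_tendsto_zero]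
    refine squeeze_zero' (Eventually.of_forall fun _ => dist_nonneg) ?_ h1
    have hnear : ∀ᶠ x : ℝ × K in 𝓝[Icc 0 1 ×ˢ univ] (t₀, ⟨p₀, hp₀⟩), dist (x.2 : ℝ × ℝ) p₀ ≤ ε := by
      have : Continuous fun x : ℝ × K => dist (x.2 : ℝ × ℝ) p₀ := by fun_prop
      have h3 := (this.tendsto (t₀, ⟨p₀, hp₀⟩)).mono_left
        (nhdsWithin_le_nhds (s := (Icc 0 1 ×ˢ univ : Set (ℝ × K))))
      simp only [dist_self] at h3
      exact h3.eventually (Iic_mem_nhds hε)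
    filter_upwards [self_mem_nhdsWithin, hnear] with ⟨t, p, hp⟩ ht hpε
    refine (dist_triangle _ (c p₀ (T * t)) _).trans (add_le_add_left ?_ _)
    have := hlip _ _ _ _ (by simpa using hε.le) (by simpa using hε.le) (htr p hp) (htr p₀ hp₀)
      (by simpa [hc0 p hp, hc0 p₀ hp₀] using hpε) (by simpa using hε.le) t ht.1
    simpa [hc0 p hp, hc0 p₀ hp₀] using this
  have : CompactSpace K := isCompact_iff_compactSpace.1 hK
  obtain ⟨M, hM⟩ : ∃ M, ∀ t ∈ Icc (0 : ℝ) 1, ∀ p ∈ K, ‖Ψ (c p (T * t))‖ ≤ M := by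
    obtain ⟨M, hM⟩ := ((isCompact_Icc.prod isCompact_univ).image_of_continuousOn
      (Ψ.continuous.comp_continuousOn hcont)).isBounded.exists_norm_le
    exact ⟨M, fun t ht p hp => hM _ ⟨(t, ⟨p, hp⟩), ⟨ht, mem_univ _⟩, rfl⟩⟩
  have hcoc : Tendsto (fun x => ‖Ψ (d' x)‖) (𝓝[uIcc T 0 \ {0}] 0) atTop := by
    have h1 : Tendsto d' (𝓝[uIcc T 0 \ {0}] 0) (cocompact (ℝ × ℝ)) := by
      rw [← Metric.cobounded_eq_cocompact, ← tendsto_norm_atTop_iff_cobounded]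
      exact tendsto_atTop_mono (fun x => le_max_left _ _) hlim
    have h2 := Ψ.isClosedEmbedding.tendsto_cocompact.comp h1
    rw [← Metric.cobounded_eq_cocompact] at h2
    exact tendsto_norm_atTop_iff_cobounded.2 h2
  have hTt : ∀ t ∈ Ioc (0 : ℝ) 1, T * t ∈ uIcc T 0 \ {0} := by
    intro t ht
    refine ⟨?_, by simpa using ⟨hT, ht.1.ne'⟩⟩
    rw [mem_uIcc]
    rcases le_total 0 T with h | h
    · right; constructor <;> nlinarith [ht.1, ht.2]
    · left; constructor <;> nlinarith [ht.1, ht.2]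
  -- A homeomorphism of the plane onto ℂ respects infinity, so shortly after time 0 the point `Ψ (d'
  -- _)` lies outside the disc containing the images of all the other solutions.
  obtain ⟨ε, hε, hεM⟩ : ∃ ε ∈ Ioo (0 : ℝ) 1, M < ‖Ψ (d' (T * ε))‖ := by
    have h1 : Tendsto (fun t : ℝ => T * t) (𝓝[>] 0) (𝓝[uIcc T 0 \ {0}] 0) := by
      refine tendsto_nhdsWithin_iff.2 ⟨?_, ?_⟩
      · have : Tendsto (fun t : ℝ => T * t) (𝓝 0) (𝓝 (T * 0)) := (continuous_const_mul T).tendsto 0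
        rw [mul_zero] at this
        exact this.mono_left nhdsWithin_le_nhds
      · filter_upwards [Ioc_mem_nhdsGT (zero_lt_one (α := ℝ))] with t ht using hTt t ht
    obtain ⟨t, h, ht⟩ := ((hcoc.comp h1).eventually_gt_atTop M |>.and
      (Ioo_mem_nhdsGT (zero_lt_one (α := ℝ)))).exists
    exact ⟨t, ht, h⟩
  have hsub : Icc ε 1 ⊆ Ioc (0 : ℝ) 1 := fun t ht => ⟨hε.1.trans_le ht.1, ht.2⟩
  obtain ⟨L, hL, hexp⟩ := exists_log_of_homotopy (A := K) hε (fun t p => Ψ (c p (T * t)))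
    ((Ψ.continuous.comp_continuousOn hcont).mono
      (prod_mono (fun t ht => ⟨(hsub ht).1.le, ht.2⟩) Subset.rfl))
    (fun t => Ψ (d' (T * t)))
    (Ψ.continuous.comp_continuousOn (hd'.continuousOn.comp (by fun_prop)
      fun t ht => hTt t (hsub ht)))
    (fun t ht p h => (uIcc_comm 0 T ▸ hc p p.2).ne_of_collapse hF hd' hlim (hTt t (hsub ht))
      (Ψ.injective h))
    (fun p => (hM ε ⟨hε.1.le, hε.2.le⟩ p p.2).trans_lt hεM)
  classical
  refine ⟨fun p => if h : p ∈ K then L ⟨p, h⟩ else 0, ?_, fun p hp => ?_⟩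
  · rw [continuousOn_iff_continuous_domRestrict]
    convert! hL using 1
    ext p
    simp
  · simp only [hp, dif_pos]
    rw [hexp, mul_one, hc1 p hp, hd'def]
    simp [hd0]

end Flow

/-! ### Crossing lemmas for real functions -/

/-- A continuous function that crosses zero upwards at each of its zeros is positive after its
first zero. -/
lemma pos_of_crossing_up {f : ℝ → ℝ} {a b : ℝ} (hf : ContinuousOn f (Icc a b))
    (hr : ∀ x ∈ Ico a b, f x = 0 → ∀ᶠ y in 𝓝[>] x, 0 < f y)
    (hl : ∀ x ∈ Ioc a b, f x = 0 → ∀ᶠ y in 𝓝[<] x, f y < 0) (ha : f a = 0) :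
    ∀ y ∈ Ioc a b, 0 < f y := by
  intro y hy
  by_contra! hneg
  obtain ⟨u, hu, hpos⟩ := (mem_nhdsGT_iff_exists_Ioo_subset' hy.1).1
    (hr a ⟨le_rfl, hy.1.trans_le hy.2⟩ ha)
  set m := min u y with hm
  have ham : a < m := lt_min hu hy.1
  set w := (a + m) / 2 with hw
  have haw : a < w := by linarith
  have hwm : w < m := by linarith
  have hwu : w < u := hwm.trans_le (min_le_left _ _)
  have hwy : w < y := hwm.trans_le (min_le_right _ _)
  have hsub : Icc w y ⊆ Icc a b := Icc_subset_Icc haw.le hy.2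
  have hcl : IsCompact (Icc w y ∩ f ⁻¹' Iic 0) :=
    isCompact_Icc.of_isClosed_subset
      ((hf.mono hsub).preimage_isClosed_of_isClosed isClosed_Icc isClosed_Iic) inter_subset_left
  obtain ⟨x, ⟨hx, hx0⟩, hleast⟩ := hcl.exists_isLeast ⟨y, right_mem_Icc.2 hwy.le, hneg⟩
  have hwx : w < x := by
    refine lt_of_le_of_ne hx.1 fun h => ?_
    have h1 : 0 < f w := hpos (show w ∈ Ioo a u from ⟨haw, hwu⟩)
    rw [h] at h1
    exact absurd h1 (not_lt.2 hx0)
  have hbefore : ∀ z ∈ Ioo w x, 0 < f z := by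
    intro z hz
    by_contra! h
    exact absurd (hleast ⟨⟨hz.1.le, hz.2.le.trans hx.2⟩, h⟩) (not_le.2 hz.2)
  have hev : ∀ᶠ z in 𝓝[<] x, 0 < f z := mem_of_superset (Ioo_mem_nhdsLT hwx) hbefore
  have hge : 0 ≤ f x := by
    have h1 : Tendsto f (𝓝[<] x) (𝓝 (f x)) :=
      (hf x (hsub hx)).mono_left (nhdsWithin_le_of_mem
        (mem_of_superset (Ioo_mem_nhdsLT hwx) fun z hz =>
          hsub ⟨hz.1.le, hz.2.le.trans hx.2⟩))
    exact ge_of_tendsto h1 (hev.mono fun _ h => h.le)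
  have hz : f x = 0 := le_antisymm hx0 hge
  obtain ⟨z, hz1, hz2⟩ := (hev.and (hl x ⟨haw.trans hwx, (hsub hx).2⟩ hz)).exists
  exact lt_asymm hz1 hz2

lemma strictMonoOn_of_local {f : ℝ → ℝ} {a b : ℝ} (hf : ContinuousOn f (Icc a b))
    (hr : ∀ x ∈ Ico a b, ∀ᶠ y in 𝓝[>] x, f x < f y)
    (hl : ∀ x ∈ Ioc a b, ∀ᶠ y in 𝓝[<] x, f y < f x) : StrictMonoOn f (Icc a b) := by
  intro x hx y hy hxy
  have hsub : Icc x b ⊆ Icc a b := Icc_subset_Icc_left hx.1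
  have := pos_of_crossing_up (f := fun z => f z - f x) (a := x) (b := b)
    ((hf.mono hsub).sub continuousOn_const)
    (fun z hz h => (hr z ⟨hx.1.trans hz.1, hz.2⟩).mono fun w hw => by linarith)
    (fun z hz h => (hl z ⟨hx.1.trans_lt hz.1, hz.2⟩).mono fun w hw => by linarith)
    (sub_self _) y ⟨hxy, hy.2⟩
  linarith

/-! ### Types of monotonicity as signs -/

/-- The sign of the increments of an increasing or decreasing function. -/
def MonoType.sgn : MonoType → ℝ
  | .inc => 1
  | .dec => -1

lemma MonoType.sgn_opp (σ : MonoType) : σ.opp.sgn = -σ.sgn := by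
  cases σ <;> simp [MonoType.opp, MonoType.sgn]

lemma MonoType.sgn_eq (σ : MonoType) : σ.sgn = 1 ∨ σ.sgn = -1 := by
  cases σ <;> simp [MonoType.sgn]

lemma MonoType.on_iff {σ : MonoType} {f : ℝ → ℝ} {s : Set ℝ} :
    σ.On f s ↔ ∀ x ∈ s, ∀ y ∈ s, x ≤ y → 0 ≤ σ.sgn * (f y - f x) := by
  cases σ
  · simp only [MonoType.On, MonoType.sgn, MonotoneOn]
    refine ⟨fun h x hx y hy hxy => ?_, fun h x hx y hy hxy => ?_⟩
    · have := h hx hy hxy; linarith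
    · have := h x hx y hy hxy; linarith
  · simp only [MonoType.On, MonoType.sgn, AntitoneOn]
    refine ⟨fun h x hx y hy hxy => ?_, fun h x hx y hy hxy => ?_⟩
    · have := h hx hy hxy; linarith
    · have := h x hx y hy hxy; linarith

/-- The increments of `f` have the sign `s` (or vanish). -/
def MonoS (s : ℝ) (f : ℝ → ℝ) : Prop := ∀ x y, x ≤ y → 0 ≤ s * (f y - f x)

lemma MonoS.comp_anti {s : ℝ} {f g : ℝ → ℝ} (hs : s = 1 ∨ s = -1) (hf : MonoS s f)
    (hg : MonoS (-s) g) : Antitone (f ∘ g) := by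
  intro x y hxy
  have h1 := hg x y hxy
  simp only [Function.comp]
  rcases hs with rfl | rfl
  · have h2 := hf (g y) (g x) (by linarith); linarith
  · have h2 := hf (g x) (g y) (by linarith); linarith

namespace Arc

variable {a : Arc} {γ : ℝ} {σ : MonoType}

lemma clamp_mem (a : Arc) (x : ℝ) : max a.lo (min a.hi x) ∈ Icc a.lo a.hi :=
  ⟨le_max_left _ _, max_le a.le (min_le_left _ _)⟩

lemma ext_of_mem {x : ℝ} (hx : x ∈ Icc a.lo a.hi) : a.ext x = a.f x := by
  rw [Arc.ext, min_eq_right hx.2, max_eq_right hx.1]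

lemma ext_of_le {x : ℝ} (hx : x ≤ a.lo) : a.ext x = a.f a.lo := by
  rw [Arc.ext, max_eq_left ((min_le_right _ _).trans hx)]

lemma ext_of_ge {x : ℝ} (hx : a.hi ≤ x) : a.ext x = a.f a.hi := by
  rw [Arc.ext, min_eq_left hx, max_eq_right a.le]

lemma MonoLip.monoS (h : a.MonoLip γ σ) : MonoS σ.sgn a.ext := fun x y hxy =>
  MonoType.on_iff.1 h.1 _ (a.clamp_mem x) _ (a.clamp_mem y)
    (max_le_max le_rfl (min_le_min le_rfl hxy))

lemma MonoLip.abs_ext_sub_le (h : a.MonoLip γ σ) (hγ : 0 ≤ γ) (x y : ℝ) :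
    |a.ext x - a.ext y| ≤ γ * |x - y| := by
  refine (h.2 _ (a.clamp_mem x) _ (a.clamp_mem y)).trans (mul_le_mul_of_nonneg_left ?_ hγ)
  have h1 : LipschitzWith 1 (fun x : ℝ => max a.lo (min a.hi x)) :=
    (LipschitzWith.id.const_min _).const_max _
  simpa [Real.dist_eq] using h1.dist_le_mul x y

lemma MonoLip.continuous (h : a.MonoLip γ σ) (hγ : 0 ≤ γ) : Continuous a.ext := by
  have : LipschitzWith γ.toNNReal a.ext := LipschitzWith.of_dist_le_mul fun x y => by
    simpa [Real.dist_eq, Real.coe_toNNReal _ hγ] using h.abs_ext_sub_le hγ x y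
  exact this.continuous

lemma MonoLip.exists_bound (h : a.MonoLip γ σ) : ∃ B, ∀ x, |a.ext x| ≤ B := by
  refine ⟨max |a.f a.lo| |a.f a.hi|, fun x => ?_⟩
  have h1 := MonoType.on_iff.1 h.1 _ (left_mem_Icc.2 a.le) _ (a.clamp_mem x) (a.clamp_mem x).1
  have h2 := MonoType.on_iff.1 h.1 _ (a.clamp_mem x) _ (right_mem_Icc.2 a.le) (a.clamp_mem x).2
  change 0 ≤ σ.sgn * (a.ext x - a.f a.lo) at h1
  change 0 ≤ σ.sgn * (a.f a.hi - a.ext x) at h2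
  rcases σ.sgn_eq with hs | hs <;> rw [hs] at h1 h2
  · exact abs_le_max_abs_abs (by linarith) (by linarith)
  · rw [max_comm]; exact abs_le_max_abs_abs (by linarith) (by linarith)

end Arc

/-! ### Geometry of curvilinear quadrangles -/

namespace Quad

/-- The quadrangle with the two coordinates interchanged. -/
def swap (Q : Quad) : Quad := ⟨Q.βm, Q.βp, Q.αm, Q.αp⟩

/-- The closed region cut out by the four sides. -/
def closedRegion (Q : Quad) : Set (ℝ × ℝ) :=
  {p | Q.αm.ext p.1 ≤ p.2 ∧ p.2 ≤ Q.αp.ext p.1 ∧ Q.βm.ext p.2 ≤ p.1 ∧ p.1 ≤ Q.βp.ext p.2}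

variable {Q : Quad} {γ : ℝ} {σ : MonoType}

lemma _root_.QuasiStrips.MonoType.opp_opp (σ : MonoType) : σ.opp.opp = σ := by cases σ <;> rfl

lemma IsQuadrangle.swap (h : Q.IsQuadrangle γ σ) : Q.swap.IsQuadrangle γ σ.opp where
  αm_mono := h.βm_mono
  αp_mono := h.βp_mono
  βm_mono := by rw [MonoType.opp_opp]; exact h.αm_mono
  βp_mono := by rw [MonoType.opp_opp]; exact h.αp_mono
  α_lt := h.β_lt
  β_lt := h.α_lt
  corner_mm := ⟨h.corner_mm.2, h.corner_mm.1⟩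
  corner_mp := ⟨h.corner_pm.2, h.corner_pm.1⟩
  corner_pm := ⟨h.corner_mp.2, h.corner_mp.1⟩
  corner_pp := ⟨h.corner_pp.2, h.corner_pp.1⟩

lemma region_swap (Q : Quad) : Q.swap.region = Prod.swap ⁻¹' Q.region := by
  ext p
  simp only [region, swap, mem_ofPred_eq, mem_preimage, Prod.fst_swap, Prod.snd_swap]
  tauto

lemma region_subset_closedRegion (Q : Quad) : Q.region ⊆ Q.closedRegion :=
  fun _ h => ⟨h.1.le, h.2.1.le, h.2.2.1.le, h.2.2.2.le⟩

lemma swap_mem_closedRegion {p : ℝ × ℝ} : p.swap ∈ Q.swap.closedRegion ↔ p ∈ Q.closedRegion := by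
  simp only [closedRegion, swap, mem_ofPred_eq, Prod.fst_swap, Prod.snd_swap]
  tauto

lemma IsQuadrangle.isOpen_region (h : Q.IsQuadrangle γ σ) (hγ : 0 ≤ γ) : IsOpen Q.region := by
  have h1 := h.αm_mono.continuous hγ
  have h2 := h.αp_mono.continuous hγ
  have h3 := h.βm_mono.continuous hγ
  have h4 := h.βp_mono.continuous hγ
  simp only [region, ofPred_and]
  refine IsOpen.inter ?_ (IsOpen.inter ?_ (IsOpen.inter ?_ ?_)) <;>
    exact isOpen_lt (by fun_prop) (by fun_prop)

lemma IsQuadrangle.isClosed_closedRegion (h : Q.IsQuadrangle γ σ) (hγ : 0 ≤ γ) :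
    IsClosed Q.closedRegion := by
  have h1 := h.αm_mono.continuous hγ
  have h2 := h.αp_mono.continuous hγ
  have h3 := h.βm_mono.continuous hγ
  have h4 := h.βp_mono.continuous hγ
  simp only [closedRegion, ofPred_and]
  refine IsClosed.inter ?_ (IsClosed.inter ?_ (IsClosed.inter ?_ ?_)) <;>
    exact isClosed_le (by fun_prop) (by fun_prop)

lemma IsQuadrangle.closure_subset (h : Q.IsQuadrangle γ σ) (hγ : 0 ≤ γ) :
    closure Q.region ⊆ Q.closedRegion :=
  closure_minimal Q.region_subset_closedRegion (h.isClosed_closedRegion hγ)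

lemma IsQuadrangle.exists_bound (h : Q.IsQuadrangle γ σ) :
    ∃ B, ∀ p ∈ Q.closedRegion, |p.1| ≤ B ∧ |p.2| ≤ B := by
  obtain ⟨B1, h1⟩ := h.αm_mono.exists_bound
  obtain ⟨B2, h2⟩ := h.αp_mono.exists_bound
  obtain ⟨B3, h3⟩ := h.βm_mono.exists_bound
  obtain ⟨B4, h4⟩ := h.βp_mono.exists_bound
  refine ⟨max (max B1 B2) (max B3 B4), fun p hp => ⟨?_, ?_⟩⟩
  · refine (abs_le_max_abs_abs hp.2.2.1 hp.2.2.2).trans ((max_le_max (h3 _) (h4 _)).trans ?_)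
    exact le_max_right _ _
  · refine (abs_le_max_abs_abs hp.1 hp.2.1).trans ((max_le_max (h1 _) (h2 _)).trans ?_)
    exact le_max_left _ _

/-- Points of the closed region off the `β`-sides are limits of points of the open region. -/
lemma IsQuadrangle.mem_closure (h : Q.IsQuadrangle γ σ) (hγ : 0 ≤ γ) {p : ℝ × ℝ}
    (h1 : Q.αm.ext p.1 ≤ p.2) (h2 : p.2 ≤ Q.αp.ext p.1) (h3 : Q.βm.ext p.2 < p.1)
    (h4 : p.1 < Q.βp.ext p.2) : p ∈ closure Q.region := by
  set m := (Q.αm.ext p.1 + Q.αp.ext p.1) / 2 with hm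
  have hα := h.α_lt p.1
  have hβm := h.βm_mono.continuous hγ
  have hβp := h.βp_mono.continuous hγ
  have hlim : Tendsto (fun t : ℝ => (p.1, p.2 + t * (m - p.2))) (𝓝[>] 0) (𝓝 p) := by
    have : Continuous fun t : ℝ => (p.1, p.2 + t * (m - p.2)) := by fun_prop
    have := this.tendsto 0
    simp only [zero_mul, add_zero] at this
    exact this.mono_left nhdsWithin_le_nhds
  refine mem_closure_of_tendsto hlim ?_
  have e3 : ∀ᶠ q in 𝓝 p, Q.βm.ext q.2 < q.1 :=
    (isOpen_lt (by fun_prop) (by fun_prop)).mem_nhds h3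
  have e4 : ∀ᶠ q in 𝓝 p, q.1 < Q.βp.ext q.2 :=
    (isOpen_lt (by fun_prop) (by fun_prop)).mem_nhds h4
  filter_upwards [hlim.eventually e3, hlim.eventually e4, Ioo_mem_nhdsGT (zero_lt_one (α := ℝ))]
    with t ht3 ht4 ht
  refine ⟨?_, ?_, ht3, ht4⟩
  · change Q.αm.ext p.1 < p.2 + t * (m - p.2)
    nlinarith [ht.1, ht.2]
  · change p.2 + t * (m - p.2) < Q.αp.ext p.1
    nlinarith [ht.1, ht.2]

/-- A point on the constant continuation of the side beyond a corner would have the height of that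
corner, where the β-side cuts the closed region off. -/
lemma IsQuadrangle.mem_αm (h : Q.IsQuadrangle γ σ) {p : ℝ × ℝ} (hp : p ∈ Q.closedRegion)
    (he : p.2 = Q.αm.ext p.1) : p ∈ Q.αm.hGraph := by
  have hmem : p.1 ∈ Icc Q.αm.lo Q.αm.hi := by
    constructor
    · by_contra! hlt
      rw [Arc.ext_of_le hlt.le, h.corner_mm.1] at he
      have := hp.2.2.1
      rw [he, Arc.ext_of_mem (left_mem_Icc.2 Q.βm.le), h.corner_mm.2] at this
      linarith
    · by_contra! hlt
      rw [Arc.ext_of_ge hlt.le, h.corner_mp.1] at he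
      have := hp.2.2.2
      rw [he, Arc.ext_of_mem (left_mem_Icc.2 Q.βp.le), h.corner_mp.2] at this
      linarith
  exact ⟨hmem, by rw [he, Arc.ext_of_mem hmem]⟩

lemma IsQuadrangle.mem_αp (h : Q.IsQuadrangle γ σ) {p : ℝ × ℝ} (hp : p ∈ Q.closedRegion)
    (he : p.2 = Q.αp.ext p.1) : p ∈ Q.αp.hGraph := by
  have hmem : p.1 ∈ Icc Q.αp.lo Q.αp.hi := by
    constructor
    · by_contra! hlt
      rw [Arc.ext_of_le hlt.le, h.corner_pm.1] at he
      have := hp.2.2.1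
      rw [he, Arc.ext_of_mem (right_mem_Icc.2 Q.βm.le), h.corner_pm.2] at this
      linarith
    · by_contra! hlt
      rw [Arc.ext_of_ge hlt.le, h.corner_pp.1] at he
      have := hp.2.2.2
      rw [he, Arc.ext_of_mem (right_mem_Icc.2 Q.βp.le), h.corner_pp.2] at this
      linarith
  exact ⟨hmem, by rw [he, Arc.ext_of_mem hmem]⟩

lemma IsQuadrangle.mem_βm (h : Q.IsQuadrangle γ σ) {p : ℝ × ℝ} (hp : p ∈ Q.closedRegion)
    (he : p.1 = Q.βm.ext p.2) : p ∈ Q.βm.vGraph :=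
  h.swap.mem_αm (swap_mem_closedRegion.2 hp) he

lemma IsQuadrangle.mem_βp (h : Q.IsQuadrangle γ σ) {p : ℝ × ℝ} (hp : p ∈ Q.closedRegion)
    (he : p.1 = Q.βp.ext p.2) : p ∈ Q.βp.vGraph :=
  h.swap.mem_αp (swap_mem_closedRegion.2 hp) he

/-- The function `b` of `u'` separates the two `β`-sides in the closed region. -/
structure IsCut (Q : Quad) (σ : MonoType) (b : ℝ → ℝ) : Prop where
  continuous : Continuous b
  mono : MonoS (-σ.sgn) b
  right_of_βm : ∀ p ∈ Q.closedRegion, p.1 = Q.βm.ext p.2 → p.1 ≤ b p.2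
  left_of_βp : ∀ p ∈ Q.closedRegion, p.1 = Q.βp.ext p.2 → b p.2 ≤ p.1

lemma isCut_of_mem {b : ℝ → ℝ} (hb : Continuous b)
    (hm : MonoS (-σ.sgn) b) (h1 : ∀ y, Q.βm.ext y ≤ b y) (h2 : ∀ y, b y ≤ Q.βp.ext y) :
    Q.IsCut σ b :=
  ⟨hb, hm, fun _ _ hp => hp ▸ h1 _, fun _ _ hp => hp ▸ h2 _⟩

lemma IsQuadrangle.monoS_βm (h : Q.IsQuadrangle γ σ) : MonoS (-σ.sgn) Q.βm.ext := by
  rw [← MonoType.sgn_opp]; exact h.βm_mono.monoS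

lemma IsQuadrangle.monoS_βp (h : Q.IsQuadrangle γ σ) : MonoS (-σ.sgn) Q.βp.ext := by
  rw [← MonoType.sgn_opp]; exact h.βp_mono.monoS

/-- The curve halfway between the `β`-sides. -/
def mid (Q : Quad) (y : ℝ) : ℝ := (Q.βm.ext y + Q.βp.ext y) / 2

lemma IsQuadrangle.βm_lt_mid (h : Q.IsQuadrangle γ σ) (y : ℝ) : Q.βm.ext y < Q.mid y := by
  have := h.β_lt y; simp only [mid]; linarith

lemma IsQuadrangle.mid_lt_βp (h : Q.IsQuadrangle γ σ) (y : ℝ) : Q.mid y < Q.βp.ext y := by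
  have := h.β_lt y; simp only [mid]; linarith

lemma IsQuadrangle.continuous_mid (h : Q.IsQuadrangle γ σ) (hγ : 0 ≤ γ) : Continuous Q.mid := by
  have h3 := h.βm_mono.continuous hγ
  have h4 := h.βp_mono.continuous hγ
  unfold mid
  fun_prop

lemma IsQuadrangle.monoS_mid (h : Q.IsQuadrangle γ σ) : MonoS (-σ.sgn) Q.mid := by
  intro x y hxy
  have h1 := h.monoS_βm x y hxy
  have h2 := h.monoS_βp x y hxy
  simp only [mid]; linarith

lemma IsQuadrangle.isCut_mid (h : Q.IsQuadrangle γ σ) (hγ : 0 ≤ γ) : Q.IsCut σ Q.mid :=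
  isCut_of_mem (h.continuous_mid hγ) h.monoS_mid (fun y => (h.βm_lt_mid y).le)
    (fun y => (h.mid_lt_βp y).le)

/-- The part of the middle curve in the region is an arc that joins the `α`-sides. -/
lemma IsQuadrangle.exists_mid_ends (h : Q.IsQuadrangle γ σ) (hγ : 0 ≤ γ) :
    ∃ y₁ y₂, y₁ < y₂ ∧ (Q.mid y₁, y₁) ∈ Q.αm.hGraph ∧ (Q.mid y₂, y₂) ∈ Q.αp.hGraph ∧
      ∀ y, (Q.mid y, y) ∈ Q.region ↔ y ∈ Ioo y₁ y₂ := by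
  have hmc := h.continuous_mid hγ
  have key : ∀ a : Arc, a.MonoLip γ σ →
      StrictMono (fun y => y - a.ext (Q.mid y)) ∧ ∃ y, y - a.ext (Q.mid y) = 0 := by
    intro a ha
    have hac := ha.continuous hγ
    have hanti := MonoS.comp_anti σ.sgn_eq ha.monoS h.monoS_mid
    obtain ⟨B, hB⟩ := ha.exists_bound
    refine ⟨fun x y hxy => ?_, ?_⟩
    · have := hanti hxy.le
      simp only [Function.comp] at this
      simp only; linarith
    · have hB0 : 0 ≤ B := (abs_nonneg _).trans (hB 0)
      have hc : ContinuousOn (fun y => y - a.ext (Q.mid y)) (Icc (-B) B) := by fun_prop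
      obtain ⟨y, -, hy⟩ := intermediate_value_Icc (by linarith : -B ≤ B) hc
        (show (0 : ℝ) ∈ Icc _ _ from
          ⟨by have := abs_le.1 (hB (Q.mid (-B))); linarith,
            by have := abs_le.1 (hB (Q.mid B)); linarith⟩)
      exact ⟨y, hy⟩
  obtain ⟨hs1, y₁, hy₁⟩ := key _ h.αm_mono
  obtain ⟨hs2, y₂, hy₂⟩ := key _ h.αp_mono
  have hlt : y₁ < y₂ := hs2.lt_iff_lt.1 (by
    simp only [hy₂]
    have := h.α_lt (Q.mid y₁)
    linarith)
  have hcl : ∀ y ∈ Icc y₁ y₂, (Q.mid y, y) ∈ Q.closedRegion := by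
    intro y hy
    have e1 := hs1.monotone hy.1
    have e2 := hs2.monotone hy.2
    simp only [hy₁, hy₂] at e1 e2
    exact ⟨by simpa using e1, by simpa using e2, (h.βm_lt_mid y).le, (h.mid_lt_βp y).le⟩
  refine ⟨y₁, y₂, hlt, h.mem_αm (hcl _ (left_mem_Icc.2 hlt.le)) (by simp only; linarith),
    h.mem_αp (hcl _ (right_mem_Icc.2 hlt.le)) (by simp only; linarith), fun y => ?_⟩
  have e1 := hs1.lt_iff_lt (a := y₁) (b := y)
  have e2 := hs2.lt_iff_lt (a := y) (b := y₂)
  simp only [hy₁, hy₂] at e1 e2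
  simp only [region, mem_ofPred_eq, h.βm_lt_mid y, h.mid_lt_βp y, and_true, mem_Ioo, ← e1, ← e2,
    sub_pos, sub_neg]

/-! ### Curves joining the α-sides, as cuts of the quadrangle. -/

section VCurve

variable {b : Arc}

/-- The end points of the curve are on the α-sides and its continuation has constant `u`, so beyond
the ends it is outside the closed region. -/
lemma vCurve_mem_Icc (hb : IsVCurve γ σ Q b) {p : ℝ × ℝ}
    (hp : p ∈ Q.closedRegion) (he : p.1 = b.ext p.2) : p.2 ∈ Icc b.lo b.hi := by
  constructor
  · by_contra! hlt
    rw [Arc.ext_of_le hlt.le] at he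
    have h1 := hb.bottom
    have h2 : b.lo = Q.αm.ext (b.f b.lo) := by rw [Arc.ext_of_mem h1.1]; exact h1.2
    have := hp.1
    rw [he, ← h2] at this
    linarith
  · by_contra! hlt
    rw [Arc.ext_of_ge hlt.le] at he
    have h1 := hb.top
    have h2 : b.hi = Q.αp.ext (b.f b.hi) := by rw [Arc.ext_of_mem h1.1]; exact h1.2
    have := hp.2.1
    rw [he, ← h2] at this
    linarith

/-- Between the end heights the curve is inside the quadrangle. At other heights the continuation
need not lie between the continued β-sides; there the comparison at points of the closed region
follows from the monotonicity of the α-side when `σ.sgn = 1`, and of the β-side when `σ.sgn = -1`.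
-/
lemma IsQuadrangle.isCut_vCurve (h : Q.IsQuadrangle γ σ) (hγ : 0 ≤ γ) (hb : IsVCurve γ σ Q b) :
    Q.IsCut σ b.ext := by
  have hcl : ∀ y ∈ Icc b.lo b.hi, (b.ext y, y) ∈ Q.closedRegion := fun y hy =>
    h.closure_subset hγ (hb.subset ⟨hy, Arc.ext_of_mem hy⟩)
  have hlo := hcl _ (left_mem_Icc.2 b.le)
  have hhi := hcl _ (right_mem_Icc.2 b.le)
  have hlo2 : b.lo = Q.αm.ext (b.ext b.lo) := by
    rw [Arc.ext_of_mem (left_mem_Icc.2 b.le), Arc.ext_of_mem hb.bottom.1]; exact hb.bottom.2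
  have hhi2 : b.hi = Q.αp.ext (b.ext b.hi) := by
    rw [Arc.ext_of_mem (right_mem_Icc.2 b.le), Arc.ext_of_mem hb.top.1]; exact hb.top.2
  refine ⟨hb.mono.continuous hγ, by rw [← MonoType.sgn_opp]; exact hb.mono.monoS, ?_, ?_⟩
  · intro p hp he
    rcases lt_or_ge p.2 b.lo with hlt | hge
    · by_contra! hgt
      rw [Arc.ext_of_le hlt.le, ← Arc.ext_of_mem (left_mem_Icc.2 b.le)] at hgt
      have h1 := h.αm_mono.monoS _ _ hgt.le
      have h2 := h.monoS_βm _ _ hlt.le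
      have h3 := hp.1
      have h4 := hlo.2.2.1
      simp only at h4
      rcases σ.sgn_eq with hs | hs <;> rw [hs] at h1 h2 <;> linarith
    · rcases lt_or_ge b.hi p.2 with hlt | hge'
      · by_contra! hgt
        rw [Arc.ext_of_ge hlt.le, ← Arc.ext_of_mem (right_mem_Icc.2 b.le)] at hgt
        have h1 := h.αp_mono.monoS _ _ hgt.le
        have h2 := h.monoS_βm _ _ hlt.le
        have h3 := hp.2.1
        have h4 := hhi.2.2.1
        simp only at h4
        rcases σ.sgn_eq with hs | hs <;> rw [hs] at h1 h2 <;> linarith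
      · rw [he]; exact (hcl _ ⟨hge, hge'⟩).2.2.1
  · intro p hp he
    rcases lt_or_ge p.2 b.lo with hlt | hge
    · by_contra! hgt
      rw [Arc.ext_of_le hlt.le, ← Arc.ext_of_mem (left_mem_Icc.2 b.le)] at hgt
      have h1 := h.αm_mono.monoS _ _ hgt.le
      have h2 := h.monoS_βp _ _ hlt.le
      have h3 := hp.1
      have h4 := hlo.2.2.2
      simp only at h4
      rcases σ.sgn_eq with hs | hs <;> rw [hs] at h1 h2 <;> linarith
    · rcases lt_or_ge b.hi p.2 with hlt | hge'
      · by_contra! hgt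
        rw [Arc.ext_of_ge hlt.le, ← Arc.ext_of_mem (right_mem_Icc.2 b.le)] at hgt
        have h1 := h.αp_mono.monoS _ _ hgt.le
        have h2 := h.monoS_βp _ _ hlt.le
        have h3 := hp.2.1
        have h4 := hhi.2.2.2
        simp only at h4
        rcases σ.sgn_eq with hs | hs <;> rw [hs] at h1 h2 <;> linarith
      · rw [he]; exact (hcl _ ⟨hge, hge'⟩).2.2.2

end VCurve

end Quad

/-! ### Maps of a curvilinear quadrangle across another one -/

/-- The points of the region of `Q` that `f` sends to the region of `R`. -/
def crossing (Q R : Quad) (f : ℝ × ℝ → ℝ × ℝ) : Set (ℝ × ℝ) := {p | p ∈ Q.region ∧ f p ∈ R.region}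

/-- `f : dom → dom'` is a homeomorphism with the inverse `g`; it is not defined on the `β`-sides of
`Q`, its inverse is not defined on the `α`-sides of `R`, and no loop in `dom'` winds around a point
of these sides. On the closure of `crossing Q R f` the map is differentiable, with an admitted
configuration of signs and an expansion in the direction of the first coordinate. -/
structure StripMap (γ : ℝ) (σ τ : MonoType) (Q R : Quad) (f g : ℝ × ℝ → ℝ × ℝ)
    (dom dom' : Set (ℝ × ℝ)) (η ρ : ℝ) : Prop where
  nonneg : 0 ≤ γ
  quadQ : Q.IsQuadrangle γ σ
  quadR : R.IsQuadrangle γ τ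
  isOpen_dom : IsOpen dom
  cont : ContinuousOn f dom
  cont' : ContinuousOn g dom'
  mapsTo' : MapsTo g dom' dom
  mapsTo : MapsTo f dom dom'
  left_inv : ∀ p ∈ dom, g (f p) = p
  right_inv : ∀ q ∈ dom', f (g q) = q
  Q_subset : Q.region ⊆ dom
  R_subset : R.region ⊆ dom'
  β_notMem : ∀ p ∈ Q.βm.vGraph ∪ Q.βp.vGraph, p ∉ dom
  α_notMem : ∀ p ∈ R.αm.hGraph ∪ R.αp.hGraph, p ∉ dom'
  exists_log : ∀ K, IsCompact K → K ⊆ dom → ∀ e ∈ R.αm.hGraph ∪ R.αp.hGraph, ∀ Ψ : ℝ × ℝ ≃ₜ ℂ,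
    ∃ L : ℝ × ℝ → ℂ, ContinuousOn L K ∧ ∀ p ∈ K, Complex.exp (L p) = Ψ (f p) - Ψ e
  nonempty : (crossing Q R f).Nonempty
  sign : η = 1 ∨ η = -1
  one_lt : 1 < ρ
  mem_dom : closure (crossing Q R f) ⊆ dom
  deriv : ∀ p ∈ closure (crossing Q R f), ∃ A : ℝ × ℝ →L[ℝ] ℝ × ℝ, HasFDerivAt f A p ∧
    ρ ≤ η * (A (1, 0)).1 ∧ 0 < η * (σ.sgn * (A (0, 1)).1) ∧ 0 < η * (τ.sgn * (A (1, 0)).2) ∧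
    0 < η * (σ.sgn * (τ.sgn * (A (0, 1)).2))

/-- The signed deviation of `f p` from the graph `u = b u'`. -/
def cutFun (f : ℝ × ℝ → ℝ × ℝ) (η : ℝ) (b : ℝ → ℝ) (p : ℝ × ℝ) : ℝ := η * ((f p).1 - b (f p).2)

/-- The `β`-side through which curves enter `R`. -/
def entrySide (R : Quad) (η : ℝ) : ℝ → ℝ := if η = 1 then R.βm.ext else R.βp.ext

/-- The `β`-side through which curves leave `R`. -/
def exitSide (R : Quad) (η : ℝ) : ℝ → ℝ := if η = 1 then R.βp.ext else R.βm.ext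

/-- A continuous monotone line between the (continued) `α`-sides of `Q`, of the type of these. -/
structure HLine (Q : Quad) (σ : MonoType) (h : ℝ → ℝ) : Prop where
  continuous : Continuous h
  mono : MonoS σ.sgn h
  ge : ∀ x, Q.αm.ext x ≤ h x
  le : ∀ x, h x ≤ Q.αp.ext x

/-- In the quadrant $dx\ge0$, $s\,dy\ge0$ both terms of the linear part have sign $\eta$, so each of
them absorbs its share of the error, leaving $\rho'dx$ of the first one. -/
lemma cone_aux {η s a b u dx dy ε ρ ρ' : ℝ} (hη : η = 1 ∨ η = -1) (hs : s = 1 ∨ s = -1)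
    (ha : ρ ≤ η * a) (hερ : ε ≤ ρ - ρ') (hεb : ε ≤ η * (s * b))
    (he : |u - (dx * a + dy * b)| ≤ ε * (|dx| + |dy|)) (hdx : 0 ≤ dx) (hdy : 0 ≤ s * dy) :
    ρ' * dx ≤ η * u := by
  have h1 : 0 ≤ (η * a - ε - ρ') * dx := mul_nonneg (by linarith) hdx
  have h2 : 0 ≤ (η * (s * b) - ε) * (s * dy) := mul_nonneg (by linarith) hdy
  rw [abs_of_nonneg hdx] at he
  have he' := abs_le.1 he
  rcases hη with rfl | rfl <;> rcases hs with rfl | rfl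
  · rw [abs_of_nonneg (by linarith : 0 ≤ dy)] at he'; linarith [he'.1, he'.2]
  · rw [abs_of_nonpos (by linarith : dy ≤ 0)] at he'; linarith [he'.1, he'.2]
  · rw [abs_of_nonneg (by linarith : 0 ≤ dy)] at he'; linarith [he'.1, he'.2]
  · rw [abs_of_nonpos (by linarith : dy ≤ 0)] at he'; linarith [he'.1, he'.2]

lemma MonoS.sub_nonneg {t η : ℝ} {b : ℝ → ℝ} (ht : t = 1 ∨ t = -1) (hη : η = 1 ∨ η = -1)
    (hb : MonoS (-t) b) {v v' : ℝ} (h : 0 ≤ η * (t * (v' - v))) : 0 ≤ -(η * (b v' - b v)) := by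
  rcases hη with rfl | rfl <;> rcases ht with rfl | rfl
  · have := hb v v' (by linarith); linarith
  · have := hb v' v (by linarith); linarith
  · have := hb v' v (by linarith); linarith
  · have := hb v v' (by linarith); linarith

/-- The supremum of the right ends of the intervals in `S` issuing from `x₀` belongs to one of them
since `S` is closed; without `P` there, the interval could be prolonged. -/
lemma exists_right_end {S : Set ℝ} (hS : IsClosed S) (hb : BddAbove S) {P : ℝ → Prop} {x₀ : ℝ}
    (hx₀ : x₀ ∈ S) (hext : ∀ x ∈ S, ¬ P x → ∀ᶠ y in 𝓝[>] x, y ∈ S) :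
    ∃ x₂, x₀ ≤ x₂ ∧ Icc x₀ x₂ ⊆ S ∧ P x₂ := by
  set s : Set ℝ := {x | x₀ ≤ x ∧ Icc x₀ x ⊆ S} with hs
  have hne : s.Nonempty := ⟨x₀, le_rfl, by simpa using hx₀⟩
  have hsb : BddAbove s := hb.mono fun x hx => hx.2 (right_mem_Icc.2 hx.1)
  have hle : x₀ ≤ sSup s := le_csSup hsb ⟨le_rfl, by simpa using hx₀⟩
  have hIco : Ico x₀ (sSup s) ⊆ S := by
    intro x hx
    obtain ⟨t, ht, hxt⟩ := exists_lt_of_lt_csSup hne hx.2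
    exact ht.2 ⟨hx.1, hxt.le⟩
  have hIcc : Icc x₀ (sSup s) ⊆ S := by
    rcases hle.eq_or_lt with h | h
    · rw [← h]; simpa using hx₀
    · rw [← closure_Ico h.ne]; exact closure_minimal hIco hS
  refine ⟨sSup s, hle, hIcc, ?_⟩
  by_contra hP
  obtain ⟨u, hu, hsub⟩ := mem_nhdsGT_iff_exists_Ioo_subset.1 (hext _ (hIcc (right_mem_Icc.2 hle)) hP)
  have hu' : sSup s < u := hu
  have hmem : (sSup s + u) / 2 ∈ s := by
    refine ⟨by linarith, fun x hx => ?_⟩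
    rcases le_or_gt x (sSup s) with h | h
    · exact hIcc ⟨hx.1, h⟩
    · exact hsub ⟨h, by linarith [hx.2]⟩
  have := le_csSup hsb hmem
  linarith

lemma exists_left_end {S : Set ℝ} (hS : IsClosed S) (hb : BddBelow S) {P : ℝ → Prop} {x₀ : ℝ}
    (hx₀ : x₀ ∈ S) (hext : ∀ x ∈ S, ¬ P x → ∀ᶠ y in 𝓝[<] x, y ∈ S) :
    ∃ x₁, x₁ ≤ x₀ ∧ Icc x₁ x₀ ⊆ S ∧ P x₁ := by
  have htend : ∀ x : ℝ, Tendsto (fun y : ℝ => -y) (𝓝[>] x) (𝓝[<] (-x)) := fun x =>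
    tendsto_neg_nhdsGT
  obtain ⟨B, hB⟩ := hb
  obtain ⟨x₂, h1, h2, h3⟩ := exists_right_end (S := (fun x => -x) ⁻¹' S) (P := fun x => P (-x))
    (x₀ := -x₀) (hS.preimage continuous_neg) ⟨-B, fun x hx => by have := hB hx; linarith⟩ (by simpa)
    fun x hx hP => (htend x).eventually (hext _ hx hP)
  refine ⟨-x₂, by linarith, fun x hx => ?_, h3⟩
  have := h2 (show -x ∈ Icc (-x₀) x₂ from ⟨by linarith [hx.2], by linarith [hx.1]⟩)
  simpa using this

/-! ### Following a line through the closed crossing set. -/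

namespace StripMap

variable {γ : ℝ} {σ τ : MonoType} {Q R : Quad} {f g : ℝ × ℝ → ℝ × ℝ} {dom dom' : Set (ℝ × ℝ)}
  {η ρ : ℝ} (S : StripMap γ σ τ Q R f g dom dom' η ρ)

include S

lemma continuousAt {p : ℝ × ℝ} (hp : p ∈ dom) : ContinuousAt f p :=
  S.cont.continuousAt (S.isOpen_dom.mem_nhds hp)

lemma mem_closedQ {p : ℝ × ℝ} (hp : p ∈ closure (crossing Q R f)) : p ∈ Q.closedRegion :=
  S.quadQ.closure_subset S.nonneg (closure_mono (fun _ h => h.1) hp)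

lemma map_mem_closedR {p : ℝ × ℝ} (hp : p ∈ closure (crossing Q R f)) : f p ∈ R.closedRegion := by
  refine S.quadR.closure_subset S.nonneg ?_
  refine closure_mono ?_ (mem_closure_image (S.continuousAt (S.mem_dom hp)) hp)
  rintro _ ⟨p, hp, rfl⟩
  exact hp.2

/-- This and `α_lt` are where collapse enters the geometry: a point of the domain cannot lie on a
β-side of `Q`, nor can its image lie on an α-side of `R`. -/
lemma β_lt {p : ℝ × ℝ} (hp : p ∈ Q.closedRegion) (hd : p ∈ dom) :
    Q.βm.ext p.2 < p.1 ∧ p.1 < Q.βp.ext p.2 := by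
  constructor
  · exact lt_of_le_of_ne hp.2.2.1 fun h => S.β_notMem p (Or.inl (S.quadQ.mem_βm hp h.symm)) hd
  · exact lt_of_le_of_ne hp.2.2.2 fun h => S.β_notMem p (Or.inr (S.quadQ.mem_βp hp h)) hd

lemma α_lt {p : ℝ × ℝ} (hp : f p ∈ R.closedRegion) (hd : p ∈ dom) :
    R.αm.ext (f p).1 < (f p).2 ∧ (f p).2 < R.αp.ext (f p).1 := by
  have hd' := S.mapsTo hd
  constructor
  · exact lt_of_le_of_ne hp.1 fun h => S.α_notMem _ (Or.inl (S.quadR.mem_αm hp h.symm)) hd'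
  · exact lt_of_le_of_ne hp.2.1 fun h => S.α_notMem _ (Or.inr (S.quadR.mem_αp hp h)) hd'

/-- Only the β-inequalities need be strict, so lines may run along the α-sides themselves. -/
lemma mem_closure_of {p : ℝ × ℝ} (hd : p ∈ dom) (hR : f p ∈ R.region)
    (h1 : Q.αm.ext p.1 ≤ p.2) (h2 : p.2 ≤ Q.αp.ext p.1) (h3 : Q.βm.ext p.2 < p.1)
    (h4 : p.1 < Q.βp.ext p.2) : p ∈ closure (crossing Q R f) := by
  have hcl := S.quadQ.mem_closure S.nonneg h1 h2 h3 h4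
  rw [mem_closure_iff_frequently] at hcl ⊢
  have hev : ∀ᶠ q in 𝓝 p, f q ∈ R.region :=
    (S.continuousAt hd).eventually ((S.quadR.isOpen_region S.nonneg).mem_nhds hR)
  exact (hcl.and_eventually hev).mono fun q hq => hq

lemma isCut_entrySide : R.IsCut τ (entrySide R η) := by
  unfold entrySide
  have := fun y => (S.quadR.β_lt y).le
  split_ifs
  · exact Quad.isCut_of_mem (S.quadR.βm_mono.continuous S.nonneg) S.quadR.monoS_βm (fun _ => le_rfl)
      this
  · exact Quad.isCut_of_mem (S.quadR.βp_mono.continuous S.nonneg) S.quadR.monoS_βp this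
      (fun _ => le_rfl)

lemma isCut_exitSide : R.IsCut τ (exitSide R η) := by
  unfold exitSide
  have := fun y => (S.quadR.β_lt y).le
  split_ifs
  · exact Quad.isCut_of_mem (S.quadR.βp_mono.continuous S.nonneg) S.quadR.monoS_βp this
      (fun _ => le_rfl)
  · exact Quad.isCut_of_mem (S.quadR.βm_mono.continuous S.nonneg) S.quadR.monoS_βm (fun _ => le_rfl)
      this

lemma cutFun_exit_lt_entry (p : ℝ × ℝ) :
    cutFun f η (exitSide R η) p < cutFun f η (entrySide R η) p := by
  have := S.quadR.β_lt (f p).2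
  rcases S.sign with rfl | rfl
  · simp only [cutFun, exitSide, entrySide, if_true]; linarith
  · simp only [cutFun, exitSide, entrySide, if_neg (by norm_num : (-1 : ℝ) ≠ 1)]; linarith

lemma cutFun_of_closedR {p : ℝ × ℝ} (hp : f p ∈ R.closedRegion) :
    0 ≤ cutFun f η (entrySide R η) p ∧ cutFun f η (exitSide R η) p ≤ 0 := by
  have h1 := hp.2.2.1
  have h2 := hp.2.2.2
  rcases S.sign with rfl | rfl
  · simp only [cutFun, exitSide, entrySide, if_true]; constructor <;> linarith
  · simp only [cutFun, exitSide, entrySide, if_neg (by norm_num : (-1 : ℝ) ≠ 1)]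
    constructor <;> linarith

lemma mem_region_of_cutFun {p : ℝ × ℝ} (h1 : R.αm.ext (f p).1 < (f p).2)
    (h2 : (f p).2 < R.αp.ext (f p).1) (h3 : 0 < cutFun f η (entrySide R η) p)
    (h4 : cutFun f η (exitSide R η) p < 0) : f p ∈ R.region := by
  refine ⟨h1, h2, ?_⟩
  rcases S.sign with rfl | rfl
  · simp only [cutFun, exitSide, entrySide, if_true] at h3 h4; constructor <;> linarith
  · simp only [cutFun, exitSide, entrySide, if_neg (by norm_num : (-1 : ℝ) ≠ 1)] at h3 h4
    constructor <;> linarith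

lemma cutFun_nonpos_of_entry {p : ℝ × ℝ} (hp : f p ∈ R.closedRegion)
    (h : cutFun f η (entrySide R η) p = 0) {b : ℝ → ℝ} (hb : R.IsCut τ b) : cutFun f η b p ≤ 0 := by
  rcases S.sign with rfl | rfl
  · simp only [cutFun, entrySide, if_true] at h ⊢
    have := hb.right_of_βm _ hp (by linarith); linarith
  · simp only [cutFun, entrySide, if_neg (by norm_num : (-1 : ℝ) ≠ 1)] at h ⊢
    have := hb.left_of_βp _ hp (by linarith); linarith

lemma cutFun_nonneg_of_exit {p : ℝ × ℝ} (hp : f p ∈ R.closedRegion)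
    (h : cutFun f η (exitSide R η) p = 0) {b : ℝ → ℝ} (hb : R.IsCut τ b) : 0 ≤ cutFun f η b p := by
  rcases S.sign with rfl | rfl
  · simp only [cutFun, exitSide, if_true] at h ⊢
    have := hb.left_of_βp _ hp (by linarith); linarith
  · simp only [cutFun, exitSide, if_neg (by norm_num : (-1 : ℝ) ≠ 1)] at h ⊢
    have := hb.right_of_βm _ hp (by linarith); linarith

lemma continuousAt_cutFun {b : ℝ → ℝ} (hb : Continuous b) {p : ℝ × ℝ} (hp : p ∈ dom) :
    ContinuousAt (cutFun f η b) p := by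
  have h := S.continuousAt hp
  exact continuousAt_const.mul (h.fst.sub (hb.continuousAt.comp h.snd))

lemma cutFun_eq_zero {b : ℝ → ℝ} {p : ℝ × ℝ} : cutFun f η b p = 0 ↔ (f p).1 = b (f p).2 := by
  rcases S.sign with rfl | rfl <;> simp only [cutFun] <;> constructor <;> intro <;> linarith

/-- Increments of `f` at a point of the closure of the crossing set, in directions of type `σ`. -/
lemma eventually_cone {p : ℝ × ℝ} (hp : p ∈ closure (crossing Q R f)) {ρ' : ℝ} (hρ : ρ' < ρ) :
    ∀ᶠ q in 𝓝 p,
      (p.1 ≤ q.1 → 0 ≤ σ.sgn * (q.2 - p.2) → ρ' * (q.1 - p.1) ≤ η * ((f q).1 - (f p).1) ∧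
        0 ≤ η * (τ.sgn * ((f q).2 - (f p).2))) ∧
      (q.1 ≤ p.1 → 0 ≤ σ.sgn * (p.2 - q.2) → ρ' * (p.1 - q.1) ≤ η * ((f p).1 - (f q).1) ∧
        0 ≤ η * (τ.sgn * ((f p).2 - (f q).2))) := by
  obtain ⟨A, hA, h11, h12, h21, h22⟩ := S.deriv p hp
  obtain ⟨ε, hε, e1, e2, e3, e4⟩ : ∃ ε > 0, ε ≤ ρ - ρ' ∧ ε ≤ η * (σ.sgn * (A (0, 1)).1) ∧
      ε ≤ η * (τ.sgn * (A (1, 0)).2) ∧ ε ≤ η * (σ.sgn * (τ.sgn * (A (0, 1)).2)) :=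
    ⟨min (min (ρ - ρ') (η * (σ.sgn * (A (0, 1)).1)))
      (min (η * (τ.sgn * (A (1, 0)).2)) (η * (σ.sgn * (τ.sgn * (A (0, 1)).2)))),
      lt_min (lt_min (by linarith) h12) (lt_min h21 h22),
      (min_le_left _ _).trans (min_le_left _ _), (min_le_left _ _).trans (min_le_right _ _),
      (min_le_right _ _).trans (min_le_left _ _), (min_le_right _ _).trans (min_le_right _ _)⟩
  filter_upwards [hA.isLittleO.def hε] with q hq
  have hAv : A (q - p) = (q.1 - p.1) • A (1, 0) + (q.2 - p.2) • A (0, 1) := by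
    rw [← map_smul, ← map_smul, ← map_add]
    congr 1
    ext <;> simp
  have hn : ‖q - p‖ ≤ |q.1 - p.1| + |q.2 - p.2| :=
    max_le (le_add_of_nonneg_right (abs_nonneg _)) (le_add_of_nonneg_left (abs_nonneg _))
  have hq' := hq.trans (mul_le_mul_of_nonneg_left hn hε.le)
  rw [hAv] at hq'
  have hU : |((f q).1 - (f p).1) - ((q.1 - p.1) * (A (1, 0)).1 + (q.2 - p.2) * (A (0, 1)).1)| ≤
      ε * (|q.1 - p.1| + |q.2 - p.2|) := (le_max_left _ _).trans hq'
  have hV : |((f q).2 - (f p).2) - ((q.1 - p.1) * (A (1, 0)).2 + (q.2 - p.2) * (A (0, 1)).2)| ≤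
      ε * (|q.1 - p.1| + |q.2 - p.2|) := (le_max_right _ _).trans hq'
  have hV' : |τ.sgn * ((f q).2 - (f p).2) -
      ((q.1 - p.1) * (τ.sgn * (A (1, 0)).2) + (q.2 - p.2) * (τ.sgn * (A (0, 1)).2))| ≤
      ε * (|q.1 - p.1| + |q.2 - p.2|) := by
    refine le_trans (le_of_eq ?_) hV
    rcases τ.sgn_eq with h | h <;> rw [h]
    · congr 1; ring
    · rw [← abs_neg]; congr 1; ring
  have hneg : ∀ {u a b dx dy : ℝ}, |u - (dx * a + dy * b)| ≤ ε * (|dx| + |dy|) →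
      |(-u) - ((-dx) * a + (-dy) * b)| ≤ ε * (|-dx| + |-dy|) := by
    intro u a b dx dy h
    rw [abs_neg dx, abs_neg dy, ← abs_neg]
    convert h using 2; ring
  refine ⟨fun hx hy => ⟨?_, ?_⟩, fun hx hy => ⟨?_, ?_⟩⟩
  · exact cone_aux S.sign σ.sgn_eq h11 e1 e2 hU (by linarith) hy
  · have := cone_aux (ρ' := 0) S.sign σ.sgn_eq le_rfl (by linarith) e4 hV' (by linarith) hy
    linarith
  · have := cone_aux S.sign σ.sgn_eq h11 e1 e2 (hneg hU) (by linarith) (by linarith)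
    linarith
  · have := cone_aux (ρ' := 0) S.sign σ.sgn_eq le_rfl (by linarith) e4 (hneg hV')
      (by linarith) (by linarith)
    linarith

variable {h : ℝ → ℝ} (hh : HLine Q σ h)
include hh

/-- Along a line the image moves within the quadrant of type `τ`, up to the sign `η`. As `b` has the
opposite type, the change of `b` can only enlarge the increment of the deviation beyond the
expansion of the first coordinate. -/
lemma eventually_slope {x₀ : ℝ} (hx₀ : (x₀, h x₀) ∈ closure (crossing Q R f)) {b : ℝ → ℝ}
    (hb : MonoS (-τ.sgn) b) {ρ' : ℝ} (hρ : ρ' < ρ) :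
    ∀ᶠ x in 𝓝 x₀,
      (x₀ ≤ x → ρ' * (x - x₀) ≤ cutFun f η b (x, h x) - cutFun f η b (x₀, h x₀)) ∧
      (x ≤ x₀ → ρ' * (x₀ - x) ≤ cutFun f η b (x₀, h x₀) - cutFun f η b (x, h x)) := by
  have hc : Tendsto (fun x => (x, h x)) (𝓝 x₀) (𝓝 (x₀, h x₀)) :=
    (continuous_id.prodMk hh.continuous).tendsto x₀
  filter_upwards [hc.eventually (S.eventually_cone hx₀ hρ)] with x hx
  refine ⟨fun hxx => ?_, fun hxx => ?_⟩
  · obtain ⟨h1, h2⟩ := hx.1 hxx (hh.mono _ _ hxx)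
    have := hb.sub_nonneg τ.sgn_eq S.sign h2
    simp only [cutFun] at *; linarith
  · obtain ⟨h1, h2⟩ := hx.2 hxx (hh.mono _ _ hxx)
    have := hb.sub_nonneg τ.sgn_eq S.sign h2
    simp only [cutFun] at *; linarith

lemma eventually_gt {x₀ : ℝ} (hx₀ : (x₀, h x₀) ∈ closure (crossing Q R f)) {b : ℝ → ℝ}
    (hb : MonoS (-τ.sgn) b) :
    ∀ᶠ x in 𝓝[>] x₀, cutFun f η b (x₀, h x₀) < cutFun f η b (x, h x) := by
  filter_upwards [nhdsWithin_le_nhds (S.eventually_slope hh hx₀ hb S.one_lt), self_mem_nhdsWithin]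
    with x hx hxx
  have hlt : x₀ < x := hxx
  have := hx.1 hlt.le
  linarith

lemma eventually_lt {x₀ : ℝ} (hx₀ : (x₀, h x₀) ∈ closure (crossing Q R f)) {b : ℝ → ℝ}
    (hb : MonoS (-τ.sgn) b) :
    ∀ᶠ x in 𝓝[<] x₀, cutFun f η b (x, h x) < cutFun f η b (x₀, h x₀) := by
  filter_upwards [nhdsWithin_le_nhds (S.eventually_slope hh hx₀ hb S.one_lt), self_mem_nhdsWithin]
    with x hx hxx
  have hlt : x < x₀ := hxx
  have := hx.2 hlt.le
  linarith

/-- Off the sides of `R`, membership in the closure of the crossing set persists along a line. -/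
lemma eventually_mem {x₀ : ℝ} (hx₀ : (x₀, h x₀) ∈ closure (crossing Q R f)) :
    ∀ᶠ x in 𝓝 x₀, 0 < cutFun f η (entrySide R η) (x, h x) →
      cutFun f η (exitSide R η) (x, h x) < 0 → (x, h x) ∈ closure (crossing Q R f) := by
  have hc : Tendsto (fun x => (x, h x)) (𝓝 x₀) (𝓝 (x₀, h x₀)) :=
    (continuous_id.prodMk hh.continuous).tendsto x₀
  have hd := S.mem_dom hx₀
  have hβ := S.β_lt (S.mem_closedQ hx₀) hd
  have hα := S.α_lt (S.map_mem_closedR hx₀) hd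
  have c1 := S.quadQ.βm_mono.continuous S.nonneg
  have c2 := S.quadQ.βp_mono.continuous S.nonneg
  have c3 := S.quadR.αm_mono.continuous S.nonneg
  have c4 := S.quadR.αp_mono.continuous S.nonneg
  have e1 : ∀ᶠ p in 𝓝 (x₀, h x₀), p ∈ dom := S.isOpen_dom.mem_nhds hd
  have e2 : ∀ᶠ p in 𝓝 (x₀, h x₀), Q.βm.ext p.2 < p.1 ∧ p.1 < Q.βp.ext p.2 :=
    (ContinuousAt.eventually_lt (by fun_prop) (by fun_prop) hβ.1).and
      (ContinuousAt.eventually_lt (by fun_prop) (by fun_prop) hβ.2)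
  have e3 : ∀ᶠ q in 𝓝 (f (x₀, h x₀)), R.αm.ext q.1 < q.2 ∧ q.2 < R.αp.ext q.1 :=
    (ContinuousAt.eventually_lt (by fun_prop) (by fun_prop) hα.1).and
      (ContinuousAt.eventually_lt (by fun_prop) (by fun_prop) hα.2)
  filter_upwards [hc.eventually e1, hc.eventually e2,
    hc.eventually ((S.continuousAt hd).eventually e3)] with x h1 h2 h3 h4 h5
  exact S.mem_closure_of h1 (S.mem_region_of_cutFun h3.1 h3.2 h4 h5) (hh.ge x) (hh.le x) h2.1 h2.2

lemma isCompact_line : IsCompact {x | (x, h x) ∈ closure (crossing Q R f)} := by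
  have hcl : IsClosed {x | (x, h x) ∈ closure (crossing Q R f)} :=
    isClosed_closure.preimage (continuous_id.prodMk hh.continuous)
  obtain ⟨B, hB⟩ := S.quadQ.exists_bound
  exact isCompact_Icc.of_isClosed_subset hcl fun x hx =>
    abs_le.1 (hB _ (S.mem_closedQ hx)).1

/-- From a point of the closure of the crossing set, one can follow a line to the exit side. -/
lemma exists_exit {x₀ : ℝ} (hx₀ : (x₀, h x₀) ∈ closure (crossing Q R f)) :
    ∃ x₂, x₀ ≤ x₂ ∧ (∀ x ∈ Icc x₀ x₂, (x, h x) ∈ closure (crossing Q R f)) ∧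
      cutFun f η (exitSide R η) (x₂, h x₂) = 0 := by
  have hK := S.isCompact_line hh
  refine exists_right_end hK.isClosed hK.bddAbove (P := fun x => cutFun f η (exitSide R η) (x, h x) = 0)
    hx₀ fun x hx hP => ?_
  have hc : Tendsto (fun x => (x, h x)) (𝓝 x) (𝓝 (x, h x)) :=
    (continuous_id.prodMk hh.continuous).tendsto x
  have h0 := S.cutFun_of_closedR (S.map_mem_closedR hx)
  have hlt : cutFun f η (exitSide R η) (x, h x) < 0 := lt_of_le_of_ne h0.2 hP
  have hcut := (S.continuousAt_cutFun S.isCut_exitSide.continuous (S.mem_dom hx)).tendsto.comp hc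
  -- Just to the right the deviation from the entry side is strictly positive and that from the exit
  -- side still negative, so the line has not left the closed crossing set.
  filter_upwards [nhdsWithin_le_nhds (S.eventually_mem hh hx),
    nhdsWithin_le_nhds (hcut.eventually (gt_mem_nhds hlt)),
    S.eventually_gt hh hx S.isCut_entrySide.mono] with y h1 h2 h3
  exact h1 (h0.1.trans_lt h3) h2

lemma exists_entry {x₀ : ℝ} (hx₀ : (x₀, h x₀) ∈ closure (crossing Q R f)) :
    ∃ x₁, x₁ ≤ x₀ ∧ (∀ x ∈ Icc x₁ x₀, (x, h x) ∈ closure (crossing Q R f)) ∧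
      cutFun f η (entrySide R η) (x₁, h x₁) = 0 := by
  have hK := S.isCompact_line hh
  refine exists_left_end hK.isClosed hK.bddBelow
    (P := fun x => cutFun f η (entrySide R η) (x, h x) = 0) hx₀ fun x hx hP => ?_
  have hc : Tendsto (fun x => (x, h x)) (𝓝 x) (𝓝 (x, h x)) :=
    (continuous_id.prodMk hh.continuous).tendsto x
  have h0 := S.cutFun_of_closedR (S.map_mem_closedR hx)
  have hlt : 0 < cutFun f η (entrySide R η) (x, h x) := lt_of_le_of_ne h0.1 (Ne.symm hP)
  have hcut := (S.continuousAt_cutFun S.isCut_entrySide.continuous (S.mem_dom hx)).tendsto.comp hc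
  filter_upwards [nhdsWithin_le_nhds (S.eventually_mem hh hx),
    nhdsWithin_le_nhds (hcut.eventually (lt_mem_nhds hlt)),
    S.eventually_lt hh hx S.isCut_exitSide.mono] with y h1 h2 h3
  exact h1 h2 (h3.trans_le h0.2)

lemma continuousOn_line {b : ℝ → ℝ} (hb : Continuous b) {s : Set ℝ}
    (hs : ∀ x ∈ s, (x, h x) ∈ dom) : ContinuousOn (fun x => cutFun f η b (x, h x)) s := fun x hx =>
  (ContinuousAt.comp (f := fun x => (x, h x)) (S.continuousAt_cutFun hb (hs x hx))
    (continuous_id.prodMk hh.continuous).continuousAt).continuousWithinAt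

lemma strictMonoOn_line {b : ℝ → ℝ} (hb : Continuous b) (hbm : MonoS (-τ.sgn) b) {x₁ x₂ : ℝ}
    (hs : ∀ x ∈ Icc x₁ x₂, (x, h x) ∈ closure (crossing Q R f)) :
    StrictMonoOn (fun x => cutFun f η b (x, h x)) (Icc x₁ x₂) :=
  strictMonoOn_of_local (S.continuousOn_line hh hb fun x hx => S.mem_dom (hs x hx))
    (fun x hx => S.eventually_gt hh (hs x (Ico_subset_Icc_self hx)) hbm)
    (fun x hx => S.eventually_lt hh (hs x (Ioc_subset_Icc_self hx)) hbm)

/-- From a point of the closure of the crossing set, one can follow a line to a given cut. -/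
lemma exists_zero_near {x₀ : ℝ} (hx₀ : (x₀, h x₀) ∈ closure (crossing Q R f)) {b : ℝ → ℝ}
    (hb : R.IsCut τ b) : ∃ x, (∀ y ∈ uIcc x x₀, (y, h y) ∈ closure (crossing Q R f)) ∧
      cutFun f η b (x, h x) = 0 := by
  obtain ⟨x₁, h1, hK1, hz1⟩ := S.exists_entry hh hx₀
  obtain ⟨x₂, h2, hK2, hz2⟩ := S.exists_exit hh hx₀
  have hK : ∀ x ∈ Icc x₁ x₂, (x, h x) ∈ closure (crossing Q R f) := by
    intro x hx
    rcases le_total x x₀ with hxx | hxx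
    · exact hK1 x ⟨hx.1, hxx⟩
    · exact hK2 x ⟨hxx, hx.2⟩
  obtain ⟨x, hx, hx0⟩ := intermediate_value_Icc (h1.trans h2)
    (S.continuousOn_line hh hb.continuous fun x hx => S.mem_dom (hK x hx))
    (show (0 : ℝ) ∈ Icc _ _ from
      ⟨S.cutFun_nonpos_of_entry (S.map_mem_closedR (hK1 x₁ (left_mem_Icc.2 h1))) hz1 hb,
       S.cutFun_nonneg_of_exit (S.map_mem_closedR (hK2 x₂ (right_mem_Icc.2 h2))) hz2 hb⟩)
  exact ⟨x, fun y hy => hK y (OrdConnected.uIcc_subset ordConnected_Icc hx ⟨h1, h2⟩ hy), hx0⟩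

end StripMap

/-! ### Lines cross the target quadrangle once -/

/-- A continuous function with values in the discrete set $\pi\mathbb Z$ is constant; otherwise a
value differing from an end value by at most 1, less than $\pi$, would be taken. -/
lemma eq_of_sin_eq_zero {φ : ℝ → ℝ} {a b : ℝ} (hφ : ContinuousOn φ (uIcc a b))
    (hs : ∀ x ∈ uIcc a b, Real.sin (φ x) = 0) : φ a = φ b := by
  have key : ∀ {a b : ℝ}, ContinuousOn φ (uIcc a b) → (∀ x ∈ uIcc a b, Real.sin (φ x) = 0) →
      ¬ φ a < φ b := by
    intro a b hφ hs hlt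
    set w := min (φ b) (φ a + 1) with hw
    have hw1 : φ a < w := lt_min hlt (by linarith)
    have hw2 : w ≤ φ a + 1 := min_le_right _ _
    obtain ⟨x, hx, hxw⟩ := intermediate_value_uIcc hφ
      (show w ∈ uIcc (φ a) (φ b) from by
        rw [uIcc_of_le hlt.le]; exact ⟨hw1.le, min_le_left _ _⟩)
    have h1 : Real.sin (w - φ a) = 0 := by
      rw [Real.sin_sub, ← hxw, hs x hx, hs a left_mem_uIcc]; ring
    have h2 : 0 < Real.sin (w - φ a) :=
      Real.sin_pos_of_pos_of_lt_pi (by linarith) (by linarith [Real.pi_gt_three])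
    linarith
  refine le_antisymm (not_lt.1 ?_) (not_lt.1 (key hφ hs))
  rw [uIcc_comm] at hφ hs
  exact key hφ hs

lemma sign_pos_of_sin {η δ : ℝ} (hη : η = 1 ∨ η = -1) (hδ : |δ| < Real.pi)
    (h : 0 < η * Real.sin δ) : 0 < η * δ := by
  have hδ' := abs_lt.1 hδ
  rcases hη with rfl | rfl
  · by_contra! hle
    have := Real.sin_nonpos_of_nonpos_of_neg_pi_le (by linarith : δ ≤ 0) hδ'.1.le
    linarith
  · by_contra! hle
    have := Real.sin_nonneg_of_nonneg_of_le_pi (by linarith : 0 ≤ δ) hδ'.2.le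
    linarith

/-- The shear that straightens the graph `u = b u'`, with values in the complex plane. -/
def shear (b : ℝ → ℝ) (hb : Continuous b) : ℝ × ℝ ≃ₜ ℂ where
  toFun p := ((p.1 - b p.2 : ℝ) : ℂ) + (p.2 : ℂ) * Complex.I
  invFun z := (z.re + b z.im, z.im)
  left_inv p := by ext <;> simp
  right_inv z := by apply Complex.ext <;> simp
  continuous_toFun := by fun_prop
  continuous_invFun := by fun_prop

/-- These are the real and imaginary parts of $\bar z_1z_2$ for $z_k=X+i(V-y_k)$: the angle under
which the vertical segment from $y_1$ to $y_2$ is seen from $(X,V)$. -/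
lemma trig_of_exp_eq {l₁ l₂ : ℂ} {X V y₁ y₂ : ℝ}
    (h₁ : Complex.exp l₁ = ((X : ℝ) : ℂ) + (V : ℂ) * Complex.I - (y₁ : ℂ) * Complex.I)
    (h₂ : Complex.exp l₂ = ((X : ℝ) : ℂ) + (V : ℂ) * Complex.I - (y₂ : ℂ) * Complex.I) :
    ∃ m > 0, m * Real.cos (l₂.im - l₁.im) = X ^ 2 + (V - y₁) * (V - y₂) ∧
      m * Real.sin (l₂.im - l₁.im) = -X * (y₂ - y₁) := by
  have r1 := congrArg Complex.re h₁
  have i1 := congrArg Complex.im h₁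
  have r2 := congrArg Complex.re h₂
  have i2 := congrArg Complex.im h₂
  rw [Complex.exp_re] at r1 r2
  rw [Complex.exp_im] at i1 i2
  simp at r1 i1 r2 i2
  refine ⟨Real.exp l₁.re * Real.exp l₂.re, by positivity, ?_, ?_⟩
  · rw [Real.cos_sub]
    calc _ = (Real.exp l₁.re * Real.cos l₁.im) * (Real.exp l₂.re * Real.cos l₂.im) +
          (Real.exp l₁.re * Real.sin l₁.im) * (Real.exp l₂.re * Real.sin l₂.im) := by ring
      _ = _ := by rw [r1, i1, r2, i2]; ring
  · rw [Real.sin_sub]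
    calc _ = (Real.exp l₁.re * Real.cos l₁.im) * (Real.exp l₂.re * Real.sin l₂.im) -
          (Real.exp l₁.re * Real.sin l₁.im) * (Real.exp l₂.re * Real.cos l₂.im) := by ring
      _ = _ := by rw [r1, i1, r2, i2]; ring

lemma MonoS.max {s : ℝ} (hs : s = 1 ∨ s = -1) {f g : ℝ → ℝ} (hf : MonoS s f) (hg : MonoS s g) :
    MonoS s (fun x => max (f x) (g x)) := by
  intro x y hxy
  have h1 := hf x y hxy
  have h2 := hg x y hxy
  rcases hs with rfl | rfl
  · have := max_le_max (by linarith : f x ≤ f y) (by linarith : g x ≤ g y); linarith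
  · have := max_le_max (by linarith : f y ≤ f x) (by linarith : g y ≤ g x); linarith

lemma MonoS.min {s : ℝ} (hs : s = 1 ∨ s = -1) {f g : ℝ → ℝ} (hf : MonoS s f) (hg : MonoS s g) :
    MonoS s (fun x => min (f x) (g x)) := by
  intro x y hxy
  have h1 := hf x y hxy
  have h2 := hg x y hxy
  rcases hs with rfl | rfl
  · have := min_le_min (by linarith : f x ≤ f y) (by linarith : g x ≤ g y); linarith
  · have := min_le_min (by linarith : f y ≤ f x) (by linarith : g y ≤ g x); linarith

/-- The line `l`, cut off at the `α`-sides. -/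
def Quad.clamp (Q : Quad) (l : ℝ → ℝ) (x : ℝ) : ℝ := max (Q.αm.ext x) (min (Q.αp.ext x) (l x))

lemma Quad.clamp_of_mem {Q : Quad} {l : ℝ → ℝ} {x : ℝ} (h1 : Q.αm.ext x ≤ l x)
    (h2 : l x ≤ Q.αp.ext x) : Q.clamp l x = l x := by
  rw [clamp, min_eq_right h2, max_eq_right h1]

/-! ### Lines between the α-sides and their deformations. -/

section HLine

variable {Q : Quad} {γ : ℝ} {σ : MonoType}

lemma HLine.convex {h₀ h₁ : ℝ → ℝ} (hh₀ : HLine Q σ h₀) (hh₁ : HLine Q σ h₁) {s : ℝ}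
    (hs : s ∈ Icc (0 : ℝ) 1) : HLine Q σ (fun x => (1 - s) * h₀ x + s * h₁ x) where
  continuous := (continuous_const.mul hh₀.continuous).add (continuous_const.mul hh₁.continuous)
  mono x y hxy := by
    have h1 := mul_nonneg (sub_nonneg.2 hs.2) (hh₀.mono x y hxy)
    have h2 := mul_nonneg hs.1 (hh₁.mono x y hxy)
    linarith
  ge x := by
    have h1 := mul_nonneg (sub_nonneg.2 hs.2) (sub_nonneg.2 (hh₀.ge x))
    have h2 := mul_nonneg hs.1 (sub_nonneg.2 (hh₁.ge x))
    linarith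
  le x := by
    have h1 := mul_nonneg (sub_nonneg.2 hs.2) (sub_nonneg.2 (hh₀.le x))
    have h2 := mul_nonneg hs.1 (sub_nonneg.2 (hh₁.le x))
    linarith

lemma Quad.IsQuadrangle.hLine_clamp (hQ : Q.IsQuadrangle γ σ) (hγ : 0 ≤ γ) {l : ℝ → ℝ}
    (hl : Continuous l) (hm : MonoS σ.sgn l) : HLine Q σ (Q.clamp l) where
  continuous := (hQ.αm_mono.continuous hγ).max ((hQ.αp_mono.continuous hγ).min hl)
  mono := hQ.αm_mono.monoS.max σ.sgn_eq (hQ.αp_mono.monoS.min σ.sgn_eq hm)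
  ge _ := le_max_left _ _
  le x := max_le (hQ.α_lt x).le (min_le_left _ _)

lemma monoS_const (s y : ℝ) : MonoS s fun _ => y := fun _ _ _ => by simp

lemma Quad.IsQuadrangle.hLine_αm (hQ : Q.IsQuadrangle γ σ) (hγ : 0 ≤ γ) : HLine Q σ Q.αm.ext :=
  ⟨hQ.αm_mono.continuous hγ, hQ.αm_mono.monoS, fun _ => le_rfl, fun x => (hQ.α_lt x).le⟩

lemma Quad.IsQuadrangle.hLine_αp (hQ : Q.IsQuadrangle γ σ) (hγ : 0 ≤ γ) : HLine Q σ Q.αp.ext :=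
  ⟨hQ.αp_mono.continuous hγ, hQ.αp_mono.monoS, fun x => (hQ.α_lt x).le, fun _ => le_rfl⟩

end HLine

/-! ### Each line has exactly one crossing interval. -/

namespace StripMap

variable {γ : ℝ} {σ τ : MonoType} {Q R : Quad} {f g : ℝ × ℝ → ℝ × ℝ} {dom dom' : Set (ℝ × ℝ)}
  {η ρ : ℝ} (S : StripMap γ σ τ Q R f g dom dom' η ρ) {h : ℝ → ℝ} (hh : HLine Q σ h)
include S

lemma map_mem_R_of_mid {p : ℝ × ℝ} (hp : p ∈ closure (crossing Q R f))
    (h0 : cutFun f η R.mid p = 0) : f p ∈ R.region := by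
  have hα := S.α_lt (S.map_mem_closedR hp) (S.mem_dom hp)
  have h1 := S.cutFun_eq_zero.1 h0
  exact ⟨hα.1, hα.2, h1 ▸ S.quadR.βm_lt_mid _, h1 ▸ S.quadR.mid_lt_βp _⟩

include hh

/-- A line strictly between the `α`-sides meets the preimage of the middle curve of `R` at most
once, as otherwise there would be a loop around the end of an `α`-side. -/
lemma mid_zero_unique_of_strict (hlt : ∀ x, Q.αm.ext x < h x ∧ h x < Q.αp.ext x) {xa xb : ℝ}
    (ha : (xa, h xa) ∈ closure (crossing Q R f)) (hb : (xb, h xb) ∈ closure (crossing Q R f))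
    (ha0 : cutFun f η R.mid (xa, h xa) = 0) (hb0 : cutFun f η R.mid (xb, h xb) = 0) :
    ¬ xa < xb := by
  intro hab
  have hmc := S.quadR.continuous_mid S.nonneg
  obtain ⟨y₁, y₂, hy, he₁, he₂, hmem⟩ := S.quadR.exists_mid_ends S.nonneg
  set pt : ℝ → ℝ × ℝ := fun x => (x, h x) with hpt
  have hptc : Continuous pt := continuous_id.prodMk hh.continuous
  set sg : ℝ → ℝ × ℝ := fun v => (R.mid v, v) with hsg
  have hsgc : Continuous sg := hmc.prodMk continuous_id
  have hfa : f (pt xa) = sg (f (pt xa)).2 := Prod.ext (S.cutFun_eq_zero.1 ha0) rfl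
  have hfb : f (pt xb) = sg (f (pt xb)).2 := Prod.ext (S.cutFun_eq_zero.1 hb0) rfl
  set va := (f (pt xa)).2 with hva
  set vb := (f (pt xb)).2 with hvb
  have hva' : va ∈ Ioo y₁ y₂ := (hmem va).1 (by
    have := S.map_mem_R_of_mid ha ha0; change f (pt xa) ∈ _ at this; rwa [hfa] at this)
  have hvb' : vb ∈ Ioo y₁ y₂ := (hmem vb).1 (by
    have := S.map_mem_R_of_mid hb hb0; change f (pt xb) ∈ _ at this; rwa [hfb] at this)
  -- The β-sides have the type opposite to the line, so their distances along it vary monotonically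
  -- and the inequalities at `xa`, `xb` propagate. Strictness at the α-sides puts this whole piece
  -- into the domain.
  have hQreg : ∀ x ∈ Icc xa xb, pt x ∈ Q.region := by
    intro x hx
    refine ⟨(hlt x).1, (hlt x).2, ?_, ?_⟩
    · have h1 := MonoS.comp_anti (s := -σ.sgn)
        (by rcases σ.sgn_eq with h | h <;> rw [h] <;> norm_num) S.quadQ.monoS_βm
        (by rw [neg_neg]; exact hh.mono) hx.1
      have h2 := (S.β_lt (S.mem_closedQ ha) (S.mem_dom ha)).1
      simp only [Function.comp, pt] at *
      linarith [hx.1]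
    · have h1 := MonoS.comp_anti (s := -σ.sgn)
        (by rcases σ.sgn_eq with h | h <;> rw [h] <;> norm_num) S.quadQ.monoS_βp
        (by rw [neg_neg]; exact hh.mono) hx.2
      have h2 := (S.β_lt (S.mem_closedQ hb) (S.mem_dom hb)).2
      simp only [Function.comp, pt] at *
      linarith [hx.2]
  have hsub : uIcc va vb ⊆ Ioo y₁ y₂ := OrdConnected.uIcc_subset ordConnected_Ioo hva' hvb'
  have hsgd : ∀ v ∈ uIcc va vb, sg v ∈ dom' := fun v hv => S.R_subset ((hmem v).2 (hsub hv))
  -- The loop: the piece of the line, closed up by the preimage of a piece of the middle curve. One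
  -- compact set is needed so that each logarithm is continuous on all of it.
  set K : Set (ℝ × ℝ) := pt '' Icc xa xb ∪ (g ∘ sg) '' uIcc va vb with hK
  have hgc : ContinuousOn (g ∘ sg) (uIcc va vb) := S.cont'.comp hsgc.continuousOn hsgd
  have hKc : IsCompact K := (isCompact_Icc.image hptc).union (isCompact_uIcc.image_of_continuousOn hgc)
  have hKd : K ⊆ dom := by
    rintro _ (⟨x, hx, rfl⟩ | ⟨v, hv, rfl⟩)
    · exact S.Q_subset (hQreg x hx)
    · exact S.mapsTo' (hsgd v hv)
  obtain ⟨L₁, hL₁, hexp₁⟩ := S.exists_log K hKc hKd _ (Or.inl he₁) (shear R.mid hmc)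
  obtain ⟨L₂, hL₂, hexp₂⟩ := S.exists_log K hKc hKd _ (Or.inr he₂) (shear R.mid hmc)
  -- A continuous choice of the angle under which the middle curve, straightened by the shear, is
  -- seen from `f p`. Modulo $2\pi$ it is $\pi$ exactly when `f p` is on the open curve.
  set G : ℝ × ℝ → ℝ := fun p => (L₂ p).im - (L₁ p).im with hG
  have hGc : ContinuousOn G K :=
    (Complex.continuous_im.comp_continuousOn hL₂).sub (Complex.continuous_im.comp_continuousOn hL₁)
  have key : ∀ p ∈ K, ∃ m > 0,
      m * Real.cos (G p) = ((f p).1 - R.mid (f p).2) ^ 2 + ((f p).2 - y₁) * ((f p).2 - y₂) ∧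
      m * Real.sin (G p) = -((f p).1 - R.mid (f p).2) * (y₂ - y₁) := by
    intro p hp
    refine trig_of_exp_eq ?_ ?_
    · rw [hexp₁ p hp]; simp [shear]
    · rw [hexp₂ p hp]; simp [shear]
  have hKseg : ∀ v ∈ uIcc va vb, (g ∘ sg) v ∈ K := fun v hv => Or.inr ⟨v, hv, rfl⟩
  have hKpt : ∀ x ∈ Icc xa xb, pt x ∈ K := fun x hx => Or.inl ⟨x, hx, rfl⟩
  have hseg : ∀ v ∈ uIcc va vb, Real.sin (G ((g ∘ sg) v)) = 0 ∧ Real.cos (G ((g ∘ sg) v)) < 0 := by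
    intro v hv
    obtain ⟨m, hm, hcos, hsin⟩ := key _ (hKseg v hv)
    rw [Function.comp, S.right_inv _ (hsgd v hv)] at hcos hsin
    simp only [hsg, sub_self] at hcos hsin
    have hv' := hsub hv
    constructor
    · have : m * Real.sin (G ((g ∘ sg) v)) = 0 := by rw [Function.comp, hsin]; ring
      exact (mul_eq_zero.1 this).resolve_left hm.ne'
    · by_contra! hcon
      have h1 := mul_nonneg hm.le hcon
      rw [Function.comp, hcos] at h1
      nlinarith [hv'.1, hv'.2, mul_pos (sub_pos.2 hv'.1) (sub_pos.2 hv'.2)]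
  -- On the segment part of the loop the angle is constant, so it has the same value `c` at both
  -- ends of the line piece.
  have hGab := eq_of_sin_eq_zero (φ := fun v => G ((g ∘ sg) v))
    (hGc.comp hgc hKseg) fun v hv => (hseg v hv).1
  have hga : (g ∘ sg) va = pt xa := by
    rw [Function.comp, ← hfa]; exact S.left_inv _ (S.mem_dom ha)
  have hgb : (g ∘ sg) vb = pt xb := by
    rw [Function.comp, ← hfb]; exact S.left_inv _ (S.mem_dom hb)
  simp only [hga, hgb] at hGab
  have hc := hseg va left_mem_uIcc
  rw [hga] at hc
  set c := G (pt xa) with hcdef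
  have hGpt : ContinuousOn (fun x => G (pt x)) (Icc xa xb) := hGc.comp hptc.continuousOn hKpt
  have hη0 : ∀ t : ℝ, η * t = 0 → t = 0 := fun t ht => by
    rcases S.sign with h | h <;> rw [h] at ht <;> linarith
  -- If the angle returns to `c` along the line, the image is again on the open middle curve, hence
  -- in `R`; the point is then in the crossing set, where the cone estimates apply.
  have hzero : ∀ x ∈ Icc xa xb, η * (G (pt x) - c) = 0 →
      pt x ∈ closure (crossing Q R f) ∧ cutFun f η R.mid (pt x) = 0 := by
    intro x hx hx0
    have hGx : G (pt x) = c := by linarith [hη0 _ hx0]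
    obtain ⟨m, hm, hcos, hsin⟩ := key _ (hKpt x hx)
    rw [hGx] at hcos hsin
    rw [hc.1, mul_zero] at hsin
    have hX : (f (pt x)).1 - R.mid (f (pt x)).2 = 0 := by
      have : ((f (pt x)).1 - R.mid (f (pt x)).2) * (y₂ - y₁) = 0 := by linarith
      exact (mul_eq_zero.1 this).resolve_right (sub_pos.2 hy).ne'
    rw [hX] at hcos
    have hneg : ((f (pt x)).2 - y₁) * ((f (pt x)).2 - y₂) < 0 := by
      have := mul_neg_of_pos_of_neg hm hc.2
      rw [hcos] at this
      linarith
    have hV : (f (pt x)).2 ∈ Ioo y₁ y₂ := by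
      rcases mul_neg_iff.1 hneg with h | h
      · exact ⟨by linarith [h.1], by linarith [h.2]⟩
      · linarith [h.1, h.2]
    have hfx : f (pt x) = sg (f (pt x)).2 := Prod.ext (by simp only [hsg]; linarith) rfl
    refine ⟨subset_closure ⟨hQreg x hx, ?_⟩, S.cutFun_eq_zero.2 (by linarith)⟩
    rw [hfx]
    exact (hmem _).2 hV
  -- Since $\cos c<0=\sin c$, the sine of `G - c` has the sign of the deviation from the middle
  -- curve, so near `c` the angle lies on the side given by `cutFun`.
  have hside : ∀ x ∈ Icc xa xb, |G (pt x) - c| < Real.pi →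
      (0 < cutFun f η R.mid (pt x) → 0 < η * (G (pt x) - c)) ∧
      (cutFun f η R.mid (pt x) < 0 → η * (G (pt x) - c) < 0) := by
    intro x hx hπ
    obtain ⟨m, hm, -, hsin⟩ := key _ (hKpt x hx)
    have hs : Real.sin (G (pt x)) = Real.cos c * Real.sin (G (pt x) - c) := by
      have : G (pt x) = c + (G (pt x) - c) := by ring
      conv_lhs => rw [this]
      rw [Real.sin_add, hc.1]; ring
    rw [hs] at hsin
    have hk : 0 < (y₂ - y₁) := sub_pos.2 hy
    have hprod : (m * -Real.cos c) * (η * Real.sin (G (pt x) - c)) =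
        cutFun f η R.mid (pt x) * (y₂ - y₁) := by
      simp only [cutFun]; linear_combination (-η) * hsin
    have hmc : 0 < m * -Real.cos c := mul_pos hm (by linarith [hc.2])
    constructor
    · intro hpos
      refine sign_pos_of_sin S.sign hπ (pos_of_mul_pos_right ?_ hmc.le)
      rw [hprod]; exact mul_pos hpos hk
    · intro hneg
      have h1 : 0 < -η * Real.sin (G (pt x) - c) := by
        refine pos_of_mul_pos_right ?_ hmc.le
        have := mul_neg_of_neg_of_pos hneg hk
        linarith
      have := sign_pos_of_sin (by rcases S.sign with h | h <;> rw [h] <;> norm_num) hπ h1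
      linarith
  have hnear : ∀ x ∈ Icc xa xb, η * (G (pt x) - c) = 0 →
      ∀ᶠ y in 𝓝[Icc xa xb] x, |G (pt y) - c| < Real.pi := by
    intro x hx hx0
    have h1 : Tendsto (fun y => |G (pt y) - c|) (𝓝[Icc xa xb] x) (𝓝 |G (pt x) - c|) :=
      ((hGpt x hx).sub continuousWithinAt_const).abs
    rw [hη0 _ hx0, abs_zero] at h1
    exact h1.eventually (gt_mem_nhds Real.pi_pos)
  -- Every return of the angle to `c` is a crossing in the direction `η`; it cannot come back to `c`
  -- at `xb`.
  have := pos_of_crossing_up (f := fun x => η * (G (pt x) - c)) (a := xa) (b := xb)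
    (continuousOn_const.mul (hGpt.sub continuousOn_const)) ?_ ?_ (by simp [hcdef]) xb ⟨hab, le_rfl⟩
  · rw [← hGab] at this
    simp at this
  · intro x hx hx0
    have hxI := Ico_subset_Icc_self hx
    obtain ⟨hK', hz⟩ := hzero x hxI hx0
    have hIcc : Icc xa xb ∈ 𝓝[>] x :=
      mem_of_superset (Ioo_mem_nhdsGT hx.2) fun y hy => ⟨hx.1.trans hy.1.le, hy.2.le⟩
    filter_upwards [S.eventually_gt hh hK' S.quadR.monoS_mid,
      (nhdsWithin_le_of_mem hIcc) (hnear x hxI hx0), hIcc] with y h1 h2 h3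
    change cutFun f η R.mid (pt x) < cutFun f η R.mid (pt y) at h1
    rw [hz] at h1
    exact (hside y h3 h2).1 h1
  · intro x hx hx0
    have hxI := Ioc_subset_Icc_self hx
    obtain ⟨hK', hz⟩ := hzero x hxI hx0
    have hIcc : Icc xa xb ∈ 𝓝[<] x :=
      mem_of_superset (Ioo_mem_nhdsLT hx.1) fun y hy => ⟨hy.1.le, hy.2.le.trans hx.2⟩
    filter_upwards [S.eventually_lt hh hK' S.quadR.monoS_mid,
      (nhdsWithin_le_of_mem hIcc) (hnear x hxI hx0), hIcc] with y h1 h2 h3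
    change cutFun f η R.mid (pt y) < cutFun f η R.mid (pt x) at h1
    rw [hz] at h1
    exact (hside y h3 h2).2 h1

omit hh in
/-- A transversal intersection with the preimage of the middle curve persists. -/
lemma eventually_exists_mid_zero {H : ℝ → ℝ → ℝ} (hH : Continuous fun z : ℝ × ℝ => H z.1 z.2)
    (hHl : ∀ s ∈ Icc (0 : ℝ) 1, HLine Q σ (H s)) {s₀ x₀ : ℝ} (hs₀ : s₀ ∈ Icc (0 : ℝ) 1)
    (hx₀ : (x₀, H s₀ x₀) ∈ closure (crossing Q R f))
    (hz : cutFun f η R.mid (x₀, H s₀ x₀) = 0) {δ : ℝ} (hδ : 0 < δ) :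
    ∀ᶠ s in 𝓝[Icc 0 1] s₀, ∃ x, |x - x₀| < δ ∧ (x, H s x) ∈ closure (crossing Q R f) ∧
      cutFun f η R.mid (x, H s x) = 0 := by
  have hd := S.mem_dom hx₀
  have hβ := S.β_lt (S.mem_closedQ hx₀) hd
  have c1 := S.quadQ.βm_mono.continuous S.nonneg
  have c2 := S.quadQ.βp_mono.continuous S.nonneg
  have hmc := S.quadR.continuous_mid S.nonneg
  have hpt : Continuous fun z : ℝ × ℝ => (z.2, H z.1 z.2) := continuous_snd.prodMk hH
  have e0 : ∀ᶠ p in 𝓝 (x₀, H s₀ x₀), p ∈ dom ∧ f p ∈ R.region ∧ Q.βm.ext p.2 < p.1 ∧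
      p.1 < Q.βp.ext p.2 := by
    have h3 : ∀ᶠ p in 𝓝 (x₀, H s₀ x₀), Q.βm.ext p.2 < p.1 :=
      ContinuousAt.eventually_lt (by fun_prop) (by fun_prop) hβ.1
    have h4 : ∀ᶠ p in 𝓝 (x₀, H s₀ x₀), p.1 < Q.βp.ext p.2 :=
      ContinuousAt.eventually_lt (by fun_prop) (by fun_prop) hβ.2
    filter_upwards [S.isOpen_dom.mem_nhds hd, (S.continuousAt hd).eventually
      ((S.quadR.isOpen_region S.nonneg).mem_nhds (S.map_mem_R_of_mid hx₀ hz)), h3, h4]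
      with p h1 h2 h3 h4 using ⟨h1, h2, h3, h4⟩
  have e1 := (hpt.tendsto (s₀, x₀)).eventually e0
  rw [nhds_prod_eq] at e1
  obtain ⟨ps, hps, px, hpx, hprod⟩ := eventually_prod_iff.1 e1
  have hl₀ := hHl s₀ hs₀
  obtain ⟨r, hr, hrpx⟩ := Metric.eventually_nhds_iff.1 hpx
  set r' := min r δ with hr'
  have hr'0 : 0 < r' := lt_min hr hδ
  have hright : ∀ᶠ x in 𝓝[>] x₀, x < x₀ + r' :=
    nhdsWithin_le_nhds (gt_mem_nhds (by linarith))
  have hleft : ∀ᶠ x in 𝓝[<] x₀, x₀ - r' < x :=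
    nhdsWithin_le_nhds (lt_mem_nhds (by linarith))
  -- The deviation has opposite signs at two nearby points `xl < x₀ < xr` of the line; both signs
  -- persist for nearby `s`, and the intermediate value theorem gives the zero.
  obtain ⟨xr, hxr1, hxr2, hxr3⟩ := ((S.eventually_gt hl₀ hx₀ S.quadR.monoS_mid).and
    (hright.and self_mem_nhdsWithin)).exists
  obtain ⟨xl, hxl1, hxl2, hxl3⟩ := ((S.eventually_lt hl₀ hx₀ S.quadR.monoS_mid).and
    (hleft.and self_mem_nhdsWithin)).exists
  have hxr3' : x₀ < xr := hxr3
  have hxl3' : xl < x₀ := hxl3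
  rw [hz] at hxr1 hxl1
  have hin : ∀ x ∈ Icc xl xr, |x - x₀| < r' := fun x hx =>
    abs_lt.2 ⟨by linarith [hx.1], by linarith [hx.2]⟩
  have hpx' : ∀ x ∈ Icc xl xr, px x := fun x hx =>
    hrpx (by rw [Real.dist_eq]; exact (hin x hx).trans_le (min_le_left _ _))
  have hsign : ∀ x ∈ Icc xl xr, ContinuousAt (fun s => cutFun f η R.mid (x, H s x)) s₀ := by
    intro x hx
    refine ContinuousAt.comp (f := fun s => (x, H s x)) (g := cutFun f η R.mid) ?_ ?_
    · exact S.continuousAt_cutFun hmc (hprod hps.self_of_nhds (hpx' x hx)).1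
    · exact (continuous_const.prodMk (hH.comp (continuous_id.prodMk continuous_const))).continuousAt
  have hlr : xl ≤ xr := by linarith
  filter_upwards [nhdsWithin_le_nhds hps,
    nhdsWithin_le_nhds ((hsign xr (right_mem_Icc.2 hlr)).eventually (lt_mem_nhds hxr1)),
    nhdsWithin_le_nhds ((hsign xl (left_mem_Icc.2 hlr)).eventually (gt_mem_nhds hxl1)),
    self_mem_nhdsWithin] with s h1 h2 h3 h4
  have hls := hHl s h4
  obtain ⟨x, hx, hx0⟩ := intermediate_value_Icc hlr
    (S.continuousOn_line hls hmc fun x hx => (hprod h1 (hpx' x hx)).1)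
    (show (0 : ℝ) ∈ Icc _ _ from ⟨h3.le, h2.le⟩)
  obtain ⟨k1, k2, k3, k4⟩ := hprod h1 (hpx' x hx)
  exact ⟨x, (hin x hx).trans_le (min_le_right _ _),
    S.mem_closure_of k1 k2 (hls.ge x) (hls.le x) k3 k4, hx0⟩

/-- A line between the `α`-sides meets the preimage of the middle curve of `R` at most once. -/
lemma mid_zero_unique {xa xb : ℝ}
    (ha : (xa, h xa) ∈ closure (crossing Q R f)) (hb : (xb, h xb) ∈ closure (crossing Q R f))
    (ha0 : cutFun f η R.mid (xa, h xa) = 0) (hb0 : cutFun f η R.mid (xb, h xb) = 0) :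
    xa = xb := by
  by_contra hne
  wlog hab : xa < xb generalizing xa xb
  · exact this hb ha hb0 ha0 (Ne.symm hne) (lt_of_le_of_ne (not_lt.1 hab) (Ne.symm hne))
  have c1 := S.quadQ.αm_mono.continuous S.nonneg
  have c2 := S.quadQ.αp_mono.continuous S.nonneg
  -- Pushing the line towards the one halfway between the α-sides makes it strictly interior for
  -- every `s > 0`, and two distinct zeros survive for small `s`.
  set H : ℝ → ℝ → ℝ := fun s x => (1 - s) * h x + s * ((1 - 1 / 2) * Q.αm.ext x + 1 / 2 * Q.αp.ext x)
    with hHdef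
  have hhm := (S.quadQ.hLine_αm S.nonneg).convex (S.quadQ.hLine_αp S.nonneg)
    (s := 1 / 2) (by norm_num)
  have hHc : Continuous fun z : ℝ × ℝ => H z.1 z.2 := by
    have := hh.continuous
    simp only [hHdef]; fun_prop
  have hHl : ∀ s ∈ Icc (0 : ℝ) 1, HLine Q σ (H s) := fun s hs => hh.convex hhm hs
  have hH0 : ∀ x, H 0 x = h x := fun x => by simp [hHdef]
  have h0 : (0 : ℝ) ∈ Icc (0 : ℝ) 1 := by norm_num
  have hδ : 0 < (xb - xa) / 2 := by linarith
  have ea := S.eventually_exists_mid_zero hHc hHl h0 (by rwa [hH0]) (by rwa [hH0]) hδ (x₀ := xa)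
  have eb := S.eventually_exists_mid_zero hHc hHl h0 (by rwa [hH0]) (by rwa [hH0]) hδ (x₀ := xb)
  have hle : 𝓝[>] (0 : ℝ) ≤ 𝓝[Icc 0 1] 0 :=
    nhdsWithin_le_of_mem (mem_of_superset (Ioo_mem_nhdsGT zero_lt_one) Ioo_subset_Icc_self)
  obtain ⟨s, ⟨xa', ha1, ha2, ha3⟩, ⟨xb', hb1, hb2, hb3⟩, hs1⟩ :=
    ((ea.filter_mono hle).and ((eb.filter_mono hle).and (Ioo_mem_nhdsGT zero_lt_one))).exists
  have hs0 := hs1.1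
  refine S.mid_zero_unique_of_strict (hHl s ⟨hs0.le, hs1.2.le⟩) (fun x => ?_) ha2 hb2 ha3 hb3 ?_
  · have h1 := mul_nonneg (sub_nonneg.2 hs1.2.le) (sub_nonneg.2 (hh.ge x))
    have h2 := mul_nonneg (sub_nonneg.2 hs1.2.le) (sub_nonneg.2 (hh.le x))
    have h3 := mul_pos hs0 (sub_pos.2 (S.quadQ.α_lt x))
    simp only [hHdef]
    constructor <;> linarith
  · have := abs_lt.1 ha1
    have := abs_lt.1 hb1
    linarith

/-- Each line between the `α`-sides meets the preimage of the middle curve of `R`. -/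
lemma exists_mid_zero : ∃ x, (x, h x) ∈ closure (crossing Q R f) ∧
    cutFun f η R.mid (x, h x) = 0 := by
  have hmc := S.quadR.continuous_mid S.nonneg
  obtain ⟨p₀, hp₀⟩ := S.nonempty
  have hl₀ := S.quadQ.hLine_clamp S.nonneg (continuous_const (y := p₀.2)) (monoS_const _ _)
  have hp : (p₀.1, Q.clamp (fun _ => p₀.2) p₀.1) ∈ closure (crossing Q R f) := by
    rw [Quad.clamp_of_mem hp₀.1.1.le hp₀.1.2.1.le]; exact subset_closure hp₀
  obtain ⟨x₀, hx₀, hz₀⟩ := S.exists_zero_near hl₀ hp (S.quadR.isCut_mid S.nonneg)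
  replace hx₀ := hx₀ x₀ left_mem_uIcc
  set H : ℝ → ℝ → ℝ := fun s x => (1 - s) * Q.clamp (fun _ => p₀.2) x + s * h x with hHdef
  have hHc : Continuous fun z : ℝ × ℝ => H z.1 z.2 := by
    have := hh.continuous
    have := hl₀.continuous
    simp only [hHdef]; fun_prop
  have hHl : ∀ s ∈ Icc (0 : ℝ) 1, HLine Q σ (H s) := fun s hs => hl₀.convex hh hs
  set T : Set ℝ := {s | ∃ x, (x, H s x) ∈ closure (crossing Q R f) ∧
    cutFun f η R.mid (x, H s x) = 0} with hT
  have hpt : Continuous fun z : ℝ × ℝ => (z.2, H z.1 z.2) := continuous_snd.prodMk hHc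
  obtain ⟨B, hB⟩ := S.quadQ.exists_bound
  -- The pairs (parameter, zero) form a compact set; its projection is closed.
  have hclosed : IsClosed (T ∩ Icc 0 1) := by
    have hcomp : IsCompact {z : ℝ × ℝ | z.1 ∈ Icc (0 : ℝ) 1 ∧
        (z.2, H z.1 z.2) ∈ closure (crossing Q R f) ∧ cutFun f η R.mid (z.2, H z.1 z.2) = 0} := by
      refine (isCompact_Icc.prod (isCompact_Icc (a := -B) (b := B))).of_isClosed_subset
        ?_ fun z hz => ⟨hz.1, abs_le.1 (hB _ (S.mem_closedQ hz.2.1)).1⟩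
      have h1 : IsClosed {p : ℝ × ℝ | p ∈ closure (crossing Q R f) ∧ cutFun f η R.mid p = 0} := by
        have : ContinuousOn (cutFun f η R.mid) (closure (crossing Q R f)) := fun p hp =>
          (S.continuousAt_cutFun hmc (S.mem_dom hp)).continuousWithinAt
        exact this.preimage_isClosed_of_isClosed isClosed_closure isClosed_singleton
      exact (isClosed_Icc.preimage continuous_fst).inter (h1.preimage hpt)
    convert! (hcomp.image continuous_fst).isClosed using 1
    ext s
    constructor
    · rintro ⟨⟨x, hx⟩, hs⟩; exact ⟨(s, x), ⟨hs, hx⟩, rfl⟩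
    · rintro ⟨⟨s, x⟩, ⟨hs, hx⟩, rfl⟩; exact ⟨⟨x, hx⟩, hs⟩
  -- Zeros exist for the horizontal line through the given crossing point and persist to the right
  -- of each parameter, so they exist for all parameters.
  have hsub : Icc (0 : ℝ) 1 ⊆ T := by
    refine hclosed.Icc_subset_of_forall_exists_gt ⟨x₀, ?_, ?_⟩ ?_
    · simpa [hHdef] using hx₀
    · simpa [hHdef] using hz₀
    · rintro s ⟨⟨x, hx, hz⟩, hs⟩ y hy
      have ev := S.eventually_exists_mid_zero hHc hHl (Ico_subset_Icc_self hs) hx hz one_pos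
      have hle : 𝓝[>] s ≤ 𝓝[Icc 0 1] s :=
        nhdsWithin_le_of_mem (mem_of_superset (Ioo_mem_nhdsGT hs.2)
          fun t ht => ⟨hs.1.trans ht.1.le, ht.2.le⟩)
      obtain ⟨t, ⟨x', -, hx'⟩, ht⟩ := ((ev.filter_mono hle).and (Ioc_mem_nhdsGT hy)).exists
      exact ⟨t, ⟨x', hx'⟩, ht⟩
  obtain ⟨x, hx⟩ := hsub (right_mem_Icc.2 zero_le_one)
  exact ⟨x, by simpa [hHdef] using hx⟩

/-- Each line between the `α`-sides meets the closure of the crossing set in an interval, which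
extends from the preimage of one `β`-side of `R` to that of the other one. -/
theorem exists_interval : ∃ x₁ x₂, x₁ < x₂ ∧
    (∀ x, (x, h x) ∈ closure (crossing Q R f) ↔ x ∈ Icc x₁ x₂) ∧
    cutFun f η (entrySide R η) (x₁, h x₁) = 0 ∧ cutFun f η (exitSide R η) (x₂, h x₂) = 0 := by
  obtain ⟨z, hz, hz0⟩ := S.exists_mid_zero hh
  obtain ⟨x₁, h1, hK1, hz1⟩ := S.exists_entry hh hz
  obtain ⟨x₂, h2, hK2, hz2⟩ := S.exists_exit hh hz
  -- Any point of the line in the closed crossing set is connected within that set to a zero on the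
  -- middle curve, and there is only one such zero.
  have hconn : ∀ x, (x, h x) ∈ closure (crossing Q R f) →
      ∀ y ∈ uIcc z x, (y, h y) ∈ closure (crossing Q R f) := by
    intro x hx
    obtain ⟨w, hw, hw0⟩ := S.exists_zero_near hh hx (S.quadR.isCut_mid S.nonneg)
    obtain rfl := S.mid_zero_unique hh hz (hw w left_mem_uIcc) hz0 hw0
    exact hw
  have hIcc : ∀ x ∈ Icc x₁ x₂, (x, h x) ∈ closure (crossing Q R f) := by
    intro x hx
    rcases le_total x z with hxx | hxx
    · exact hK1 x ⟨hx.1, hxx⟩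
    · exact hK2 x ⟨hxx, hx.2⟩
  refine ⟨x₁, x₂, ?_, fun x => ⟨fun hx => ⟨?_, ?_⟩, hIcc x⟩, hz1, hz2⟩
  · refine lt_of_le_of_ne (h1.trans h2) ?_
    rintro rfl
    have := S.cutFun_exit_lt_entry (x₁, h x₁)
    linarith
  · by_contra! hlt
    have hm := S.strictMonoOn_line hh S.isCut_entrySide.continuous S.isCut_entrySide.mono
      (x₁ := x) (x₂ := z) (fun y hy => hconn x hx y (by
        rw [uIcc_comm, uIcc_of_le (hlt.le.trans h1)]; exact hy))
      ⟨le_rfl, hlt.le.trans h1⟩ ⟨hlt.le, h1⟩ hlt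
    have := (S.cutFun_of_closedR (S.map_mem_closedR hx)).1
    simp only at hm
    linarith
  · by_contra! hlt
    have hm := S.strictMonoOn_line hh S.isCut_exitSide.continuous S.isCut_exitSide.mono
      (x₁ := z) (x₂ := x) (fun y hy => hconn x hx y (by
        rw [uIcc_of_le (h2.trans hlt.le)]; exact hy))
      ⟨h2, hlt.le⟩ ⟨h2.trans hlt.le, le_rfl⟩ hlt
    have := (S.cutFun_of_closedR (S.map_mem_closedR hx)).2
    simp only at hm
    linarith

/-- Along a line, the deviation from a cut is strictly increasing on the crossing interval. -/
lemma cutFun_lt {b : ℝ → ℝ} (hb : Continuous b) (hbm : MonoS (-τ.sgn) b) {x y : ℝ}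
    (hx : (x, h x) ∈ closure (crossing Q R f)) (hy : (y, h y) ∈ closure (crossing Q R f))
    (hxy : x < y) : cutFun f η b (x, h x) < cutFun f η b (y, h y) := by
  obtain ⟨x₁, x₂, -, hmem, -, -⟩ := S.exists_interval hh
  exact S.strictMonoOn_line hh hb hbm (fun x hx => (hmem x).2 hx) ((hmem x).1 hx) ((hmem y).1 hy) hxy

lemma exists_zero {b : ℝ → ℝ} (hb : R.IsCut τ b) :
    ∃ x, (x, h x) ∈ closure (crossing Q R f) ∧ cutFun f η b (x, h x) = 0 := by
  obtain ⟨z, hz, -⟩ := S.exists_mid_zero hh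
  obtain ⟨x, hx, hx0⟩ := S.exists_zero_near hh hz hb
  exact ⟨x, hx x left_mem_uIcc, hx0⟩

lemma zero_unique {b : ℝ → ℝ} (hb : R.IsCut τ b) {x y : ℝ}
    (hx : (x, h x) ∈ closure (crossing Q R f)) (hy : (y, h y) ∈ closure (crossing Q R f))
    (hx0 : cutFun f η b (x, h x) = 0) (hy0 : cutFun f η b (y, h y) = 0) : x = y := by
  rcases lt_trichotomy x y with hlt | rfl | hlt
  · have := S.cutFun_lt hh hb.continuous hb.mono hx hy hlt; linarith
  · rfl
  · have := S.cutFun_lt hh hb.continuous hb.mono hy hx hlt; linarith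

end StripMap

/-! ### The preimage of a strip -/

/-- If $\eta\,du\le0$, the expansion makes $dx$ comparable with $dy$ at once. Otherwise $(du,dv)$
lies along a curve of the opposite type, so $dv$ has the sign opposite to the contribution of $dx$;
hence $dv$ is controlled by $dy$ alone, and $|du|\le\gamma|dv|$ finishes the estimate. -/
lemma lip_aux {η t a b c d du dv dx dy ε ρ γ C : ℝ} (hη : η = 1 ∨ η = -1) (ht : t = 1 ∨ t = -1)
    (hγ : 0 ≤ γ) (ha : ρ ≤ η * a) (hc : 0 ≤ η * (t * c)) (hb : |b| ≤ C) (hd : |d| ≤ C)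
    (hu : |du - (dx * a + dy * b)| ≤ ε * (|dx| + |dy|))
    (hv : |dv - (dx * c + dy * d)| ≤ ε * (|dx| + |dy|)) (hlip : |du| ≤ γ * |dv|)
    (hmono : 0 ≤ η * (t * dv) → η * du ≤ 0) (hdx : 0 ≤ dx) :
    ρ * dx ≤ C * (1 + γ) * |dy| + (1 + γ) * (ε * (|dx| + |dy|)) := by
  set E := ε * (|dx| + |dy|) with hE
  have hE0 : 0 ≤ E := (abs_nonneg _).trans hu
  have hC : 0 ≤ C := (abs_nonneg _).trans hb
  have h1 : ρ * dx ≤ η * a * dx := mul_le_mul_of_nonneg_right ha hdx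
  have hbdy : |dy * b| ≤ C * |dy| := by
    rw [abs_mul, mul_comm]; exact mul_le_mul_of_nonneg_right hb (abs_nonneg _)
  have hddy : |dy * d| ≤ C * |dy| := by
    rw [abs_mul, mul_comm]; exact mul_le_mul_of_nonneg_right hd (abs_nonneg _)
  have h2 : η * a * dx ≤ η * du + C * |dy| + E := by
    have e1 := abs_le.1 hu
    have e2 := abs_le.1 hbdy
    rcases hη with rfl | rfl <;> linarith [e1.1, e1.2, e2.1, e2.2]
  have h3 : 0 ≤ γ * (C * |dy| + E) := mul_nonneg hγ (by positivity)
  rcases le_or_gt (η * du) 0 with hneg | hpos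
  · linarith
  · have hV : η * (t * dv) < 0 := by
      by_contra! h
      linarith [hmono h]
    have h4 : |dv| ≤ C * |dy| + E := by
      have e1 := abs_le.1 hv
      have e2 := abs_le.1 hddy
      have h5 := mul_nonneg hc hdx
      have h6 : |dv| = -(η * (t * dv)) := by
        rcases hη with rfl | rfl <;> rcases ht with rfl | rfl
        · rw [abs_of_neg (by linarith)]; ring
        · rw [abs_of_pos (by linarith)]; ring
        · rw [abs_of_pos (by linarith)]; ring
        · rw [abs_of_neg (by linarith)]; ring
      rw [h6]
      rcases hη with rfl | rfl <;> rcases ht with rfl | rfl <;> linarith [e1.1, e1.2, e2.1, e2.2]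
    have h7 : η * du ≤ |du| := by
      rcases hη with rfl | rfl
      · rw [one_mul]; exact le_abs_self _
      · rw [neg_one_mul]; exact neg_le_abs _
    have h8 := mul_le_mul_of_nonneg_left h4 hγ
    linarith

lemma abs_sub_le_of_local {X : ℝ → ℝ} (hX : Continuous X) {L lo hi : ℝ}
    (hloc : ∀ y ∈ Icc lo hi, ∀ᶠ z in 𝓝[Icc lo hi] y, |X z - X y| ≤ L * |z - y|) :
    ∀ y ∈ Icc lo hi, ∀ z ∈ Icc lo hi, |X y - X z| ≤ L * |y - z| := by
  have key : ∀ y ∈ Icc lo hi, ∀ z ∈ Icc lo hi, y ≤ z → |X z - X y| ≤ L * (z - y) := by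
    intro y hy z hz hyz
    have hcl : IsClosed ({w | |X w - X y| ≤ L * (w - y)} ∩ Icc y z) :=
      (isClosed_le (by fun_prop) (by fun_prop)).inter isClosed_Icc
    refine hcl.Icc_subset_of_forall_exists_gt (by simp) ?_ (right_mem_Icc.2 hyz)
    rintro w ⟨hw, hwI⟩ u hu
    have hwI' : w ∈ Icc lo hi := ⟨hy.1.trans hwI.1, hwI.2.le.trans hz.2⟩
    have hle : 𝓝[>] w ≤ 𝓝[Icc lo hi] w :=
      nhdsWithin_le_of_mem (mem_of_superset (Ioo_mem_nhdsGT hwI.2)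
        fun t ht => ⟨hwI'.1.trans ht.1.le, ht.2.le.trans hz.2⟩)
    obtain ⟨v, hv, hvu⟩ := (((hloc w hwI').filter_mono hle).and (Ioc_mem_nhdsGT hu)).exists
    refine ⟨v, ?_, hvu⟩
    rw [abs_of_pos (sub_pos.2 hvu.1)] at hv
    have hw' : |X w - X y| ≤ L * (w - y) := hw
    have := abs_sub_le (X v) (X w) (X y)
    change |X v - X y| ≤ L * (v - y)
    linarith
  intro y hy z hz
  rcases le_total y z with h | h
  · rw [abs_sub_comm, abs_sub_comm y z, abs_of_nonneg (sub_nonneg.2 h)]; exact key y hy z hz h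
  · rw [abs_of_nonneg (sub_nonneg.2 h)]; exact key z hz y hy h

/-! ### Preimages of curves and strips, and their thickness. -/

namespace StripMap

variable {γ : ℝ} {σ τ : MonoType} {Q R : Quad} {f g : ℝ × ℝ → ℝ × ℝ} {dom dom' : Set (ℝ × ℝ)}
  {η ρ : ℝ} (S : StripMap γ σ τ Q R f g dom dom' η ρ)
include S

lemma hLine_const (y : ℝ) : HLine Q σ (Q.clamp fun _ => y) :=
  S.quadQ.hLine_clamp S.nonneg continuous_const (monoS_const _ _)

/-- Two points of the preimage of a cut are not in a position of type `σ`. -/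
lemma not_cone_of_zero {b : ℝ → ℝ} (hb : R.IsCut τ b) {p q : ℝ × ℝ}
    (hp : p ∈ closure (crossing Q R f)) (hq : q ∈ closure (crossing Q R f))
    (hp0 : cutFun f η b p = 0) (hq0 : cutFun f η b q = 0) (hlt : p.1 < q.1) :
    ¬ 0 ≤ σ.sgn * (q.2 - p.2) := by
  intro hσ
  set k := (q.2 - p.2) / (q.1 - p.1) with hk
  have hk0 : 0 ≤ σ.sgn * k := by
    rw [hk, mul_div_assoc']; exact div_nonneg hσ (by linarith)
  -- The straight line through `p` and `q`, cut off at the α-sides, is an admissible line meeting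
  -- the preimage of the cut twice.
  set l : ℝ → ℝ := fun x => p.2 + k * (x - p.1) with hl
  have hlm : MonoS σ.sgn l := fun x y hxy => by
    have := mul_nonneg hk0 (sub_nonneg.2 hxy)
    simp only [hl]; linarith
  have hh := S.quadQ.hLine_clamp S.nonneg (l := l) (by fun_prop) hlm
  have hlp : Q.clamp l p.1 = p.2 := by
    have h0 : l p.1 = p.2 := by simp [hl]
    have := S.mem_closedQ hp
    rw [Quad.clamp_of_mem (by rw [h0]; exact this.1) (by rw [h0]; exact this.2.1), h0]
  have hlq : Q.clamp l q.1 = q.2 := by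
    have h0 : l q.1 = q.2 := by
      simp only [hl, hk]; rw [div_mul_cancel₀ _ (by linarith : q.1 - p.1 ≠ 0)]; ring
    have := S.mem_closedQ hq
    rw [Quad.clamp_of_mem (by rw [h0]; exact this.1) (by rw [h0]; exact this.2.1), h0]
  have := S.zero_unique hh hb (x := p.1) (y := q.1) (by rwa [hlp]) (by rwa [hlq]) (by rwa [hlp])
    (by rwa [hlq])
  linarith

lemma local_lipschitz {b : ℝ → ℝ} (hb : R.IsCut τ b) (hbl : ∀ x y, |b x - b y| ≤ γ * |x - y|)
    {C : ℝ} (hC : ∀ p ∈ closure (crossing Q R f), ∀ A : ℝ × ℝ →L[ℝ] ℝ × ℝ,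
      HasFDerivAt f A p → ‖A‖ ≤ C) {p : ℝ × ℝ}
    (hp : p ∈ closure (crossing Q R f)) (hp0 : cutFun f η b p = 0) :
    ∀ᶠ q in 𝓝 p, cutFun f η b q = 0 → |q.1 - p.1| ≤ (C * (1 + γ) + 1) * |q.2 - p.2| := by
  obtain ⟨A, hA, h11, h12, h21, h22⟩ := S.deriv p hp
  have hγ := S.nonneg
  have hρ := S.one_lt
  -- The excess of `ρ` over 1 absorbs the error in `dx`; the error in `dy` is the final `+ 1` of the
  -- Lipschitz constant.
  obtain ⟨ε, hε, e1, e2⟩ : ∃ ε > 0, (1 + γ) * ε ≤ ρ - 1 ∧ (1 + γ) * ε ≤ 1 := by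
    refine ⟨min (ρ - 1) 1 / (1 + γ), by have := sub_pos.2 hρ; positivity, ?_, ?_⟩ <;>
      rw [mul_div_cancel₀ _ (by linarith : 1 + γ ≠ 0)]
    · exact min_le_left _ _
    · exact min_le_right _ _
  have hA1 : ‖A (0, 1)‖ ≤ C := by
    refine (A.le_opNorm _).trans ?_
    have : ‖((0 : ℝ), (1 : ℝ))‖ = 1 := by simp
    rw [this, mul_one]
    exact hC p hp A hA
  have hbC : |(A (0, 1)).1| ≤ C := (norm_fst_le _).trans hA1
  have hdC : |(A (0, 1)).2| ≤ C := (norm_snd_le _).trans hA1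
  have hC0 : 0 ≤ C := (abs_nonneg _).trans hbC
  filter_upwards [hA.isLittleO.def hε] with q hq hq0
  have hAv : A (q - p) = (q.1 - p.1) • A (1, 0) + (q.2 - p.2) • A (0, 1) := by
    rw [← map_smul, ← map_smul, ← map_add]
    congr 1
    ext <;> simp
  have hn : ‖q - p‖ ≤ |q.1 - p.1| + |q.2 - p.2| :=
    max_le (le_add_of_nonneg_right (abs_nonneg _)) (le_add_of_nonneg_left (abs_nonneg _))
  have hq' := hq.trans (mul_le_mul_of_nonneg_left hn hε.le)
  rw [hAv] at hq'
  have hU : |((f q).1 - (f p).1) - ((q.1 - p.1) * (A (1, 0)).1 + (q.2 - p.2) * (A (0, 1)).1)| ≤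
      ε * (|q.1 - p.1| + |q.2 - p.2|) := (le_max_left _ _).trans hq'
  have hV : |((f q).2 - (f p).2) - ((q.1 - p.1) * (A (1, 0)).2 + (q.2 - p.2) * (A (0, 1)).2)| ≤
      ε * (|q.1 - p.1| + |q.2 - p.2|) := (le_max_right _ _).trans hq'
  have hneg : ∀ {u a b dx dy : ℝ}, |u - (dx * a + dy * b)| ≤ ε * (|dx| + |dy|) →
      |(-u) - ((-dx) * a + (-dy) * b)| ≤ ε * (|-dx| + |-dy|) := by
    intro u a b dx dy h
    rw [abs_neg dx, abs_neg dy, ← abs_neg]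
    convert h using 2; ring
  have hp1 := S.cutFun_eq_zero.1 hp0
  have hq1 := S.cutFun_eq_zero.1 hq0
  have hlip : |(f q).1 - (f p).1| ≤ γ * |(f q).2 - (f p).2| := by rw [hp1, hq1]; exact hbl _ _
  have hm : ∀ {v v' : ℝ}, 0 ≤ η * (τ.sgn * (v' - v)) → η * (b v' - b v) ≤ 0 := fun h => by
    linarith [hb.mono.sub_nonneg τ.sgn_eq S.sign h]
  have fin : ∀ {dx dy : ℝ}, 0 ≤ dx →
      ρ * dx ≤ C * (1 + γ) * |dy| + (1 + γ) * (ε * (|dx| + |dy|)) →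
      dx ≤ (C * (1 + γ) + 1) * |dy| := by
    intro dx dy hdx h
    rw [abs_of_nonneg hdx] at h
    have k1 := mul_le_mul_of_nonneg_right e1 hdx
    have k2 := mul_le_mul_of_nonneg_right e2 (abs_nonneg dy)
    linarith
  rcases le_total 0 (q.1 - p.1) with hdx | hdx
  · rw [abs_of_nonneg hdx]
    refine fin hdx (lip_aux S.sign τ.sgn_eq hγ h11 h21.le hbC hdC hU hV hlip ?_ hdx)
    rw [hp1, hq1]; exact hm
  · rw [abs_of_nonpos hdx, ← abs_neg (q.2 - p.2)]
    refine fin (by linarith) (lip_aux S.sign τ.sgn_eq hγ h11 h21.le hbC hdC (hneg hU) (hneg hV)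
      (by rwa [abs_neg, abs_neg]) ?_ (by linarith))
    rw [neg_sub, neg_sub, hp1, hq1]; exact hm

/-- The preimage of a `v`-curve of `R` is a `v`-curve of `Q`. -/
theorem exists_vCurve {b : ℝ → ℝ} (hb : R.IsCut τ b) (hbl : ∀ x y, |b x - b y| ≤ γ * |x - y|)
    {C : ℝ} (hC : ∀ p ∈ closure (crossing Q R f), ∀ A : ℝ × ℝ →L[ℝ] ℝ × ℝ,
      HasFDerivAt f A p → ‖A‖ ≤ C) :
    ∃ a : Arc, IsVCurve (C * (1 + γ) + 1) σ Q a ∧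
      ∀ y, (a.ext y, Q.clamp (fun _ => y) (a.ext y)) ∈ closure (crossing Q R f) ∧
        cutFun f η b (a.ext y, Q.clamp (fun _ => y) (a.ext y)) = 0 := by
  -- `X y` is the abscissa where the horizontal line at height `y`, cut off at the α-sides, meets
  -- the preimage of the cut; `xm` and `xp` are those for the α-sides.
  choose X hX hX0 using fun y => S.exists_zero (S.hLine_const y) hb
  obtain ⟨xm, hxm, hxm0⟩ := S.exists_zero (S.quadQ.hLine_αm S.nonneg) hb
  obtain ⟨xp, hxp, hxp0⟩ := S.exists_zero (S.quadQ.hLine_αp S.nonneg) hb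
  have hmle : ∀ y, y ≤ Q.αm.ext (X y) → X y = xm := fun y hy => by
    have hc : Q.clamp (fun _ => y) (X y) = Q.αm.ext (X y) :=
      max_eq_left ((min_le_right _ _).trans hy)
    exact S.zero_unique (S.quadQ.hLine_αm S.nonneg) hb (hc ▸ hX y) hxm (hc ▸ hX0 y) hxm0
  have hple : ∀ y, Q.αp.ext (X y) ≤ y → X y = xp := fun y hy => by
    have hc : Q.clamp (fun _ => y) (X y) = Q.αp.ext (X y) := by
      rw [Quad.clamp, min_eq_left hy, max_eq_right (S.quadQ.α_lt _).le]
    exact S.zero_unique (S.quadQ.hLine_αp S.nonneg) hb (hc ▸ hX y) hxp (hc ▸ hX0 y) hxp0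
  have hmle' : ∀ y, y ≤ Q.αm.ext xm → X y = xm := fun y hy => by
    have hc : Q.clamp (fun _ => y) xm = Q.αm.ext xm := max_eq_left ((min_le_right _ _).trans hy)
    exact S.zero_unique (S.hLine_const y) hb (hX y) (by rwa [hc]) (hX0 y) (by rwa [hc])
  have hple' : ∀ y, Q.αp.ext xp ≤ y → X y = xp := fun y hy => by
    have hc : Q.clamp (fun _ => y) xp = Q.αp.ext xp := by
      rw [Quad.clamp, min_eq_left hy, max_eq_right (S.quadQ.α_lt _).le]
    exact S.zero_unique (S.hLine_const y) hb (hX y) (by rwa [hc]) (hX0 y) (by rwa [hc])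
  have hlohi : Q.αm.ext xm ≤ Q.αp.ext xp := by
    by_contra! hlt
    have h1 := hmle' _ hlt.le
    have h2 := hple' _ le_rfl
    rw [h1] at h2
    have := S.quadQ.α_lt xm
    rw [h2] at this hlt
    linarith
  have hval : ∀ y ∈ Icc (Q.αm.ext xm) (Q.αp.ext xp), Q.clamp (fun _ => y) (X y) = y := by
    intro y hy
    refine Quad.clamp_of_mem ?_ ?_
    · by_contra! hlt
      rw [hmle y hlt.le] at hlt
      linarith [hy.1]
    · by_contra! hlt
      rw [hple y hlt.le] at hlt
      linarith [hy.2]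
  have hmono : MonoS (-σ.sgn) X := by
    intro y z hyz
    by_contra! hneg
    have hle : ∀ x, Q.clamp (fun _ => y) x ≤ Q.clamp (fun _ => z) x := fun x =>
      max_le_max le_rfl (min_le_min le_rfl hyz)
    have hmz := (S.hLine_const z).mono
    have hmy := (S.hLine_const y).mono
    rcases σ.sgn_eq with hs | hs <;> rw [hs] at hneg hmz hmy
    · have hlt : X y < X z := by linarith
      refine S.not_cone_of_zero hb (hX y) (hX z) (hX0 y) (hX0 z) hlt ?_
      have h1 := hmz _ _ hlt.le
      have h2 := hle (X y)
      rw [hs]; simp only; linarith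
    · have hlt : X z < X y := by linarith
      refine S.not_cone_of_zero hb (hX z) (hX y) (hX0 z) (hX0 y) hlt ?_
      have h1 := hmy _ _ hlt.le
      have h2 := hle (X z)
      rw [hs]; simp only; linarith
  have hclc : Continuous fun z : ℝ × ℝ => Q.clamp (fun _ => z.1) z.2 := by
    have h1 := S.quadQ.αm_mono.continuous S.nonneg
    have h2 := S.quadQ.αp_mono.continuous S.nonneg
    unfold Quad.clamp
    fun_prop
  -- The graph is closed by uniqueness of the zero, and `X` is bounded.
  have hXc : Continuous X := by
    obtain ⟨B, hB⟩ := S.quadQ.exists_bound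
    rw [continuous_iff_continuousAt]
    intro y
    refine (isCompact_Icc (a := -B) (b := B)).tendsto_nhds_of_unique_mapClusterPt
      (Eventually.of_forall fun z => abs_le.1 (hB _ (S.mem_closedQ (hX z))).1) ?_
    intro x _ hx
    have hcl : IsClosed {z : ℝ × ℝ | (z.2, Q.clamp (fun _ => z.1) z.2) ∈
        closure (crossing Q R f) ∩ cutFun f η b ⁻¹' {0}} := by
      have : ContinuousOn (cutFun f η b) (closure (crossing Q R f)) := fun p hp =>
        (S.continuousAt_cutFun hb.continuous (S.mem_dom hp)).continuousWithinAt
      exact (this.preimage_isClosed_of_isClosed isClosed_closure isClosed_singleton).preimage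
        (continuous_snd.prodMk hclc)
    have hmem : (y, x) ∈ {z : ℝ × ℝ | (z.2, Q.clamp (fun _ => z.1) z.2) ∈
        closure (crossing Q R f) ∩ cutFun f η b ⁻¹' {0}} := by
      rw [← hcl.closure_eq, mem_closure_iff_frequently, nhds_prod_eq]
      rw [(((𝓝 y).basis_sets).prod (𝓝 x).basis_sets).frequently_iff]
      rintro ⟨U, W⟩ ⟨hU, hW⟩
      obtain ⟨z, hz, hzU⟩ := ((mapClusterPt_iff_frequently.1 hx W hW).and_eventually hU).exists
      exact ⟨(z, X z), ⟨hzU, hz⟩, hX z, hX0 z⟩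
    exact S.zero_unique (S.hLine_const y) hb hmem.1 (hX y) hmem.2 (hX0 y)
  set a : Arc := ⟨Q.αm.ext xm, Q.αp.ext xp, hlohi, X⟩ with ha
  -- Beyond the end heights `X` already equals `xm` or `xp`, so the continued arc describes the zero
  -- at every height, as the thickness requires.
  have hext : ∀ y, a.ext y = X y := by
    intro y
    rcases le_total y (Q.αm.ext xm) with h | h
    · rw [Arc.ext_of_le (a := a) h, hmle' y h]; exact hmle' _ le_rfl
    · rcases le_total (Q.αp.ext xp) y with h' | h'
      · rw [Arc.ext_of_ge (a := a) h', hple' y h']; exact hple' _ le_rfl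
      · exact Arc.ext_of_mem (a := a) ⟨h, h'⟩
  have hmem : ∀ y ∈ Icc a.lo a.hi, (X y, y) ∈ closure (crossing Q R f) ∧ cutFun f η b (X y, y) = 0 := by
    intro y hy
    have h1 := hX y
    have h2 := hX0 y
    rw [hval y hy] at h1 h2
    exact ⟨h1, h2⟩
  refine ⟨a, ⟨⟨?_, ?_⟩, ?_, ?_, ?_⟩, fun y => ?_⟩
  · refine MonoType.on_iff.2 fun x _ y _ hxy => ?_
    rw [MonoType.sgn_opp]; exact hmono x y hxy
  · refine abs_sub_le_of_local hXc fun y hy => ?_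
    have hc : Tendsto (fun z => (X z, z)) (𝓝[Icc a.lo a.hi] y) (𝓝 (X y, y)) :=
      ((hXc.prodMk continuous_id).tendsto y).mono_left nhdsWithin_le_nhds
    filter_upwards [hc.eventually (S.local_lipschitz hb hbl hC (hmem y hy).1 (hmem y hy).2),
      self_mem_nhdsWithin] with z hz hzI
    exact hz (hmem z hzI).2
  · have : X (Q.αm.ext xm) = xm := hmle' _ le_rfl
    change (X (Q.αm.ext xm), Q.αm.ext xm) ∈ _
    rw [this]
    exact S.quadQ.mem_αm (S.mem_closedQ hxm) rfl
  · have : X (Q.αp.ext xp) = xp := hple' _ le_rfl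
    change (X (Q.αp.ext xp), Q.αp.ext xp) ∈ _
    rw [this]
    exact S.quadQ.mem_αp (S.mem_closedQ hxp) rfl
  · rintro ⟨x, y⟩ ⟨hy, hx⟩
    have hx' : x = X y := hx
    rw [hx']
    exact closure_mono (fun _ h => h.1) (hmem y hy).1
  · rw [hext]; exact ⟨hX y, hX0 y⟩

/-- The expansion along a line. -/
lemma expansion {h : ℝ → ℝ} (hh : HLine Q σ h) {x y : ℝ}
    (hx : (x, h x) ∈ closure (crossing Q R f)) (hy : (y, h y) ∈ closure (crossing Q R f))
    (hxy : x < y) : ρ * (y - x) ≤ η * ((f (y, h y)).1 - (f (x, h x)).1) ∧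
      0 ≤ η * (τ.sgn * ((f (y, h y)).2 - (f (x, h x)).2)) := by
  constructor
  -- The midpoint of `ρ'` and `ρ` is used as local slope so that subtracting `ρ' * z` leaves a
  -- strictly increasing function.
  · have key : ∀ ρ' < ρ, ρ' * (y - x) ≤ η * ((f (y, h y)).1 - (f (x, h x)).1) := by
      intro ρ' hρ'
      obtain ⟨x₁, x₂, -, hmem, -, -⟩ := S.exists_interval hh
      have hK : ∀ z ∈ Icc x y, (z, h z) ∈ closure (crossing Q R f) := fun z hz =>
        (hmem z).2 ⟨((hmem x).1 hx).1.trans hz.1, hz.2.trans ((hmem y).1 hy).2⟩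
      have hb0 : MonoS (-τ.sgn) fun _ => (0 : ℝ) := monoS_const _ _
      have hsl := fun z hz => S.eventually_slope hh (hK z hz) hb0
        (show (ρ + ρ') / 2 < ρ by linarith)
      have hm := strictMonoOn_of_local
        (f := fun z => cutFun f η (fun _ => 0) (z, h z) - ρ' * z) (a := x) (b := y)
        ((S.continuousOn_line hh continuous_const fun z hz => S.mem_dom (hK z hz)).sub
          (by fun_prop))
        (fun z hz => by
          filter_upwards [nhdsWithin_le_nhds (hsl z (Ico_subset_Icc_self hz)), self_mem_nhdsWithin]
            with w hw hzw
          have hzw' : z < w := hzw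
          have := hw.1 hzw'.le
          nlinarith)
        (fun z hz => by
          filter_upwards [nhdsWithin_le_nhds (hsl z (Ioc_subset_Icc_self hz)), self_mem_nhdsWithin]
            with w hw hzw
          have hzw' : w < z := hzw
          have := hw.2 hzw'.le
          nlinarith)
        (left_mem_Icc.2 hxy.le) (right_mem_Icc.2 hxy.le) hxy
      simp only [cutFun] at hm
      linarith
    have hyx : 0 < y - x := sub_pos.2 hxy
    rw [← le_div_iff₀ hyx]
    exact le_of_forall_lt_imp_le_of_dense fun ρ' hρ' => (le_div_iff₀ hyx).2 (key ρ' hρ')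
  -- All linear cuts of the type opposite to `τ` are tested. If the second increment were negative,
  -- the slope `u / -v` below would make the total increment vanish.
  · have key : ∀ k : ℝ, 0 ≤ k → 0 < η * ((f (y, h y)).1 - (f (x, h x)).1) +
        k * (η * (τ.sgn * ((f (y, h y)).2 - (f (x, h x)).2))) := by
      intro k hk
      have hbm : MonoS (-τ.sgn) fun v => -(k * (τ.sgn * v)) := by
        intro v w hvw
        have := mul_nonneg hk (sub_nonneg.2 hvw)
        rcases τ.sgn_eq with h | h <;> rw [h] <;> linarith
      have := S.cutFun_lt hh (by fun_prop) hbm hx hy hxy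
      simp only [cutFun] at this
      linarith
    by_contra! hneg
    set u := η * ((f (y, h y)).1 - (f (x, h x)).1)
    set v := η * (τ.sgn * ((f (y, h y)).2 - (f (x, h x)).2))
    have h0 := key 0 le_rfl
    rw [zero_mul, add_zero] at h0
    have := key (u / -v) (div_nonneg h0.le (by linarith))
    rw [div_mul_eq_mul_div, div_neg, mul_div_cancel_right₀ _ hneg.ne] at this
    linarith

/-- The preimage of the strip between two `v`-curves of `R`, given in the order in which lines
meet them. -/
theorem exists_strip_of_order {bl br : Arc} (hl : IsVCurve γ τ R bl) (hr : IsVCurve γ τ R br)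
    (hlt : ∀ p, cutFun f η br.ext p < cutFun f η bl.ext p) {M : ℝ}
    (hM : ∀ v ∈ Icc bl.lo bl.hi, η * (br.ext v - bl.ext v) ≤ M)
    {C : ℝ} (hC : ∀ p ∈ closure (crossing Q R f), ∀ A : ℝ × ℝ →L[ℝ] ℝ × ℝ,
      HasFDerivAt f A p → ‖A‖ ≤ C) :
    ∃ V : VStrip (C * (1 + γ) + 1) σ Q,
      V.carrier = {p | p ∈ crossing Q R f ∧ 0 < cutFun f η bl.ext p ∧ cutFun f η br.ext p < 0} ∧
      V.thickness ≤ M / ρ := by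
  have hcl := S.quadR.isCut_vCurve S.nonneg hl
  have hcr := S.quadR.isCut_vCurve S.nonneg hr
  obtain ⟨al, hal, hal'⟩ := S.exists_vCurve hcl (hl.mono.abs_ext_sub_le S.nonneg) hC
  obtain ⟨ar, har, har'⟩ := S.exists_vCurve hcr (hr.mono.abs_ext_sub_le S.nonneg) hC
  have hltX : ∀ y, al.ext y < ar.ext y := by
    intro y
    by_contra! hle
    have h1 := hlt (ar.ext y, Q.clamp (fun _ => y) (ar.ext y))
    rw [(har' y).2] at h1
    rcases hle.eq_or_lt with h | h
    · rw [h, (hal' y).2] at h1; exact lt_irrefl _ h1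
    · have := S.cutFun_lt (S.hLine_const y) hcl.continuous hcl.mono (har' y).1 (hal' y).1 h
      rw [(hal' y).2] at this
      linarith
  refine ⟨⟨al, ar, hal, har, hltX⟩, ?_, ?_⟩
  · ext p
    simp only [VStrip.carrier, mem_ofPred_eq]
    constructor
    · rintro ⟨hpQ, h1, h2⟩
      have hp : (p.1, Q.clamp (fun _ => p.2) p.1) = p := by
        rw [Quad.clamp_of_mem hpQ.1.le hpQ.2.1.le]
      have hL := S.hLine_const p.2
      obtain ⟨x₁, x₂, -, hmem, -, -⟩ := S.exists_interval hL
      -- The crossing set at this height is an interval containing both boundary points. Strict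
      -- monotonicity of the entry and exit deviations then improves membership in the closure to
      -- membership in the open set.
      have hpK : (p.1, Q.clamp (fun _ => p.2) p.1) ∈ closure (crossing Q R f) :=
        (hmem _).2 ⟨((hmem _).1 (hal' p.2).1).1.trans h1.le, h2.le.trans ((hmem _).1 (har' p.2).1).2⟩
      have k1 := S.cutFun_lt hL hcl.continuous hcl.mono (hal' p.2).1 hpK h1
      have k2 := S.cutFun_lt hL hcr.continuous hcr.mono hpK (har' p.2).1 h2
      have k3 := S.cutFun_lt hL S.isCut_entrySide.continuous S.isCut_entrySide.mono (hal' p.2).1 hpK h1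
      have k4 := S.cutFun_lt hL S.isCut_exitSide.continuous S.isCut_exitSide.mono hpK (har' p.2).1 h2
      have k5 := (S.cutFun_of_closedR (S.map_mem_closedR (hal' p.2).1)).1
      have k6 := (S.cutFun_of_closedR (S.map_mem_closedR (har' p.2).1)).2
      rw [(hal' p.2).2] at k1
      rw [(har' p.2).2] at k2
      rw [hp] at *
      have hα := S.α_lt (S.map_mem_closedR hpK) (S.mem_dom hpK)
      exact ⟨⟨hpQ, S.mem_region_of_cutFun hα.1 hα.2 (k5.trans_lt k3) (k4.trans_le k6)⟩, k1, k2⟩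
    · rintro ⟨hpc, h1, h2⟩
      have hp : (p.1, Q.clamp (fun _ => p.2) p.1) = p := by
        rw [Quad.clamp_of_mem hpc.1.1.le hpc.1.2.1.le]
      have hL := S.hLine_const p.2
      have hpK : (p.1, Q.clamp (fun _ => p.2) p.1) ∈ closure (crossing Q R f) := by
        rw [hp]; exact subset_closure hpc
      rw [← hp] at h1 h2
      refine ⟨hpc.1, ?_, ?_⟩
      · by_contra! hle
        rcases hle.eq_or_lt with h | h
        · have := (hal' p.2).2; rw [← h] at this; exact h1.ne' this
        · have := S.cutFun_lt hL hcl.continuous hcl.mono hpK (hal' p.2).1 h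
          rw [(hal' p.2).2] at this
          linarith
      · by_contra! hle
        rcases hle.eq_or_lt with h | h
        · have := (har' p.2).2; rw [h] at this; exact h2.ne this
        · have := S.cutFun_lt hL hcr.continuous hcr.mono (har' p.2).1 hpK h
          rw [(har' p.2).2] at this
          linarith
  · have hne : min al.lo ar.lo ≤ max al.hi ar.hi :=
      (min_le_left _ _).trans (al.le.trans (le_max_left _ _))
    refine csSup_le ((nonempty_Icc.2 hne).image _) ?_
    rintro _ ⟨y, -, rfl⟩
    simp only
    rw [abs_of_pos (sub_pos.2 (hltX y)), le_div_iff₀ (by linarith [S.one_lt]), mul_comm]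
    obtain ⟨h1, h2⟩ := S.expansion (S.hLine_const y) (hal' y).1 (har' y).1 (hltX y)
    have h3 := S.cutFun_eq_zero.1 (hal' y).2
    have h4 := S.cutFun_eq_zero.1 (har' y).2
    have h5 := hcr.mono.sub_nonneg τ.sgn_eq S.sign h2
    -- The image of the left point is on `bl` within its interval, at some height $v$, and the right
    -- one is on `br` at a height $v'$. As $v'$ lies in the direction $\eta\tau$ from $v$, replacing
    -- $v'$ by $v$ only increases $\eta(b_r(v')-b_l(v))$, which is then at most `M`.
    have h6 := hM _ (Quad.vCurve_mem_Icc hl (S.map_mem_closedR (hal' y).1) h3)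
    rw [h3, h4] at h1
    linarith

lemma image_inter_region {s : Set (ℝ × ℝ)} (hs : s ⊆ R.region) :
    g '' s ∩ Q.region = {p | p ∈ Q.region ∧ f p ∈ s} := by
  ext p
  constructor
  · rintro ⟨⟨q, hq, rfl⟩, hp⟩
    exact ⟨hp, by rwa [S.right_inv q (S.R_subset (hs hq))]⟩
  · rintro ⟨hp, hfp⟩
    exact ⟨⟨f p, hfp, S.left_inv p (S.Q_subset hp)⟩, hp⟩

lemma abs_ext_sub_le_dist {a b : Arc} (ha : a.MonoLip γ τ.opp) (hb : b.MonoLip γ τ.opp) {v : ℝ}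
    (hv : v ∈ Icc (min a.lo b.lo) (max a.hi b.hi)) : |b.ext v - a.ext v| ≤ a.dist b := by
  have h1 := ha.continuous S.nonneg
  have h2 := hb.continuous S.nonneg
  exact le_csSup (isCompact_Icc.image (by fun_prop)).bddAbove ⟨v, hv, rfl⟩

/-- The preimage of a `v`-strip of `R` in the region of `Q` is a `v`-strip of `Q`, thinner by the
factor `ρ`. -/
theorem exists_strip (V : VStrip γ τ R) {C : ℝ}
    (hC : ∀ p ∈ closure (crossing Q R f), ∀ A : ℝ × ℝ →L[ℝ] ℝ × ℝ, HasFDerivAt f A p → ‖A‖ ≤ C) :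
    ∃ V' : VStrip (C * (1 + γ) + 1) σ Q, V'.carrier = g '' V.carrier ∩ Q.region ∧
      V'.thickness ≤ V.thickness / ρ := by
  have himg := S.image_inter_region (s := V.carrier) fun p hp => hp.1
  have hdist := fun v hv => S.abs_ext_sub_le_dist V.left_curve.mono V.right_curve.mono (v := v) hv
  rcases S.sign with hη | hη
  · obtain ⟨V', h1, h2⟩ := S.exists_strip_of_order (M := V.thickness) V.left_curve V.right_curve
      (fun p => by have := V.lt (f p).2; simp only [cutFun, hη]; linarith)
      (fun v hv => by
        rw [hη, one_mul]
        exact (le_abs_self _).trans (hdist v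
          ⟨(min_le_left _ _).trans hv.1, hv.2.trans (le_max_left _ _)⟩)) hC
    refine ⟨V', ?_, h2⟩
    rw [h1, himg]
    ext p
    simp only [crossing, VStrip.carrier, cutFun, hη, mem_ofPred_eq, one_mul, sub_pos, sub_neg]
    tauto
  -- For `η = -1` lines meet the two curves in the reverse order.
  · obtain ⟨V', h1, h2⟩ := S.exists_strip_of_order (M := V.thickness) V.right_curve V.left_curve
      (fun p => by have := V.lt (f p).2; simp only [cutFun, hη]; linarith)
      (fun v hv => by
        have := (le_abs_self _).trans (hdist v
          ⟨(min_le_right _ _).trans hv.1, hv.2.trans (le_max_right _ _)⟩)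
        rw [hη, neg_one_mul, neg_sub]
        exact this) hC
    refine ⟨V', ?_, h2⟩
    rw [h1, himg]
    ext p
    simp only [crossing, VStrip.carrier, cutFun, hη, mem_ofPred_eq, neg_one_mul, neg_sub, sub_pos,
      sub_neg]
    tauto

end StripMap

/-! ### Families of strip maps over the circle -/

lemma _root_.IsCompact.exists_uniform {X : Type*} [TopologicalSpace X] {K : Set X}
    (hK : IsCompact K)
    {B : ℝ → X → Prop} (hmono : ∀ C C' x, C ≤ C' → B C x → B C' x)
    (hloc : ∀ x ∈ K, ∃ C, ∀ᶠ y in 𝓝 x, B C y) : ∃ C, ∀ x ∈ K, B C x := by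
  refine hK.induction_on (p := fun s => ∃ C, ∀ x ∈ s, B C x) ⟨0, by simp⟩ ?_ ?_ ?_
  · rintro s t hst ⟨C, hC⟩
    exact ⟨C, fun x hx => hC x (hst hx)⟩
  · rintro s t ⟨C, hC⟩ ⟨C', hC'⟩
    refine ⟨max C C', ?_⟩
    rintro x (hx | hx)
    · exact hmono _ _ _ (le_max_left _ _) (hC x hx)
    · exact hmono _ _ _ (le_max_right _ _) (hC' x hx)
  · intro x hx
    obtain ⟨C, hC⟩ := hloc x hx
    exact ⟨_, mem_nhdsWithin_of_mem_nhds hC, C, fun y hy => hy⟩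

lemma _root_.IsCompact.exists_uniform_eventually {X Y : Type*} [TopologicalSpace X]
    [TopologicalSpace Y]
    {K : Set X} (hK : IsCompact K) {B : ℝ → Y → X → Prop} {z₀ : Y}
    (hmono : ∀ C C' z x, C ≤ C' → B C z x → B C' z x)
    (hloc : ∀ x ∈ K, ∃ C, ∀ᶠ w in 𝓝 (z₀, x), B C w.1 w.2) :
    ∃ C, ∀ᶠ z in 𝓝 z₀, ∀ x ∈ K, B C z x := by
  obtain ⟨C, hC⟩ := hK.exists_uniform (B := fun C x => ∀ᶠ w in 𝓝 (z₀, x), B C w.1 w.2)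
    (fun C C' x h hB => hB.mono fun w => hmono _ _ _ _ h) fun x hx => by
      obtain ⟨C, hC⟩ := hloc x hx
      refine ⟨C, ?_⟩
      have h1 : Tendsto (fun y : X => (z₀, y)) (𝓝 x) (𝓝 (z₀, x)) :=
        (continuous_const.prodMk continuous_id).tendsto x
      exact h1.eventually hC.eventually_nhds
  exact ⟨C, hK.eventually_forall_of_forall_eventually hC⟩

lemma isCompact_univ_angle : IsCompact (univ : Set Real.Angle) := by
  have h := (isCompact_Icc (a := -Real.pi) (b := Real.pi)).image Real.Angle.continuous_coe
  refine h.of_isClosed_subset isClosed_univ fun Δ _ => ⟨Δ.toReal, ?_, Real.Angle.coe_toReal Δ⟩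
  exact ⟨(Real.Angle.neg_pi_lt_toReal Δ).le, Real.Angle.toReal_le_pi Δ⟩

/-- The sides of the quadrangles, continued by constants, depend continuously on the phase. -/
structure ContinuousQuads (Q : Real.Angle → Quad) : Prop where
  αm : Continuous fun z : Real.Angle × ℝ => (Q z.1).αm.ext z.2
  αp : Continuous fun z : Real.Angle × ℝ => (Q z.1).αp.ext z.2
  βm : Continuous fun z : Real.Angle × ℝ => (Q z.1).βm.ext z.2
  βp : Continuous fun z : Real.Angle × ℝ => (Q z.1).βp.ext z.2

namespace ContinuousQuads

variable {Q : Real.Angle → Quad}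

lemma swap (h : ContinuousQuads Q) : ContinuousQuads fun Δ => (Q Δ).swap :=
  ⟨h.βm, h.βp, h.αm, h.αp⟩

lemma comp (h : ContinuousQuads Q) {u : Real.Angle → Real.Angle} (hu : Continuous u) :
    ContinuousQuads fun Δ => Q (u Δ) := by
  have hc : Continuous fun z : Real.Angle × ℝ => (u z.1, z.2) := by fun_prop
  exact ⟨h.αm.comp hc, h.αp.comp hc, h.βm.comp hc, h.βp.comp hc⟩

lemma isOpen_region (h : ContinuousQuads Q) :
    IsOpen {z : Real.Angle × ℝ × ℝ | z.2 ∈ (Q z.1).region} := by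
  have h1 : Continuous fun z : Real.Angle × ℝ × ℝ => (z.1, z.2.1) := by fun_prop
  have h2 : Continuous fun z : Real.Angle × ℝ × ℝ => (z.1, z.2.2) := by fun_prop
  have e1 : Continuous fun z : Real.Angle × ℝ × ℝ => z.2.1 := by fun_prop
  have e2 : Continuous fun z : Real.Angle × ℝ × ℝ => z.2.2 := by fun_prop
  exact (isOpen_lt (h.αm.comp h1) e2).inter ((isOpen_lt e2 (h.αp.comp h1)).inter
    ((isOpen_lt (h.βm.comp h2) e1).inter (isOpen_lt e1 (h.βp.comp h2))))

lemma isClosed_closedRegion (h : ContinuousQuads Q) :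
    IsClosed {z : Real.Angle × ℝ × ℝ | z.2 ∈ (Q z.1).closedRegion} := by
  have h1 : Continuous fun z : Real.Angle × ℝ × ℝ => (z.1, z.2.1) := by fun_prop
  have h2 : Continuous fun z : Real.Angle × ℝ × ℝ => (z.1, z.2.2) := by fun_prop
  have e1 : Continuous fun z : Real.Angle × ℝ × ℝ => z.2.1 := by fun_prop
  have e2 : Continuous fun z : Real.Angle × ℝ × ℝ => z.2.2 := by fun_prop
  exact (isClosed_le (h.αm.comp h1) e2).inter ((isClosed_le e2 (h.αp.comp h1)).inter
    ((isClosed_le (h.βm.comp h2) e1).inter (isClosed_le e1 (h.βp.comp h2))))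

end ContinuousQuads

/-- The lines that interpolate between the `α`-sides. -/
def Quad.interp (Q : Quad) (s x : ℝ) : ℝ := (1 - s) * Q.αm.ext x + s * Q.αp.ext x

lemma ContinuousQuads.continuous_interp {Q : Real.Angle → Quad} (h : ContinuousQuads Q) :
    Continuous fun w : (Real.Angle × ℝ) × ℝ => (Q w.1.1).interp w.1.2 w.2 := by
  have hc : Continuous fun w : (Real.Angle × ℝ) × ℝ => (w.1.1, w.2) := by fun_prop
  have h1 := h.αm.comp hc
  have h2 := h.αp.comp hc
  have h3 : Continuous fun w : (Real.Angle × ℝ) × ℝ => w.1.2 := by fun_prop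
  exact ((continuous_const.sub h3).mul h1).add (h3.mul h2)

lemma Quad.IsQuadrangle.exists_interp {Q : Quad} {γ : ℝ} {σ : MonoType} (hQ : Q.IsQuadrangle γ σ)
    {p : ℝ × ℝ} (hp : p ∈ Q.closedRegion) : ∃ s ∈ Icc (0 : ℝ) 1, p = (p.1, Q.interp s p.1) := by
  have h0 := sub_pos.2 (hQ.α_lt p.1)
  refine ⟨(p.2 - Q.αm.ext p.1) / (Q.αp.ext p.1 - Q.αm.ext p.1),
    ⟨div_nonneg (sub_nonneg.2 hp.1) h0.le, (div_le_one h0).2 (by linarith [hp.2.1])⟩,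
    Prod.ext rfl ?_⟩
  simp only [interp]
  field_simp
  ring

lemma norm_le_of_hasFDerivAt {f : ℝ × ℝ → ℝ × ℝ} {A : ℝ × ℝ →L[ℝ] ℝ × ℝ} {p : ℝ × ℝ} {C : ℝ}
    (hA : HasFDerivAt f A p) (hC : 0 ≤ C) (h : ∀ᶠ q in 𝓝 p, dist (f p) (f q) ≤ C * dist p q) :
    ‖A‖ ≤ C := by
  refine hA.le_of_lip' hC ?_
  filter_upwards [h] with q hq
  rwa [dist_comm, dist_comm p, dist_eq_norm, dist_eq_norm] at hq

namespace StripMap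

section Single

variable {γ : ℝ} {σ τ : MonoType} {Q R : Quad} {f g : ℝ × ℝ → ℝ × ℝ} {dom dom' : Set (ℝ × ℝ)}
  {η ρ : ℝ} (S : StripMap γ σ τ Q R f g dom dom' η ρ)
include S

lemma hLine_interp {s : ℝ} (hs : s ∈ Icc (0 : ℝ) 1) : HLine Q σ (Q.interp s) :=
  (S.quadQ.hLine_αm S.nonneg).convex (S.quadQ.hLine_αp S.nonneg) hs

variable {h : ℝ → ℝ} (hh : HLine Q σ h)
include hh

/-- The crossing interval of a line lies inside an interval of the domain at whose ends the image
is outside `R`. -/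
lemma exists_margin : ∃ x₁ m x₂, x₁ < m ∧ m < x₂ ∧ (∀ x ∈ Icc x₁ x₂, (x, h x) ∈ dom) ∧
    f (x₁, h x₁) ∉ R.closedRegion ∧ f (x₂, h x₂) ∉ R.closedRegion ∧
    f (m, h m) ∈ R.region ∧ Q.βm.ext (h m) < m ∧ m < Q.βp.ext (h m) := by
  obtain ⟨a, b, hab, hmem, ha, hb⟩ := S.exists_interval hh
  obtain ⟨m, hm, hm0⟩ := S.exists_mid_zero hh
  have hmI := (hmem m).1 hm
  have haK := (hmem a).2 (left_mem_Icc.2 hab.le)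
  have hbK := (hmem b).2 (right_mem_Icc.2 hab.le)
  have hpt : Continuous fun x => (x, h x) := continuous_id.prodMk hh.continuous
  have hnhds : ∀ x, (x, h x) ∈ closure (crossing Q R f) →
      ∃ ε > 0, ∀ y, dist y x < ε → (y, h y) ∈ dom := fun x hx =>
    Metric.eventually_nhds_iff.1 (hpt.continuousAt.eventually
      (S.isOpen_dom.mem_nhds (S.mem_dom hx)))
  obtain ⟨ε₁, hε₁, hd₁⟩ := hnhds a haK
  obtain ⟨ε₂, hε₂, hd₂⟩ := hnhds b hbK
  obtain ⟨x₁, hx₁, hx₁'⟩ := ((S.eventually_lt hh haK S.isCut_entrySide.mono).and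
    (Ioo_mem_nhdsLT (by linarith : a - ε₁ < a))).exists
  obtain ⟨x₂, hx₂, hx₂'⟩ := ((S.eventually_gt hh hbK S.isCut_exitSide.mono).and
    (Ioo_mem_nhdsGT (by linarith : b < b + ε₂))).exists
  have hβ := S.β_lt (S.mem_closedQ hm) (S.mem_dom hm)
  refine ⟨x₁, m, x₂, hx₁'.2.trans_le hmI.1, hmI.2.trans_lt hx₂'.1, fun x hx => ?_, fun hcl => ?_,
    fun hcl => ?_, S.map_mem_R_of_mid hm hm0, hβ.1, hβ.2⟩
  · rcases lt_or_ge x a with h1 | h1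
    · exact hd₁ x (by rw [Real.dist_eq, abs_lt]; constructor <;> linarith [hx.1, hx₁'.1])
    · rcases le_or_gt x b with h2 | h2
      · exact S.mem_dom ((hmem x).2 ⟨h1, h2⟩)
      · exact hd₂ x (by rw [Real.dist_eq, abs_lt]; constructor <;> linarith [hx.2, hx₂'.2])
  · have := (S.cutFun_of_closedR hcl).1
    linarith
  · have := (S.cutFun_of_closedR hcl).2
    linarith

end Single

variable {γ : ℝ} {σ τ : MonoType} {Q R : Real.Angle → Quad} {f g : Real.Angle → ℝ × ℝ → ℝ × ℝ}
  {dom dom' : Real.Angle → Set (ℝ × ℝ)} {η ρ : Real.Angle → ℝ}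

/-- The derivatives of a continuous family of strip maps are uniformly bounded on the crossing
sets. -/
theorem exists_uniform_bound
    (S : ∀ Δ, StripMap γ σ τ (Q Δ) (R Δ) (f Δ) (g Δ) (dom Δ) (dom' Δ) (η Δ) (ρ Δ))
    (hQ : ContinuousQuads Q) (hR : ContinuousQuads R)
    (hloc : ∀ Δ₀, ∀ p₀ ∈ dom Δ₀, ∃ C, 0 ≤ C ∧ ∃ U ∈ 𝓝 (Δ₀, p₀), ∀ x ∈ U, x.2 ∈ dom x.1 ∧
      ∀ p, (x.1, p) ∈ U → dist (f x.1 x.2) (f x.1 p) ≤ C * dist x.2 p)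
    (hcont : ∀ Δ₀, ∀ p₀ ∈ dom Δ₀,
      Tendsto (fun x : Real.Angle × ℝ × ℝ => f x.1 x.2) (𝓝 (Δ₀, p₀)) (𝓝 (f Δ₀ p₀))) :
    ∃ C, ∀ Δ, ∀ p ∈ closure (crossing (Q Δ) (R Δ) (f Δ)), ∀ A : ℝ × ℝ →L[ℝ] ℝ × ℝ,
      HasFDerivAt (f Δ) A p → ‖A‖ ≤ C := by
  -- The linearization is bounded by local Lipschitz constants, without any continuity of the
  -- derivative.
  have hev : ∀ Δ₀, ∀ p₀ ∈ dom Δ₀, ∃ C, ∀ᶠ x in 𝓝 (Δ₀, p₀), x.2 ∈ dom x.1 ∧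
      ∀ A : ℝ × ℝ →L[ℝ] ℝ × ℝ, HasFDerivAt (f x.1) A x.2 → ‖A‖ ≤ C := by
    intro Δ₀ p₀ hp₀
    obtain ⟨C, hC, U, hU, h⟩ := hloc Δ₀ p₀ hp₀
    refine ⟨C, ?_⟩
    filter_upwards [eventually_mem_nhds_iff.2 hU] with x hx
    refine ⟨(h x (mem_of_mem_nhds hx)).1, fun A hA => norm_le_of_hasFDerivAt hA hC ?_⟩
    have hc : Tendsto (fun q : ℝ × ℝ => (x.1, q)) (𝓝 x.2) (𝓝 x) :=
      (continuous_const.prodMk continuous_id).tendsto x.2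
    filter_upwards [hc.eventually hx] with q hq using (h x (mem_of_mem_nhds hx)).2 q hq
  have hfz : ∀ Δ₀, ∀ p₀ ∈ dom Δ₀, Tendsto (fun x : Real.Angle × ℝ × ℝ => (x.1, f x.1 x.2))
      (𝓝 (Δ₀, p₀)) (𝓝 (Δ₀, f Δ₀ p₀)) := fun Δ₀ p₀ hp₀ =>
    (continuous_fst.tendsto (Δ₀, p₀)).prodMk_nhds (hcont Δ₀ p₀ hp₀)
  -- The closed islands are swept by the interpolating lines, so it is enough to bound the
  -- derivative near each pair (phase, line) in a compact set.
  have key : ∀ w ∈ (univ : Set Real.Angle) ×ˢ Icc (0 : ℝ) 1, ∃ C, ∀ᶠ z in 𝓝 w,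
      z.2 ∈ Icc (0 : ℝ) 1 → ∀ x,
        (x, (Q z.1).interp z.2 x) ∈ closure (crossing (Q z.1) (R z.1) (f z.1)) →
        ∀ A : ℝ × ℝ →L[ℝ] ℝ × ℝ, HasFDerivAt (f z.1) A (x, (Q z.1).interp z.2 x) → ‖A‖ ≤ C := by
    rintro ⟨Δ₀, s₀⟩ ⟨-, hs₀⟩
    have hl₀ := (S Δ₀).hLine_interp hs₀
    obtain ⟨x₁, m, x₂, h1, h2, hdom, hx₁, hx₂, hm, hm1, hm2⟩ := (S Δ₀).exists_margin hl₀
    have hpt : Continuous fun w : (Real.Angle × ℝ) × ℝ =>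
        (w.1.1, w.2, (Q w.1.1).interp w.1.2 w.2) := by
      have := hQ.continuous_interp
      fun_prop
    have hptx : ∀ x, Tendsto (fun z : Real.Angle × ℝ => (z.1, x, (Q z.1).interp z.2 x))
        (𝓝 (Δ₀, s₀)) (𝓝 (Δ₀, x, (Q Δ₀).interp s₀ x)) := fun x =>
      (hpt.comp (continuous_id.prodMk continuous_const)).tendsto (Δ₀, s₀)
    obtain ⟨C, hC⟩ := (isCompact_Icc (a := x₁) (b := x₂)).exists_uniform_eventually
      (z₀ := (Δ₀, s₀)) (B := fun C (z : Real.Angle × ℝ) (x : ℝ) => (x, (Q z.1).interp z.2 x) ∈ dom z.1 ∧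
        ∀ A : ℝ × ℝ →L[ℝ] ℝ × ℝ, HasFDerivAt (f z.1) A (x, (Q z.1).interp z.2 x) → ‖A‖ ≤ C)
      (fun C C' z x h hB => ⟨hB.1, fun A hA => (hB.2 A hA).trans h⟩) fun x hx => by
        obtain ⟨C, hC⟩ := hev Δ₀ _ (hdom x hx)
        exact ⟨C, (hpt.tendsto ((Δ₀, s₀), x)).eventually hC⟩
    refine ⟨C, ?_⟩
    have hout : ∀ x ∈ Icc x₁ x₂, f Δ₀ (x, (Q Δ₀).interp s₀ x) ∉ (R Δ₀).closedRegion →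
        ∀ᶠ z in 𝓝 (Δ₀, s₀), f z.1 (x, (Q z.1).interp z.2 x) ∉ (R z.1).closedRegion := by
      intro x hx hn
      have := hR.isClosed_closedRegion.isOpen_compl.mem_nhds
        (show (Δ₀, f Δ₀ (x, (Q Δ₀).interp s₀ x)) ∉ _ from hn)
      exact ((hfz Δ₀ _ (hdom x hx)).comp (hptx x)).eventually this
    have hmI : m ∈ Icc x₁ x₂ := ⟨h1.le, h2.le⟩
    have hin : ∀ᶠ z in 𝓝 (Δ₀, s₀), f z.1 (m, (Q z.1).interp z.2 m) ∈ (R z.1).region :=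
      ((hfz Δ₀ _ (hdom m hmI)).comp (hptx m)).eventually (hR.isOpen_region.mem_nhds hm)
    have hβm : ∀ᶠ z in 𝓝 (Δ₀, s₀), (Q z.1).βm.ext ((Q z.1).interp z.2 m) < m := by
      have hc : Continuous fun z : Real.Angle × ℝ × ℝ => (Q z.1).βm.ext z.2.2 :=
        hQ.βm.comp (continuous_fst.prodMk (continuous_snd.comp continuous_snd))
      exact ((hc.tendsto _).comp (hptx m)).eventually (gt_mem_nhds hm1)
    have hβp : ∀ᶠ z in 𝓝 (Δ₀, s₀), m < (Q z.1).βp.ext ((Q z.1).interp z.2 m) := by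
      have hc : Continuous fun z : Real.Angle × ℝ × ℝ => (Q z.1).βp.ext z.2.2 :=
        hQ.βp.comp (continuous_fst.prodMk (continuous_snd.comp continuous_snd))
      exact ((hc.tendsto _).comp (hptx m)).eventually (lt_mem_nhds hm2)
    filter_upwards [hC, hout x₁ ⟨le_rfl, (h1.trans h2).le⟩ hx₁,
      hout x₂ ⟨(h1.trans h2).le, le_rfl⟩ hx₂, hin, hβm, hβp] with z hz hz1 hz2 hzm hzβm hzβp hzs x hx
    have hl := (S z.1).hLine_interp hzs
    obtain ⟨a, b, hab, hmem, -, -⟩ := (S z.1).exists_interval hl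
    have hmK := (hmem m).1 ((S z.1).mem_closure_of (hz m hmI).1 hzm (hl.ge m) (hl.le m) hzβm hzβp)
    have hxK := (hmem x).1 hx
    -- The crossing interval of a nearby line contains `m` and is connected; reaching beyond `x₁` or
    -- `x₂` it would contain that point, whose image is outside `R`.
    refine (hz x ⟨?_, ?_⟩).2
    · by_contra! hlt
      exact hz1 ((S z.1).map_mem_closedR ((hmem x₁).2 ⟨hxK.1.trans hlt.le, h1.le.trans hmK.2⟩))
    · by_contra! hlt
      exact hz2 ((S z.1).map_mem_closedR ((hmem x₂).2 ⟨hmK.1.trans h2.le, hlt.le.trans hxK.2⟩))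
  obtain ⟨C, hC⟩ := (isCompact_univ_angle.prod isCompact_Icc).exists_uniform
    (fun C C' z hle hB hs x hx A hA => (hB hs x hx A hA).trans hle) key
  refine ⟨C, fun Δ p hp A hA => ?_⟩
  obtain ⟨s, hs, hps⟩ := (S Δ).quadQ.exists_interp ((S Δ).mem_closedQ hp)
  rw [hps] at hp hA
  exact hC (Δ, s) ⟨mem_univ _, hs⟩ hs p.1 hp A hA

end StripMap

/-! ### The flow over one period as a strip map -/

/-- A step by `T`, a nonzero multiple of the period, from the slice `Δ` to the slice `Δ'`. -/
structure IsPeriodStep (θ T T' : ℝ) (Δ Δ' : Real.Angle) : Prop where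
  angle : Δ + ((θ * T : ℝ) : Real.Angle) = Δ'
  neg : T' = -T
  period : ∃ n : ℤ, T = n * (2 * Real.pi)
  ne : T ≠ 0

lemma isPeriodStep_add (θ : ℝ) (Δ : Real.Angle) :
    IsPeriodStep θ (2 * Real.pi) (-(2 * Real.pi)) Δ (Δ + shift θ) :=
  ⟨by rw [shift, mul_left_comm, mul_assoc], rfl, ⟨1, by simp⟩, by positivity⟩

namespace IsPeriodStep

variable {F : ℝ → ℝ → ℝ → ℝ} {θ T T' : ℝ} {Δ Δ' : Real.Angle}

lemma symm (h : IsPeriodStep θ T T' Δ Δ') : IsPeriodStep θ T' T Δ' Δ := by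
  obtain ⟨rfl, rfl, ⟨n, hn⟩, hT⟩ := h
  refine ⟨?_, by simp, ⟨-n, by rw [hn]; push_cast; ring⟩, neg_ne_zero.2 hT⟩
  rw [mul_neg, Real.Angle.coe_neg, add_neg_cancel_right]

lemma mem_flowDomain (h : IsPeriodStep θ T T' Δ Δ') (hF : PeriodicC1 F) {p : ℝ × ℝ}
    (hp : p ∈ flowDomain F θ Δ T) : flow F θ Δ T p ∈ flowDomain F θ Δ' T' := by
  rw [← h.angle, h.neg]; exact flow_mem hF h.period hp

lemma flow_flow (h : IsPeriodStep θ T T' Δ Δ') (hF : PeriodicC1 F) {p : ℝ × ℝ}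
    (hp : p ∈ flowDomain F θ Δ T) : flow F θ Δ' T' (flow F θ Δ T p) = p := by
  rw [← h.angle, h.neg]; exact QuasiStrips.flow_flow hF h.period hp

end IsPeriodStep

lemma isPeriodStep_sub (θ : ℝ) (Δ : Real.Angle) :
    IsPeriodStep θ (-(2 * Real.pi)) (2 * Real.pi) Δ (Δ - shift θ) := by
  have := (isPeriodStep_add θ (Δ - shift θ)).symm
  rwa [sub_add_cancel] at this

/-- The flow in the coordinates given by a linear involution. -/
def conjFlow (F : ℝ → ℝ → ℝ → ℝ) (θ T : ℝ) (e : (ℝ × ℝ) ≃L[ℝ] (ℝ × ℝ)) (Δ : Real.Angle)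
    (p : ℝ × ℝ) : ℝ × ℝ := e (flow F θ Δ T (e p))

/-! ### Verification of the strip map axioms for the flow. -/

section ConjFlow

variable {F : ℝ → ℝ → ℝ → ℝ} {θ T T' : ℝ} {e : (ℝ × ℝ) ≃L[ℝ] (ℝ × ℝ)}

/-- The involution `e` is the identity for the Poincaré map and the interchange of coordinates for
its inverse, so one verification serves both halves of the theorem. -/
lemma stripMap_conjFlow (hF : PeriodicC1 F) (he : ∀ p, e (e p) = p) {Δ Δ' : Real.Angle}
    (hs : IsPeriodStep θ T T' Δ Δ') {γ : ℝ} (hγ : 0 ≤ γ) {σ τ : MonoType} {Q R : Quad}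
    (hQ : Q.IsQuadrangle γ σ) (hR : R.IsQuadrangle γ τ)
    (hQd : ∀ p ∈ Q.region, e p ∈ flowDomain F θ Δ T)
    (hRd : ∀ p ∈ R.region, e p ∈ flowDomain F θ Δ' T')
    (hβ : ∀ p ∈ Q.βm.vGraph ∪ Q.βp.vGraph, CollapsesAt F θ Δ T (e p))
    (hα : ∀ p ∈ R.αm.hGraph ∪ R.αp.hGraph, CollapsesAt F θ Δ' T' (e p))
    (hne : (crossing Q R (conjFlow F θ T e Δ)).Nonempty) {η ρ : ℝ} (hη : η = 1 ∨ η = -1)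
    (hρ : 1 < ρ)
    (hderiv : ∀ p ∈ closure (crossing Q R (conjFlow F θ T e Δ)), e p ∈ flowDomain F θ Δ T ∧
      ∃ A : ℝ × ℝ →L[ℝ] ℝ × ℝ, HasFDerivAt (conjFlow F θ T e Δ) A p ∧
        ρ ≤ η * (A (1, 0)).1 ∧ 0 < η * (σ.sgn * (A (0, 1)).1) ∧ 0 < η * (τ.sgn * (A (1, 0)).2) ∧
        0 < η * (σ.sgn * (τ.sgn * (A (0, 1)).2))) :
    StripMap γ σ τ Q R (conjFlow F θ T e Δ) (conjFlow F θ T' e Δ') (e ⁻¹' flowDomain F θ Δ T)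
      (e ⁻¹' flowDomain F θ Δ' T') η ρ := by
  have hopen : ∀ {T : ℝ}, T ≠ 0 → ∀ Δ, IsOpen (flowDomain F θ Δ T) := fun hT Δ =>
    isOpen_iff_mem_nhds.2 fun p hp => by
      obtain ⟨C, -, U, hU, h⟩ := flow_local hF hT hp
      have hc : Tendsto (fun q : ℝ × ℝ => (Δ, q)) (𝓝 p) (𝓝 (Δ, p)) :=
        (continuous_const.prodMk continuous_id).tendsto p
      filter_upwards [hc.eventually hU] with q hq using (h _ hq).1
  have hcont : ∀ {T : ℝ}, T ≠ 0 → ∀ Δ,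
      ContinuousOn (conjFlow F θ T e Δ) (e ⁻¹' flowDomain F θ Δ T) := fun hT Δ p hp => by
    have hc : Tendsto (fun q : ℝ × ℝ => (Δ, e q)) (𝓝 p) (𝓝 (Δ, e p)) :=
      (continuous_const.prodMk e.continuous).tendsto p
    exact ((e.continuous.tendsto _).comp ((flow_tendsto hF hT hp).comp hc)).mono_left
      nhdsWithin_le_nhds
  refine
    { nonneg := hγ, quadQ := hQ, quadR := hR
      isOpen_dom := (hopen hs.ne Δ).preimage e.continuous
      cont := hcont hs.ne Δ, cont' := hcont hs.symm.ne Δ'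
      mapsTo' := fun q hq => ?_, mapsTo := fun p hp => ?_
      left_inv := fun p hp => ?_, right_inv := fun q hq => ?_
      Q_subset := hQd, R_subset := hRd
      β_notMem := fun p hp => (hβ p hp).notMem_flowDomain hF hs.ne
      α_notMem := fun p hp => (hα p hp).notMem_flowDomain hF hs.symm.ne
      exists_log := ?_
      nonempty := hne, sign := hη, one_lt := hρ
      mem_dom := fun p hp => (hderiv p hp).1, deriv := fun p hp => (hderiv p hp).2 }
  · simp only [mem_preimage, conjFlow, he]; exact hs.symm.mem_flowDomain hF hq
  · simp only [mem_preimage, conjFlow, he]; exact hs.mem_flowDomain hF hp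
  · simp only [conjFlow, he]; rw [hs.flow_flow hF hp, he]
  · simp only [conjFlow, he]; rw [hs.symm.flow_flow hF hq, he]
  · intro K hK hKd w hw Ψ
    obtain ⟨L, hL, hexp⟩ := flow_exists_log hF hs.ne hs.period (Δ := Δ) (hK.image e.continuous)
      (by rintro _ ⟨p, hp, rfl⟩; exact hKd hp) (e := e w)
      (by rw [hs.angle, ← hs.neg]; exact hα w hw) (e.toHomeomorph.trans Ψ)
    refine ⟨L ∘ e, hL.comp e.continuous.continuousOn (mapsTo_image e K), fun p hp => ?_⟩
    have := hexp (e p) (mem_image_of_mem e hp)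
    simpa [he, conjFlow] using this

/-- For the flow over one period between two continuous families of islands, preimages of strips
are strips. -/
theorem exists_strips (hF : PeriodicC1 F) (he : ∀ p, e (e p) = p) {u : Real.Angle → Real.Angle}
    (hs : ∀ Δ, IsPeriodStep θ T T' Δ (u Δ)) {γ : ℝ} (hγ : 0 ≤ γ) {σ τ : MonoType}
    {Q R : Real.Angle → Quad} (hQ : ∀ Δ, (Q Δ).IsQuadrangle γ σ)
    (hR : ∀ Δ, (R Δ).IsQuadrangle γ τ) (hQc : ContinuousQuads Q) (hRc : ContinuousQuads R)
    (hQd : ∀ Δ, ∀ p ∈ (Q Δ).region, e p ∈ flowDomain F θ Δ T)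
    (hRd : ∀ Δ, ∀ p ∈ (R Δ).region, e p ∈ flowDomain F θ (u Δ) T')
    (hβ : ∀ Δ, ∀ p ∈ (Q Δ).βm.vGraph ∪ (Q Δ).βp.vGraph, CollapsesAt F θ Δ T (e p))
    (hα : ∀ Δ, ∀ p ∈ (R Δ).αm.hGraph ∪ (R Δ).αp.hGraph, CollapsesAt F θ (u Δ) T' (e p))
    (hne : ∀ Δ, (crossing (Q Δ) (R Δ) (conjFlow F θ T e Δ)).Nonempty) {ρ : Real.Angle → ℝ}
    (hρ : ∀ Δ, 1 < ρ Δ)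
    (hderiv : ∀ Δ, ∃ η : ℝ, (η = 1 ∨ η = -1) ∧
      ∀ p ∈ closure (crossing (Q Δ) (R Δ) (conjFlow F θ T e Δ)), e p ∈ flowDomain F θ Δ T ∧
        ∃ A : ℝ × ℝ →L[ℝ] ℝ × ℝ, HasFDerivAt (conjFlow F θ T e Δ) A p ∧
          ρ Δ ≤ η * (A (1, 0)).1 ∧ 0 < η * (σ.sgn * (A (0, 1)).1) ∧
          0 < η * (τ.sgn * (A (1, 0)).2) ∧ 0 < η * (σ.sgn * (τ.sgn * (A (0, 1)).2))) :
    ∃ γ' : ℝ, 0 < γ' ∧ ∀ Δ, ∀ V : VStrip γ τ (R Δ), ∃ V' : VStrip γ' σ (Q Δ),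
      V'.carrier = conjFlow F θ T' e (u Δ) '' V.carrier ∩ (Q Δ).region ∧
      V'.thickness ≤ V.thickness / ρ Δ := by
  choose η hη hA using hderiv
  have S := fun Δ => stripMap_conjFlow hF he (hs Δ) hγ (hQ Δ) (hR Δ) (hQd Δ) (hRd Δ) (hβ Δ) (hα Δ)
    (hne Δ) (hη Δ) (hρ Δ) (hA Δ)
  have hec : Continuous fun x : Real.Angle × ℝ × ℝ => (x.1, e x.2) := by fun_prop
  obtain ⟨C, hC⟩ := StripMap.exists_uniform_bound S hQc hRc
    (fun Δ₀ p₀ hp₀ => by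
      obtain ⟨C, hC, U, hU, h⟩ := flow_local hF (hs Δ₀).ne hp₀
      have hEn : 0 ≤ ‖(e : ℝ × ℝ →L[ℝ] ℝ × ℝ)‖ := norm_nonneg _
      refine ⟨_, mul_nonneg (mul_nonneg hEn hC) hEn, _, hec.continuousAt.preimage_mem_nhds hU,
        fun x hx => ⟨(h _ hx).1, fun p hp => ?_⟩⟩
      have hd : ∀ p q, dist (e p) (e q) ≤ ‖(e : ℝ × ℝ →L[ℝ] ℝ × ℝ)‖ * dist p q := fun p q =>
        (e : ℝ × ℝ →L[ℝ] ℝ × ℝ).dist_le_opNorm p q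
      calc _ ≤ _ := hd _ _
        _ ≤ ‖(e : ℝ × ℝ →L[ℝ] ℝ × ℝ)‖ * (C * (‖(e : ℝ × ℝ →L[ℝ] ℝ × ℝ)‖ * dist x.2 p)) :=
          mul_le_mul_of_nonneg_left (((h _ hx).2 _ hp).trans
            (mul_le_mul_of_nonneg_left (hd _ _) hC)) hEn
        _ = _ := by ring)
    fun Δ₀ p₀ hp₀ => (e.continuous.tendsto _).comp
      ((flow_tendsto hF (hs Δ₀).ne hp₀).comp (hec.tendsto (Δ₀, p₀)))
  refine ⟨max C 0 * (1 + γ) + 1, by positivity, fun Δ V => (S Δ).exists_strip V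
    fun p hp A hA => (hC Δ p hp A hA).trans (le_max_left _ _)⟩

end ConjFlow

lemma image_inter_eq_crossing {Q R : Quad} {f g : ℝ × ℝ → ℝ × ℝ}
    (hl : ∀ p ∈ Q.region, g (f p) = p) (hr : ∀ q ∈ R.region, f (g q) = q) :
    g '' R.region ∩ Q.region = crossing Q R f := by
  ext p
  constructor
  · rintro ⟨⟨q, hq, rfl⟩, hp⟩
    exact ⟨hp, by rwa [hr q hq]⟩
  · rintro ⟨hp, hfp⟩
    exact ⟨⟨f p, hfp, hl p hp⟩, hp⟩

/-! ### Signs of the linearization -/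

/-- The eight patterns are exactly $\eta$ times a rank-one pattern: the second column carries the
factor `σ.sgn`, the second row the factor `τ.sgn`. -/
lemma AdmittedSigns.exists_sign {σ τ : MonoType} {s : Matrix (Fin 2) (Fin 2) SignType}
    (hs : AdmittedSigns σ τ s) : ∃ η : ℝ, (η = 1 ∨ η = -1) ∧
      ∀ M : Matrix (Fin 2) (Fin 2) ℝ, HasSigns M s → 0 < η * M 0 0 ∧ 0 < η * (σ.sgn * M 0 1) ∧
        0 < η * (τ.sgn * M 1 0) ∧ 0 < η * (σ.sgn * (τ.sgn * M 1 1)) := by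
  cases σ <;> cases τ <;> rcases hs with rfl | rfl
  all_goals first
    | (refine ⟨1, Or.inl rfl, fun M hM => ?_⟩
       have h00 := hM 0 0
       have h01 := hM 0 1
       have h10 := hM 1 0
       have h11 := hM 1 1
       simp [sign_eq_one_iff, sign_eq_neg_one_iff] at h00 h01 h10 h11
       simp only [MonoType.sgn]
       refine ⟨?_, ?_, ?_, ?_⟩ <;> linarith)
    | (refine ⟨-1, Or.inr rfl, fun M hM => ?_⟩
       have h00 := hM 0 0
       have h01 := hM 0 1
       have h10 := hM 1 0
       have h11 := hM 1 1
       simp [sign_eq_one_iff, sign_eq_neg_one_iff] at h00 h01 h10 h11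
       simp only [MonoType.sgn]
       refine ⟨?_, ?_, ?_, ?_⟩ <;> linarith)

lemma abs_eq_of_sign {η a : ℝ} (hη : η = 1 ∨ η = -1) (h : 0 < η * a) : |a| = η * a := by
  rcases hη with rfl | rfl
  · rw [abs_of_pos (by linarith)]; ring
  · rw [abs_of_neg (by linarith)]; ring

/-- `fderiv` is zero by default at points of non-differentiability, so the strict sign conditions
themselves supply differentiability. -/
lemma hasFDerivAt_of_jacobian_ne_zero {f : ℝ × ℝ → ℝ × ℝ} {p : ℝ × ℝ}
    (h : jacobian f p 0 0 ≠ 0) : HasFDerivAt f (fderiv ℝ f p) p := by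
  refine DifferentiableAt.hasFDerivAt ?_
  by_contra hn
  exact h (by simp [jacobian, fderiv_zero_of_not_differentiableAt hn])

/-! ### Interchanging the coordinates -/

/-- The interchange of the coordinates of the plane. -/
def swapL : (ℝ × ℝ) ≃L[ℝ] (ℝ × ℝ) := ContinuousLinearEquiv.prodComm ℝ ℝ ℝ

lemma swapL_apply (p : ℝ × ℝ) : swapL p = p.swap := rfl

lemma swap_mem_closure_region {Q : Quad} {p : ℝ × ℝ} :
    p.swap ∈ closure Q.swap.region ↔ p ∈ closure Q.region := by
  rw [Quad.region_swap]
  have := (Homeomorph.prodComm ℝ ℝ).preimage_closure Q.region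
  exact (Set.ext_iff.1 this p.swap).symm

lemma IsHCurve.swap {γ : ℝ} {σ : MonoType} {Q : Quad} {a : Arc} (h : IsHCurve γ σ Q a) :
    IsVCurve γ σ.opp Q.swap a where
  mono := by rw [MonoType.opp_opp]; exact h.mono
  bottom := h.left
  top := h.right
  subset p hp := swap_mem_closure_region.2 (h.subset (show p.swap ∈ a.hGraph from hp))

lemma IsVCurve.of_swap {γ : ℝ} {σ : MonoType} {Q : Quad} {a : Arc}
    (h : IsVCurve γ σ.opp Q.swap a) : IsHCurve γ σ Q a where
  mono := by have := h.mono; rwa [MonoType.opp_opp] at this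
  left := h.bottom
  right := h.top
  subset p hp := swap_mem_closure_region.1 (h.subset (show p.swap ∈ a.vGraph from hp))

/-- An `h`-strip is a `v`-strip in the interchanged coordinates. -/
def HStrip.swap {γ : ℝ} {σ : MonoType} {Q : Quad} (H : HStrip γ σ Q) : VStrip γ σ.opp Q.swap :=
  ⟨H.lower, H.upper, H.lower_curve.swap, H.upper_curve.swap, H.lt⟩

/-- A `v`-strip in the interchanged coordinates is an `h`-strip. -/
def VStrip.ofSwap {γ : ℝ} {σ : MonoType} {Q : Quad} (V : VStrip γ σ.opp Q.swap) : HStrip γ σ Q :=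
  ⟨V.left, V.right, V.left_curve.of_swap, V.right_curve.of_swap, V.lt⟩

lemma HStrip.carrier_swap {γ : ℝ} {σ : MonoType} {Q : Quad} (H : HStrip γ σ Q) :
    H.swap.carrier = Prod.swap '' H.carrier := by
  rw [image_swap_eq_preimage_swap]
  ext p
  simp only [VStrip.carrier, HStrip.carrier, HStrip.swap, Quad.region_swap, mem_ofPred_eq,
    mem_preimage, Prod.fst_swap, Prod.snd_swap]

lemma VStrip.carrier_ofSwap {γ : ℝ} {σ : MonoType} {Q : Quad} (V : VStrip γ σ.opp Q.swap) :
    V.ofSwap.carrier = Prod.swap ⁻¹' V.carrier := by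
  ext p
  simp only [VStrip.carrier, HStrip.carrier, VStrip.ofSwap, Quad.region_swap, mem_ofPred_eq,
    mem_preimage, Prod.fst_swap, Prod.snd_swap, Prod.swap_swap]

/-! ### Application to the donuts, in both directions of time. -/

section Donuts

variable {A : Type*} {F : ℝ → ℝ → ℝ → ℝ} {θ γ : ℝ} {σ : A → MonoType} {D : A → Real.Angle → Quad}

lemma IsDonut.continuousQuads {σ : MonoType} {D : Real.Angle → Quad} (h : IsDonut F θ γ σ D) :
    ContinuousQuads D :=
  ⟨h.αm_cont.2.2, h.αp_cont.2.2, h.βm_cont.2.2, h.βp_cont.2.2⟩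

lemma continuous_add_shift (θ : ℝ) : Continuous fun Δ : Real.Angle => Δ + shift θ := by fun_prop

lemma continuous_sub_shift (θ : ℝ) : Continuous fun Δ : Real.Angle => Δ - shift θ :=
  continuous_id.sub continuous_const

lemma vSet_eq_crossing (hF : PeriodicC1 F) (hD : IsDonutSet F θ γ σ D) (i j : A)
    (Δ : Real.Angle) :
    vSet F θ D i j Δ = crossing (D i Δ) (D j (Δ + shift θ)) (poincare F θ Δ) := by
  have hs := isPeriodStep_add θ Δ
  exact image_inter_eq_crossing
    (fun p hp => hs.flow_flow hF (((hD.donut i).island Δ).subset hp).1)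
    fun q hq => hs.symm.flow_flow hF (((hD.donut j).island _).subset hq).2

lemma hSet_eq_crossing (hF : PeriodicC1 F) (hD : IsDonutSet F θ γ σ D) (i j : A)
    (Δ : Real.Angle) :
    hSet F θ D i j Δ = crossing (D j Δ) (D i (Δ - shift θ)) (poincareInv F θ Δ) := by
  have hs := isPeriodStep_sub θ Δ
  exact image_inter_eq_crossing
    (fun p hp => hs.flow_flow hF (((hD.donut j).island Δ).subset hp).2)
    fun q hq => hs.symm.flow_flow hF (((hD.donut i).island _).subset hq).1

lemma hSet_nonempty (hF : PeriodicC1 F) (hD : IsDonutSet F θ γ σ D) {i j : A} {Δ : Real.Angle}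
    (h : (vSet F θ D i j (Δ - shift θ)).Nonempty) : (hSet F θ D i j Δ).Nonempty := by
  rw [vSet_eq_crossing hF hD] at h
  obtain ⟨p, hp, hfp⟩ := h
  rw [sub_add_cancel] at hfp
  exact ⟨_, ⟨p, hp, rfl⟩, hfp⟩

/-- Under the conditions on the Poincaré map, preimages of `v`-strips are thinner `v`-strips. -/
theorem conclV (hF : PeriodicC1 F) (hγ : 0 ≤ γ) (hD : IsDonutSet F θ γ σ D)
    (hV : ∀ i j Δ, (vSet F θ D i j Δ).Nonempty) {ρ : A → A → Real.Angle → ℝ}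
    (h : ∀ i j Δ, CondH1 F θ σ D i j Δ ∧ CondH2 F θ D i j Δ (ρ i j Δ)) :
    ConclV F θ σ D γ (fun i j Δ => ρ i j (Δ - shift θ)) := by
  intro i j
  have hi := (hD.donut i).island
  have hj := fun Δ => (hD.donut j).island (Δ + shift θ)
  have hcr := fun Δ => vSet_eq_crossing hF hD i j Δ
  obtain ⟨γ', hγ', hs⟩ := exists_strips (e := ContinuousLinearEquiv.refl ℝ (ℝ × ℝ)) hF
    (fun _ => rfl) (isPeriodStep_add θ) hγ (Q := D i) (R := fun Δ => D j (Δ + shift θ))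
    (fun Δ => (hi Δ).quadrangle) (fun Δ => (hj Δ).quadrangle) (hD.donut i).continuousQuads
    ((hD.donut j).continuousQuads.comp (continuous_add_shift θ))
    (fun Δ p hp => ((hi Δ).subset hp).1) (fun Δ p hp => ((hj Δ).subset hp).2)
    (fun Δ => (hi Δ).β_collapse) (fun Δ => (hj Δ).α_collapse)
    (fun Δ => by have := hV i j Δ; rw [hcr] at this; exact this)
    (ρ := ρ i j) (fun Δ => (h i j Δ).2.1) (fun Δ => by
      obtain ⟨⟨s, hs, h1⟩, -, h2⟩ := h i j Δ
      obtain ⟨η, hη, hM⟩ := hs.exists_sign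
      refine ⟨η, hη, fun p hp => ?_⟩
      replace hp : p ∈ closure (vSet F θ D i j Δ) := by rw [hcr]; exact hp
      obtain ⟨m1, m2, m3, m4⟩ := hM _ (h1 p hp).2
      have h2' := h2 p hp
      rw [abs_eq_of_sign hη m1] at h2'
      exact ⟨(h1 p hp).1, _,
        hasFDerivAt_of_jacobian_ne_zero (f := poincare F θ Δ) (fun h0 => by simp [h0] at m1),
        h2', m2, m3, m4⟩)
  refine ⟨γ', hγ', fun Δ => ?_⟩
  beta_reduce
  -- The conclusion is indexed by the slice of the given strip, the strip map by the slice of its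
  -- preimage.
  generalize hΔ : Δ - shift θ = Δ'
  obtain rfl : Δ = Δ' + shift θ := by rw [← hΔ, sub_add_cancel]
  exact hs Δ'

/-- Under the conditions on the inverse Poincaré map, images of `h`-strips are thinner
`h`-strips. -/
theorem conclH (hF : PeriodicC1 F) (hγ : 0 ≤ γ) (hD : IsDonutSet F θ γ σ D)
    (hV : ∀ i j Δ, (vSet F θ D i j Δ).Nonempty) {ρ : A → A → Real.Angle → ℝ}
    (h : ∀ i j Δ, CondV1 F θ σ D i j Δ ∧ CondV2 F θ D i j Δ (ρ i j Δ)) :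
    ConclH F θ σ D γ (fun i j Δ => ρ i j (Δ + shift θ)) := by
  intro i j
  have hi := fun Δ => (hD.donut i).island (Δ - shift θ)
  have hj := (hD.donut j).island
  have hcr : ∀ Δ, crossing (D j Δ).swap (D i (Δ - shift θ)).swap
      (conjFlow F θ (-(2 * Real.pi)) swapL Δ) = swapL ⁻¹' hSet F θ D i j Δ := fun Δ => by
    rw [hSet_eq_crossing hF hD]
    ext p
    simp only [crossing, Quad.region_swap, conjFlow, swapL_apply, mem_ofPred_eq, mem_preimage,
      Prod.swap_swap]
    rfl
  obtain ⟨γ', hγ', hs⟩ := exists_strips (e := swapL) hF (fun _ => rfl) (isPeriodStep_sub θ) hγ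
    (Q := fun Δ => (D j Δ).swap) (R := fun Δ => (D i (Δ - shift θ)).swap)
    (fun Δ => (hj Δ).quadrangle.swap) (fun Δ => (hi Δ).quadrangle.swap)
    (hD.donut j).continuousQuads.swap
    ((hD.donut i).continuousQuads.comp (continuous_sub_shift θ)).swap
    (fun Δ p hp => by rw [Quad.region_swap] at hp; exact ((hj Δ).subset hp).2)
    (fun Δ p hp => by rw [Quad.region_swap] at hp; exact ((hi Δ).subset hp).1)
    (fun Δ p hp => (hj Δ).α_collapse p.swap hp) (fun Δ p hp => (hi Δ).β_collapse p.swap hp)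
    (fun Δ => by
      rw [hcr]
      exact (hSet_nonempty hF hD (hV i j _)).preimage swapL.surjective)
    (ρ := ρ i j) (fun Δ => (h i j Δ).2.1) (fun Δ => by
      obtain ⟨⟨s, hs, h1⟩, -, h2⟩ := h i j Δ
      obtain ⟨η, hη, hM⟩ := hs.exists_sign
      -- After the interchange the entry 1 1 comes first, and its sign is the common sign `η` times
      -- both types.
      have hη' : η * ((σ j).opp.sgn * (σ i).opp.sgn) = 1 ∨
          η * ((σ j).opp.sgn * (σ i).opp.sgn) = -1 := by
        rcases hη with rfl | rfl <;> rcases (σ j).opp.sgn_eq with e1 | e1 <;>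
          rcases (σ i).opp.sgn_eq with e2 | e2 <;> simp [e1, e2]
      have hsq : ∀ μ : MonoType, μ.sgn * μ.sgn = 1 := fun μ => by
        rcases μ.sgn_eq with e | e <;> simp [e]
      refine ⟨_, hη', fun p hp => ?_⟩
      rw [hcr] at hp
      replace hp : swapL p ∈ closure (hSet F θ D i j Δ) := by
        have := swapL.toHomeomorph.preimage_closure (hSet F θ D i j Δ)
        exact (Set.ext_iff.1 this p).2 hp
      obtain ⟨m1, m2, m3, m4⟩ := hM _ (h1 _ hp).2
      have hf := hasFDerivAt_of_jacobian_ne_zero (f := poincareInv F θ Δ) (p := swapL p)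
        (fun h0 => by simp [h0] at m1)
      have m4' : 0 < η * ((σ j).opp.sgn * (σ i).opp.sgn) *
          jacobian (poincareInv F θ Δ) (swapL p) 1 1 := by linarith
      have h2' := h2 _ hp
      rw [abs_eq_of_sign hη' m4'] at h2'
      -- Squares of the type signs are 1, which turns the four inequalities for the original matrix
      -- into those for the interchanged one.
      have e : ∀ a b x : ℝ, η * (a * b) * (a * x) = a * a * (η * (b * x)) ∧
          η * (a * b) * (b * x) = b * b * (η * (a * x)) ∧
          η * (a * b) * (a * (b * x)) = a * a * (b * b * (η * x)) := fun a b x =>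
        ⟨by ring, by ring, by ring⟩
      rw [← one_mul (η * _), ← hsq (σ i).opp, ← one_mul (_ * _), ← hsq (σ j).opp, ← (e _ _ _).2.2]
        at m1
      rw [← one_mul (η * _), ← hsq (σ i).opp, ← (e _ _ _).2.1] at m2
      rw [← one_mul (η * _), ← hsq (σ j).opp, ← (e _ _ _).1] at m3
      exact ⟨(h1 _ hp).1, _, swapL.hasFDerivAt.comp p (hf.comp p swapL.hasFDerivAt), h2', m3, m2,
        m1⟩)
  refine ⟨γ', hγ', fun Δ => ?_⟩
  beta_reduce
  generalize hΔ : Δ + shift θ = Δ'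
  obtain rfl : Δ = Δ' - shift θ := by rw [← hΔ, add_sub_cancel_right]
  intro H
  obtain ⟨V', hV', ht⟩ := hs Δ' H.swap
  refine ⟨V'.ofSwap, ?_, ht⟩
  rw [VStrip.carrier_ofSwap, hV', H.carrier_swap, Quad.region_swap]
  ext p
  simp only [mem_preimage, mem_inter_iff, Prod.swap_swap, mem_image, exists_exists_and_eq_and,
    conjFlow, swapL_apply]
  refine and_congr_left fun _ => exists_congr fun q => and_congr_right fun _ => ?_
  exact Prod.swap_injective.eq_iff

end Donuts

end QuasiStrips

end

open QuasiStrips in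
theorem theorem4 {A : Type*} [Finite A]
    (F : ℝ → ℝ → ℝ → ℝ)
    (hF : ContDiff ℝ 1 fun z : ℝ × ℝ × ℝ => F z.1 z.2.1 z.2.2)
    (hF_zero : ∀ X Y, F X Y 0 = 0)
    (hF_perX : ∀ X Y u, F (X + 2 * Real.pi) Y u = F X Y u)
    (hF_perY : ∀ X Y u, F X (Y + 2 * Real.pi) u = F X Y u)
    (θ : ℝ) (hθ : 1 < θ) (γ : ℝ) (hγ : 0 ≤ γ)
    (σ : A → MonoType) (D : A → Real.Angle → Quad)
    (hD : IsDonutSet F θ γ σ D)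
    (hV : ∀ i j Δ, (vSet F θ D i j Δ).Nonempty) :
    (∀ ρh : A → A → Real.Angle → ℝ,
      (∀ i j Δ, CondH1 F θ σ D i j Δ ∧ CondH2 F θ D i j Δ (ρh i j Δ)) →
        ConclV F θ σ D γ (fun i j Δ => ρh i j (Δ - shift θ))) ∧
    (∀ ρv : A → A → Real.Angle → ℝ,
      (∀ i j Δ, CondV1 F θ σ D i j Δ ∧ CondV2 F θ D i j Δ (ρv i j Δ)) →
        ConclH F θ σ D γ (fun i j Δ => ρv i j (Δ + shift θ))) :=
  ⟨fun _ h => conclV ⟨hF, hF_perX, hF_perY⟩ hγ hD hV h,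
    fun _ h => conclH ⟨hF, hF_perX, hF_perY⟩ hγ hD hV h⟩
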